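/- Let $\mathbf D=\{z\in\mathbf C:|z|<1\}$, let $M_n$ be the space of complex $n\times n$ matrices with the operator norm $\|\cdot\|$ induced by the Euclidean norm, and let $A:\mathbf D\to M_n$ be a matrix-valued function with holomorphic entries such that $I-A(z)A(z)^*$ is positive semidefinite for all $z\in\mathbf D$ and $\det A\not\equiv 0$. Then there are a convergent Blaschke–Potapov product $B$ corresponding to the zeros of $\det A$, a number $0\le L<\infty$, an increasing function $E:[0,L]\to M_n$ with $\operatorname{tr}E(t)=t$ for $t\in[0,L]$, and a right-continuous increasing function $\theta:[0,L]\to[0,2\pi]$ such that for every $z\in\mathbf D$ the multiplicative integral below exists and $$A(z)=B(z)\cdot\overset{\curvearrowright}{\int}_0^L\exp\bigl(h_z(\theta(t))\,dE(t)\bigr),\qquad h_z(\theta)=\frac{z+e^{i\theta}}{z-e^{i\theta}} .$$ Here the following terms are used. * For $w\in\mathbf D$ put $\beta_w(z)=\frac{w-z}{1-\overline w z}\frac{|w|}{w}$ if $w\ne0$, and $\beta_0(z)=z$. A Blaschke–Potapov factor with zero $w$ is a function $b(z)=I-P+\beta_w(z)P$ with an orthogonal projection $P\ne0$ in $M_n$;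 its rank is the rank of $P$. A Blaschke–Potapov product is a finite (possibly empty) or infinite product $U\,b_1(z)b_2(z)\cdots\,V$ of such factors, with constant unitary matrices $U,V$. It is convergent if its partial products converge uniformly on compact subsets of $\mathbf D$. It corresponds to the zeros of $\det A$ if, for every $w\in\mathbf D$, only finitely many of its factors have zero $w$, and the sum of their ranks is the multiplicity of $w$ as a zero of $\det A$ (which is $0$ if $\det A(w)\neq 0$). * $E$ is increasing if $E(t)$ is Hermitian for all $t$ and $E(t)-E(s)$ is positive semidefinite whenever $s\le t$. * For $f:[a,b]\to\mathbf C$ and $E:[a,b]\to M_n$, a matrix $M$ is the multiplicative integral $\overset{\curvearrowright}{\int}_a^b\exp(f\,dE)$ if for every $\varepsilon>0$ there is a partition $\tau_0$ of $[a,b]$ such that for every partition $\tau=\{a=t_0\le t_1\le\dots\le t_m=b\}$ with $\tau\supseteq\tau_0$ and every choice of $\xi_i\in[t_{i-1},t_i]$, $$\Bigl\|e^{f(\xi_1)(E(t_1)-E(t_0))}\,e^{f(\xi_2)(E(t_2)-E(t_1))}\cdots e^{f(\xi_m)(E(t_m)-E(t_{m-1}))}-M\Bigr\|<\varepsilon .$$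 -/

import Mathlib

open scoped Matrix.Norms.L2Operator ComplexOrder

noncomputable section

namespace Potapov

/-- The space `M_n` of complex `n × n` matrices; with the scope opened above, its norm is the
operator norm induced by the Euclidean norm. -/
abbrev Mat (n : ℕ) : Type := Matrix (Fin n) (Fin n) ℂ

/-- The open unit disk. -/
abbrev disk : Set ℂ := Metric.ball (0 : ℂ) 1

/-! ### Multiplicative Stieltjes integrals -/

/-- A tagged partition of `[a, b]`: points `a = t₀ ≤ t₁ ≤ ⋯ ≤ t_m = b` together with
intermediate points `ξ_i ∈ [t_{i-1}, t_i]`. -/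
structure TaggedPartition (a b : ℝ) where
  size : ℕ
  point : Fin (size + 1) → ℝ
  monotone_point : Monotone point
  point_first : point 0 = a
  point_last : point (Fin.last size) = b
  tag : Fin size → ℝ
  tag_mem : ∀ i : Fin size, tag i ∈ Set.Icc (point i.castSucc) (point i.succ)

/-- `τ` refines `σ`: every partition point of `σ` is a partition point of `τ`. -/
def TaggedPartition.Refines {a b : ℝ} (τ σ : TaggedPartition a b) : Prop :=
  Set.range σ.point ⊆ Set.range τ.point

/-- The ordered product
`exp (f(ξ₁) (E(t₁) - E(t₀))) * exp (f(ξ₂) (E(t₂) - E(t₁))) * ⋯ * exp (f(ξ_m) (E(t_m) - E(t_{m-1})))`,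
multiplied from left to right. -/
def multSum {n : ℕ} {a b : ℝ} (f : ℝ → ℂ) (E : ℝ → Mat n) (τ : TaggedPartition a b) : Mat n :=
  (List.ofFn fun i : Fin τ.size =>
    NormedSpace.exp (f (τ.tag i) • (E (τ.point i.succ) - E (τ.point i.castSucc)))).prod

/-- `M` is the (right) multiplicative Stieltjes integral of `exp (f dE)` over `[a, b]`: the net of
ordered products over the tagged partitions, directed by refinement, converges to `M`. -/
def IsMultIntegral {n : ℕ} (a b : ℝ) (f : ℝ → ℂ) (E : ℝ → Mat n) (M : Mat n) : Prop :=
  ∀ ε : ℝ, 0 < ε → ∃ σ : TaggedPartition a b, ∀ τ : TaggedPartition a b,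
    τ.Refines σ → ‖multSum f E τ - M‖ < ε

/-- `E` is an increasing matrix-valued function on `[a, b]`. -/
def IncreasingOn {n : ℕ} (E : ℝ → Mat n) (a b : ℝ) : Prop :=
  (∀ t ∈ Set.Icc a b, (E t).IsHermitian) ∧
    ∀ s ∈ Set.Icc a b, ∀ t ∈ Set.Icc a b, s ≤ t → (E t - E s).PosSemidef

/-- The kernel `h_z(θ) = (z + e^{iθ}) / (z - e^{iθ})`. -/
def herglotz (z : ℂ) (θ : ℝ) : ℂ :=
  (z + Complex.exp (θ * Complex.I)) / (z - Complex.exp (θ * Complex.I))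

/-! ### Contractive analytic matrix-valued functions -/

/-- Analytic matrix-valued functions on the unit disk that are contractive there and whose
determinant does not vanish identically on the disk. -/
structure IsSchur {n : ℕ} (A : ℂ → Mat n) : Prop where
  analytic : ∀ i j : Fin n, DifferentiableOn ℂ (fun z => A z i j) disk
  contractive : ∀ z ∈ disk, (1 - A z * (A z).conjTranspose).PosSemidef
  det_ne_zero : ∃ z ∈ disk, (A z).det ≠ 0

/-! ### Blaschke–Potapov products -/

/-- The scalar Blaschke factor with zero `w`. -/
def blaschke (w z : ℂ) : ℂ :=
  if w = 0 then z else (w - z) / (1 - (starRingEnd ℂ) w * z) * ((‖w‖ : ℂ) / w)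

/-- The Blaschke–Potapov factor `I - P + β_w(z) P`. -/
def bpFactor {n : ℕ} (w : ℂ) (P : Mat n) (z : ℂ) : Mat n :=
  1 - P + blaschke w z • P

/-- A formal Blaschke–Potapov product: finitely or infinitely many factors, numbered by the
`i : ℕ` with `i < length`, each with a zero in the disk and a nonzero orthogonal projection,
and constant unitary matrices on the left and on the right. (The values of `zero` and `proj`
at indices `i ≥ length` play no role.) -/
structure BPProduct (n : ℕ) where
  length : ℕ∞
  zero : ℕ → ℂ
  proj : ℕ → Mat n
  left : Mat n
  right : Mat n
  zero_mem : ∀ i : ℕ, (i : ℕ∞) < length → zero i ∈ disk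
  proj_isStarProjection : ∀ i : ℕ, (i : ℕ∞) < length → IsStarProjection (proj i)
  proj_ne_zero : ∀ i : ℕ, (i : ℕ∞) < length → proj i ≠ 0
  left_unitary : left ∈ Matrix.unitaryGroup (Fin n) ℂ
  right_unitary : right ∈ Matrix.unitaryGroup (Fin n) ℂ

open Classical in
/-- The product of the first `k` factors (of all factors, if there are fewer than `k`), in
order from left to right, with the two unitary constants. -/
def BPProduct.partialProd {n : ℕ} (B : BPProduct n) (k : ℕ) (z : ℂ) : Mat n :=
  B.left *
    ((List.range k).map fun i : ℕ =>
      if (i : ℕ∞) < B.length then bpFactor (B.zero i) (B.proj i) z else 1).prod *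
    B.right

/-- The product converges to the function `F`, uniformly on compact subsets of the disk. -/
def BPProduct.ConvergesTo {n : ℕ} (B : BPProduct n) (F : ℂ → Mat n) : Prop :=
  TendstoLocallyUniformlyOn B.partialProd F Filter.atTop disk

/-- The factors of `B` correspond to the zeros of `g` in the disk: for every point `w` of the
disk, only finitely many factors have their zero at `w`, and their ranks add up to the
multiplicity of `w` as a zero of `g` (which is `0` if `g w ≠ 0`). -/
def BPProduct.CorrespondsToZeros {n : ℕ} (B : BPProduct n) (g : ℂ → ℂ) : Prop :=
  ∀ w ∈ disk, ∃ s : Finset ℕ, (∀ i : ℕ, i ∈ s ↔ (i : ℕ∞) < B.length ∧ B.zero i = w) ∧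
    analyticOrderAt g w = ((∑ i ∈ s, (B.proj i).rank : ℕ) : ℕ∞)

end Potapov

end

/-! First the zeros of `det A` are removed. If `det A` vanishes at `w`, a rank-one projection `P`
kills `A(w)` from the left, so `A = b A'` with the Blaschke–Potapov factor `b` of `w` and `P`. The
maximum principle keeps `A'` contractive, since `‖b⁻¹‖` tends to 1 at the circle, and `det A = β_w
det A'` (`Contractive.exists_factor`). A zero of least modulus is removed at each step. Comparing
determinants at one point gives `∑ (1 - |w_k|) < ∞`, so partial products and remainders both
converge, every zero is used up after finitely many steps, and the limiting remainder has a
zero-free determinant (`Contractive.exists_bpProduct`).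

A contractive function is a pointwise limit of rational inner functions: shrink it, pass to positive
real part by the inverse Cayley transform, replace the Herglotz integral by Riemann sums, transform
back. Each such function is a unitary constant times a finite product of Blaschke–Potapov factors,
and since the zeros may be removed in any order, they can be sorted by argument. If `det A` has no
zeros, the zeros of the approximants move to the circle. A factor with zero `w` equals `exp(h_z(arg
w) (1 - |w|) P)` up to `O((1 - |w|)²)`, while `∑ (1 - |w|)` stays below a bound for `-log |det|` at
0. So the product is asymptotically an ordered product of exponentials, encoded as steps of length
`1 - |w|`; these define a matrix weight with trace `t` and an increasing angle function.

An ultrafilter limit of these data exists by boundedness and plays the role of Helly's selection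
theorem. The products over `[s, t]` converge to a contractive cocycle `Φ(s, t)`. Monotonicity of the
angle gives `‖Φ(s, t) - exp(f(ξ)(E(t) - E(s)))‖ ≤ K (t - s)(G(t) - G(s))` with `G` increasing. Over
a partition these errors add up to at most the mesh times the total increase of `G`, up to a
constant, so `Φ(0, L)` is the multiplicative integral (`isMultIntegral_of_cocycle`,
`exists_multIntegral_of_tendsto`). The remaining unitary constant goes into the Blaschke–Potapov
product. -/

noncomputable section

namespace Potapov

open Matrix Filter Topology Set

/-! ### Contractions, projections and unitary matrices. -/

section MatrixLemmas
variable {n : ℕ}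

-- By the C*-identity `‖X Xᴴ‖ = ‖X‖²`, and a positive element has norm at most 1 exactly when it is
-- at most 1. This turns contractivity into a norm bound, to which the maximum principle applies.
open scoped MatrixOrder in
theorem norm_le_one_iff_posSemidef (X : Mat n) : ‖X‖ ≤ 1 ↔ (1 - X * Xᴴ).PosSemidef := by
  have h0 : (0 : Mat n) ≤ X * Xᴴ := (Matrix.posSemidef_self_mul_conjTranspose X).nonneg
  have h1 : ‖X * Xᴴ‖ = ‖X‖ * ‖X‖ := by
    have := l2_opNorm_conjTranspose_mul_self Xᴴ
    rwa [conjTranspose_conjTranspose, l2_opNorm_conjTranspose] at this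
  rw [← Matrix.le_iff, ← CStarAlgebra.norm_le_one_iff_of_nonneg _ h0, h1]
  constructor <;> intro h <;> nlinarith [norm_nonneg X]

theorem isStarProjection_conjTranspose {P : Mat n} (hP : IsStarProjection P) : Pᴴ = P :=
  hP.isSelfAdjoint

theorem isStarProjection_mul_self {P : Mat n} (hP : IsStarProjection P) : P * P = P :=
  hP.isIdempotentElem

theorem posSemidef_of_isStarProjection {P : Mat n} (hP : IsStarProjection P) : P.PosSemidef := by
  have := Matrix.posSemidef_self_mul_conjTranspose P
  rwa [isStarProjection_conjTranspose hP, isStarProjection_mul_self hP] at this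

/-- For `Y = 1 - P + c P` one has `1 - Y Yᴴ = (1 - |c|²) P`. This covers Blaschke–Potapov factors
and exponentials of multiples of `P` alike. -/
theorem norm_one_sub_add_smul_le_one {P : Mat n} (hP : IsStarProjection P) {c : ℂ} (hc : ‖c‖ ≤ 1) :
    ‖1 - P + c • P‖ ≤ 1 := by
  rw [norm_le_one_iff_posSemidef]
  have h1 := isStarProjection_conjTranspose hP
  have h2 := isStarProjection_mul_self hP
  have : 1 - (1 - P + c • P) * (1 - P + c • P)ᴴ = ((1 - ‖c‖ ^ 2 : ℝ) : ℂ) • P := by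
    have h3 : c * (starRingEnd ℂ) c = ((‖c‖ ^ 2 : ℝ) : ℂ) := by
      rw [Complex.mul_conj, Complex.normSq_eq_norm_sq]
    simp only [conjTranspose_add, conjTranspose_sub, conjTranspose_one, conjTranspose_smul, h1,
      add_mul, mul_add, sub_mul, mul_sub, one_mul, mul_one, smul_mul_assoc, mul_smul_comm, h2]
    rw [Complex.ofReal_sub, ← h3, sub_smul, mul_comm, mul_smul,
      Complex.ofReal_one, one_smul, starRingEnd_apply]
    module
  rw [this]
  refine (posSemidef_of_isStarProjection hP).smul ?_
  rw [Complex.zero_le_real]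
  nlinarith [norm_nonneg c]

theorem norm_isStarProjection_le_one {P : Mat n} (hP : IsStarProjection P) : ‖P‖ ≤ 1 := by
  simpa using norm_one_sub_add_smul_le_one hP.one_sub (c := 0) (by simp)

/-- Only an inequality, because the identity matrix is zero when `n = 0`. -/
theorem norm_one_le_one : ‖(1 : Mat n)‖ ≤ 1 := by
  simpa using norm_one_sub_add_smul_le_one (n := n) (P := 0)
    (IsStarProjection.zero (R := Mat n)) (c := 0) (by simp)

/-- Dividing by `c` leaves the contraction with projection `1 - P` and parameter `c⁻¹`. Used for
inverses of Blaschke–Potapov factors. -/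
theorem norm_one_sub_add_smul_le_norm {P : Mat n} (hP : IsStarProjection P) {c : ℂ}
    (hc : 1 ≤ ‖c‖) : ‖1 - P + c • P‖ ≤ ‖c‖ := by
  have hc0 : c ≠ 0 := by rintro rfl; simp at hc; linarith
  have : 1 - P + c • P = c • (1 - (1 - P) + c⁻¹ • (1 - P)) := by
    rw [smul_add, smul_smul, mul_inv_cancel₀ hc0, one_smul, sub_sub_cancel, add_comm]
  rw [this, norm_smul]
  exact mul_le_of_le_one_right (norm_nonneg _)
    (norm_one_sub_add_smul_le_one hP.one_sub (by rw [norm_inv]; exact inv_le_one_of_one_le₀ hc))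

theorem eigenvalues_mul_conjTranspose_le_one {X : Mat n} (hX : ‖X‖ ≤ 1) (i : Fin n) :
    (isHermitian_mul_conjTranspose_self X).eigenvalues i ≤ 1 := by
  set H := isHermitian_mul_conjTranspose_self X
  have h1 := (norm_le_one_iff_posSemidef X).1 hX
  have h2 := h1.dotProduct_mulVec_nonneg (H.eigenvectorBasis i).ofLp
  rw [sub_mulVec, one_mulVec, H.mulVec_eigenvectorBasis, dotProduct_sub, dotProduct_smul] at h2
  have h3 : star (H.eigenvectorBasis i).ofLp ⬝ᵥ (H.eigenvectorBasis i).ofLp = 1 := by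
    have := H.eigenvectorBasis.orthonormal.1 i
    have h4 : inner ℂ (H.eigenvectorBasis i) (H.eigenvectorBasis i) = (1 : ℂ) := by
      rw [inner_self_eq_norm_sq_to_K, this]; simp
    rw [EuclideanSpace.inner_eq_star_dotProduct] at h4
    rw [← h4, dotProduct_comm]
  rw [h3] at h2
  have h5 : (0 : ℂ) ≤ ((1 - H.eigenvalues i : ℝ) : ℂ) := by
    simpa using h2
  rw [Complex.zero_le_real] at h5
  linarith

theorem eigenvalues_mul_conjTranspose_nonneg (X : Mat n) (i : Fin n) :
    0 ≤ (isHermitian_mul_conjTranspose_self X).eigenvalues i :=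
  (Matrix.posSemidef_self_mul_conjTranspose X).eigenvalues_nonneg i

theorem norm_det_sq_eq_prod (X : Mat n) :
    ‖X.det‖ ^ 2 = ∏ i, (isHermitian_mul_conjTranspose_self X).eigenvalues i := by
  have := (isHermitian_mul_conjTranspose_self X).det_eq_prod_eigenvalues
  rw [det_mul, det_conjTranspose] at this
  have h : X.det * star X.det = ((‖X.det‖ ^ 2 : ℝ) : ℂ) := by
    rw [← Complex.normSq_eq_norm_sq, ← Complex.mul_conj]; rfl
  rw [h] at this
  have h2 : ((‖X.det‖ ^ 2 : ℝ) : ℂ) =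
      ((∏ i, (isHermitian_mul_conjTranspose_self X).eigenvalues i : ℝ) : ℂ) := by
    rw [this]; simp
  exact_mod_cast h2

theorem norm_det_le_one {X : Mat n} (hX : ‖X‖ ≤ 1) : ‖X.det‖ ≤ 1 := by
  have : ‖X.det‖ ^ 2 ≤ 1 := by
    rw [norm_det_sq_eq_prod]
    exact Finset.prod_le_one (fun i _ => eigenvalues_mul_conjTranspose_nonneg X i)
      fun i _ => eigenvalues_mul_conjTranspose_le_one hX i
  nlinarith [norm_nonneg X.det]

/-- The eigenvalues of `X Xᴴ` lie in `[0, 1]` and their product is `|det X|² = 1`, so all of them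
are 1. -/
theorem mem_unitaryGroup_of_norm_det {X : Mat n} (hX : ‖X‖ ≤ 1) (hdet : ‖X.det‖ = 1) :
    X ∈ unitaryGroup (Fin n) ℂ := by
  rw [mem_unitaryGroup_iff]
  set H := isHermitian_mul_conjTranspose_self X
  have hp : ∏ i, H.eigenvalues i = 1 := by rw [← norm_det_sq_eq_prod, hdet, one_pow]
  have he : ∀ i, H.eigenvalues i = 1 := by
    intro i
    refine le_antisymm (eigenvalues_mul_conjTranspose_le_one hX i) ?_
    rw [← hp, ← Finset.mul_prod_erase _ _ (Finset.mem_univ i)]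
    exact mul_le_of_le_one_right (eigenvalues_mul_conjTranspose_nonneg X i)
      (Finset.prod_le_one (fun i _ => eigenvalues_mul_conjTranspose_nonneg X i)
      fun i _ => eigenvalues_mul_conjTranspose_le_one hX i)
  have hs := H.spectral_theorem
  have hd : (RCLike.ofReal ∘ H.eigenvalues : Fin n → ℂ) = fun _ => 1 := by
    ext i; simp [he i]
  rw [hd, diagonal_one, map_one] at hs
  exact hs

theorem norm_le_one_of_mem_unitaryGroup {U : Mat n} (hU : U ∈ unitaryGroup (Fin n) ℂ) :
    ‖U‖ ≤ 1 := by
  rw [norm_le_one_iff_posSemidef]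
  have : U * Uᴴ = 1 := mem_unitaryGroup_iff.1 hU
  rw [this, sub_self]
  exact PosSemidef.zero

theorem norm_det_of_mem_unitaryGroup {U : Mat n} (hU : U ∈ unitaryGroup (Fin n) ℂ) :
    ‖U.det‖ = 1 := by
  have : U * Uᴴ = 1 := mem_unitaryGroup_iff.1 hU
  have h := congrArg (fun M : Mat n => ‖M.det‖) this
  simp only [det_mul, det_conjTranspose, det_one, norm_mul, norm_star, norm_one] at h
  nlinarith [norm_nonneg U.det]

/-- A nonzero vector in the left kernel of a singular matrix yields a rank-one projection that
annihilates the matrix from the left. -/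
theorem exists_rankOne_projection {X : Mat n} (hX : X.det = 0) :
    ∃ P : Mat n, IsStarProjection P ∧ P.trace = 1 ∧ P.rank = 1 ∧ P * X = 0 ∧
      ∀ c : ℂ, (1 - P + c • P).det = c := by
  obtain ⟨u, hu0, hu⟩ := exists_vecMul_eq_zero_iff.2 hX
  have hnorm : (0 : ℝ) < ‖WithLp.toLp 2 u‖ := by
    rw [norm_pos_iff]
    intro h
    exact hu0 (by simpa using congrArg WithLp.ofLp h)
  set a : ℝ := ‖WithLp.toLp 2 u‖
  -- The conjugate makes `star v` proportional to the left kernel vector `u`, so that `v v*`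
  -- annihilates `X` from the left.
  set v : Fin n → ℂ := ((a⁻¹ : ℝ) : ℂ) • star u with hv
  have huu : u ⬝ᵥ star u = ((a ^ 2 : ℝ) : ℂ) := by
    have := inner_self_eq_norm_sq_to_K (𝕜 := ℂ) (WithLp.toLp 2 u)
    rw [EuclideanSpace.inner_eq_star_dotProduct] at this
    simpa [a] using this
  have hsv : star v = ((a⁻¹ : ℝ) : ℂ) • u := by
    rw [hv, star_smul, star_star]; simp
  have hvv : star v ⬝ᵥ v = 1 := by
    rw [hsv, hv, smul_dotProduct, dotProduct_smul, huu]
    simp only [smul_eq_mul]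
    rw [← Complex.ofReal_mul, ← Complex.ofReal_mul]
    norm_cast
    field_simp
  have hv0 : v ≠ 0 := by
    rintro h; rw [h] at hvv; simp at hvv
  refine ⟨vecMulVec v (star v), ⟨?_, ?_⟩, ?_, ?_, ?_, ?_⟩
  · change _ * _ = _
    rw [vecMulVec_mul_vecMulVec, hvv, one_smul]
  · change star _ = _
    rw [star_eq_conjTranspose, conjTranspose_vecMulVec, star_star]
  · rw [trace_vecMulVec, dotProduct_comm, hvv]
  · refine le_antisymm (rank_vecMulVec_le _ _) ?_
    rw [Nat.one_le_iff_ne_zero]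
    intro h
    rw [Matrix.rank, Submodule.finrank_eq_zero, LinearMap.range_eq_bot] at h
    have h2 := LinearMap.congr_fun h v
    rw [mulVecLin_apply, vecMulVec_mulVec, hvv] at h2
    exact hv0 (by simpa using h2)
  · rw [vecMulVec_mul, hsv, smul_vecMul, hu, smul_zero, vecMulVec_zero]
  · intro c
    have : (1 : Mat n) - vecMulVec v (star v) + c • vecMulVec v (star v) =
        1 + vecMulVec ((c - 1) • v) (star v) := by
      rw [smul_vecMulVec (c - 1) v, sub_smul (M := Mat n), one_smul]
      abel
    rw [this, vecMulVec_eq Unit, det_one_add_replicateCol_mul_replicateRow, dotProduct_smul, hvv]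
    simp

end MatrixLemmas

/-! ### Scalar Blaschke factors. -/

section Blaschke

theorem one_sub_conj_mul_ne_zero {w z : ℂ} (hw : ‖w‖ ≤ 1) (hz : ‖z‖ < 1) :
    1 - (starRingEnd ℂ) w * z ≠ 0 := by
  intro h
  have h1 : (starRingEnd ℂ) w * z = 1 := (sub_eq_zero.1 h).symm
  have h2 : ‖w‖ * ‖z‖ = 1 := by
    rw [← RCLike.norm_conj w, ← norm_mul, h1, norm_one]
  nlinarith [norm_nonneg w, norm_nonneg z]

theorem norm_blaschke (w z : ℂ) :
    ‖blaschke w z‖ = ‖w - z‖ / ‖1 - (starRingEnd ℂ) w * z‖ := by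
  unfold blaschke
  split_ifs with h
  · simp [h]
  · have : ‖w‖ ≠ 0 := by simpa using h
    simp [this]

theorem one_sub_norm_blaschke_sq {w z : ℂ} (hw : ‖w‖ ≤ 1) (hz : ‖z‖ < 1) :
    1 - ‖blaschke w z‖ ^ 2 =
      (1 - ‖w‖ ^ 2) * (1 - ‖z‖ ^ 2) / ‖1 - (starRingEnd ℂ) w * z‖ ^ 2 := by
  have h0 := one_sub_conj_mul_ne_zero hw hz
  have h1 : ‖1 - (starRingEnd ℂ) w * z‖ ^ 2 ≠ 0 := by positivity
  rw [norm_blaschke, div_pow, eq_div_iff h1, sub_mul, div_mul_cancel₀ _ h1]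
  simp only [← Complex.normSq_eq_norm_sq, Complex.normSq_apply]
  simp
  ring

theorem norm_one_sub_conj_mul_le {w z : ℂ} (hw : ‖w‖ ≤ 1) (hz : ‖z‖ < 1) :
    ‖1 - (starRingEnd ℂ) w * z‖ ≤ 2 := by
  calc _ ≤ ‖(1 : ℂ)‖ + ‖(starRingEnd ℂ) w * z‖ := norm_sub_le _ _
    _ = 1 + ‖w‖ * ‖z‖ := by rw [norm_mul, RCLike.norm_conj, norm_one]
    _ ≤ 2 := by nlinarith [norm_nonneg w, norm_nonneg z]

theorem one_sub_norm_le_norm_one_sub_conj_mul {w z : ℂ} (hw : ‖w‖ ≤ 1) :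
    1 - ‖z‖ ≤ ‖1 - (starRingEnd ℂ) w * z‖ := by
  calc 1 - ‖z‖ ≤ ‖(1 : ℂ)‖ - ‖(starRingEnd ℂ) w * z‖ := by
        rw [norm_mul, RCLike.norm_conj, norm_one]; nlinarith [norm_nonneg w, norm_nonneg z]
    _ ≤ _ := norm_sub_norm_le _ _

theorem norm_blaschke_le_one {w z : ℂ} (hw : ‖w‖ ≤ 1) (hz : ‖z‖ < 1) : ‖blaschke w z‖ ≤ 1 := by
  have h := one_sub_norm_blaschke_sq hw hz
  have : 0 ≤ (1 - ‖w‖ ^ 2) * (1 - ‖z‖ ^ 2) / ‖1 - (starRingEnd ℂ) w * z‖ ^ 2 := by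
    have h1 : 0 ≤ 1 - ‖w‖ ^ 2 := by nlinarith [norm_nonneg w]
    have h2 : 0 ≤ 1 - ‖z‖ ^ 2 := by nlinarith [norm_nonneg z]
    positivity
  nlinarith [norm_nonneg (blaschke w z)]

/-- The source of the Blaschke condition. In the constant, 4 comes from `|1 - w̄ z|² ≤ 4` and 2 from
`1 - x² ≤ 2 (1 - x)` on `[0, 1]`. -/
theorem le_one_sub_norm_blaschke {w z : ℂ} (hw : ‖w‖ ≤ 1) (hz : ‖z‖ < 1) :
    (1 - ‖z‖ ^ 2) / 8 * (1 - ‖w‖) ≤ 1 - ‖blaschke w z‖ := by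
  have h := one_sub_norm_blaschke_sq hw hz
  have h0 := one_sub_conj_mul_ne_zero hw hz
  have hle := norm_one_sub_conj_mul_le hw hz
  have h1 : 0 ≤ 1 - ‖w‖ := by linarith
  have h2 : 0 ≤ 1 - ‖z‖ ^ 2 := by nlinarith [norm_nonneg z]
  have h3 : (1 - ‖w‖) * (1 - ‖z‖ ^ 2) / 4 ≤ 1 - ‖blaschke w z‖ ^ 2 := by
    rw [h]
    have : 0 < ‖1 - (starRingEnd ℂ) w * z‖ := norm_pos_iff.2 h0
    apply div_le_div₀
    · have : 0 ≤ 1 - ‖w‖ ^ 2 := by nlinarith [norm_nonneg w]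
      positivity
    · apply mul_le_mul_of_nonneg_right _ h2
      nlinarith [norm_nonneg w]
    · positivity
    · nlinarith
  have h4 := norm_blaschke_le_one hw hz
  nlinarith [norm_nonneg (blaschke w z)]

theorem one_sub_norm_blaschke_sq_le {w z : ℂ} (hw : ‖w‖ < 1) (hz : ‖z‖ < 1) :
    1 - ‖blaschke w z‖ ^ 2 ≤ (1 - ‖z‖ ^ 2) / (1 - ‖w‖) ^ 2 := by
  rw [one_sub_norm_blaschke_sq hw.le hz]
  have h1 : 1 - ‖w‖ ≤ ‖1 - (starRingEnd ℂ) w * z‖ := by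
    have := one_sub_norm_le_norm_one_sub_conj_mul (w := z) (z := w) hz.le
    have h2 : ‖1 - (starRingEnd ℂ) z * w‖ = ‖1 - (starRingEnd ℂ) w * z‖ := by
      rw [← RCLike.norm_conj]; simp [mul_comm]
    rwa [h2] at this
  have h3 : 0 < 1 - ‖w‖ := by linarith
  have h4 : 0 ≤ 1 - ‖z‖ ^ 2 := by nlinarith [norm_nonneg z]
  apply div_le_div₀ h4
  · nlinarith [norm_nonneg w, sq_nonneg ‖w‖]
  · positivity
  · exact pow_le_pow_left₀ h3.le h1 2

/-- In the rotated variable `u = ē z` the factor is `(ρ - u) / (1 - ρ u)`, which makes its expansion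
in `1 - ρ` explicit. -/
theorem blaschke_polar {ρ : ℝ} (hρ : 0 < ρ) {e z : ℂ} (he : ‖e‖ = 1) :
    blaschke (ρ * e) z = (ρ - (starRingEnd ℂ) e * z) / (1 - ρ * ((starRingEnd ℂ) e * z)) := by
  have he0 : e ≠ 0 := by rintro rfl; simp at he
  have hρ0 : (ρ : ℂ) ≠ 0 := by exact_mod_cast hρ.ne'
  have hee : (starRingEnd ℂ) e * e = 1 := by
    rw [mul_comm, Complex.mul_conj, Complex.normSq_eq_norm_sq, he]; simp
  have hinv : e⁻¹ = (starRingEnd ℂ) e := by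
    field_simp; rw [mul_comm]; exact hee.symm
  unfold blaschke
  rw [if_neg (mul_ne_zero hρ0 he0)]
  simp only [norm_mul, he, mul_one, Complex.norm_real, Real.norm_eq_abs, abs_of_pos hρ, map_mul,
    Complex.conj_ofReal]
  have : (ρ : ℂ) / (ρ * e) = (starRingEnd ℂ) e := by
    rw [← hinv]; field_simp
  rw [this, div_mul_eq_mul_div, mul_assoc]
  congr 1
  linear_combination (ρ : ℂ) * hee

theorem exists_polar (w : ℂ) : ∃ e : ℂ, ‖e‖ = 1 ∧ w = (‖w‖ : ℂ) * e :=
  ⟨Complex.exp (w.arg * Complex.I), Complex.norm_exp_ofReal_mul_I _,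
    (Complex.norm_mul_exp_arg_mul_I w).symm⟩

theorem norm_one_sub_blaschke_le {w z : ℂ} (hw : ‖w‖ ≤ 1) (hz : ‖z‖ < 1) :
    ‖1 - blaschke w z‖ ≤ 2 / (1 - ‖z‖) * (1 - ‖w‖) := by
  have hz' : 0 < 1 - ‖z‖ := by linarith
  by_cases h0 : w = 0
  · subst h0
    simp only [blaschke, if_true, norm_zero, sub_zero, mul_one]
    rw [le_div_iff₀ hz']
    have : ‖1 - z‖ ≤ 1 + ‖z‖ := by simpa using norm_sub_le (1 : ℂ) z
    nlinarith [norm_nonneg z]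
  · obtain ⟨e, he, hwe⟩ := exists_polar w
    set ρ := ‖w‖
    have hρ : 0 < ρ := norm_pos_iff.2 h0
    set u := (starRingEnd ℂ) e * z with hu
    have hun : ‖u‖ = ‖z‖ := by rw [hu, norm_mul, RCLike.norm_conj, he, one_mul]
    have hlow : 1 - ‖z‖ ≤ ‖1 - (ρ : ℂ) * u‖ := by
      have h1 : ‖(1 : ℂ)‖ - ‖(ρ : ℂ) * u‖ ≤ _ := norm_sub_norm_le _ _
      rw [norm_mul, hun, Complex.norm_real, Real.norm_eq_abs, abs_of_pos hρ, norm_one] at h1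
      nlinarith [norm_nonneg z]
    have hne : 1 - (ρ : ℂ) * u ≠ 0 := norm_pos_iff.1 (by linarith)
    have : 1 - blaschke w z = (1 - ρ : ℝ) * (1 + u) / (1 - ρ * u) := by
      rw [hwe, blaschke_polar hρ he, ← hu]
      field_simp
      push_cast
      ring
    rw [this, norm_div, norm_mul, Complex.norm_real, Real.norm_eq_abs, abs_of_nonneg (by linarith)]
    have h2 : ‖1 + u‖ ≤ 2 := by
      have := norm_add_le (1 : ℂ) u
      rw [norm_one, hun] at this; linarith
    rw [div_mul_eq_mul_div]
    apply div_le_div₀ (by nlinarith) _ hz' hlow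
    nlinarith

/-- With `u = e^{-iθ} z` the kernel is `-(1 + u) / (1 - u)`, exactly the first-order term of the
factor as its zero tends radially to `e^{iθ}`. The remainder is `(1 - ρ)² u (1 + u) / ((1 - ρ u)(1 -
u))`. -/
theorem norm_blaschke_sub_one_sub_le {ρ θ : ℝ} (hρ : 0 < ρ) (hρ1 : ρ ≤ 1) {z : ℂ} (hz : ‖z‖ < 1) :
    ‖blaschke (ρ * Complex.exp (θ * Complex.I)) z - 1 - herglotz z θ * ((1 - ρ : ℝ) : ℂ)‖ ≤
      2 / (1 - ‖z‖) ^ 2 * (1 - ρ) ^ 2 := by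
  set e := Complex.exp (θ * Complex.I) with hedef
  have he : ‖e‖ = 1 := Complex.norm_exp_ofReal_mul_I _
  have he0 : e ≠ 0 := Complex.exp_ne_zero _
  have hz' : 0 < 1 - ‖z‖ := by linarith
  set u := (starRingEnd ℂ) e * z with hu
  have hun : ‖u‖ = ‖z‖ := by rw [hu, norm_mul, RCLike.norm_conj, he, one_mul]
  have hlow : 1 - ‖z‖ ≤ ‖1 - (ρ : ℂ) * u‖ := by
    have h1 : ‖(1 : ℂ)‖ - ‖(ρ : ℂ) * u‖ ≤ _ := norm_sub_norm_le _ _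
    rw [norm_mul, hun, Complex.norm_real, Real.norm_eq_abs, abs_of_pos hρ, norm_one] at h1
    nlinarith [norm_nonneg z]
  have hlow' : 1 - ‖z‖ ≤ ‖1 - u‖ := by
    have h1 : ‖(1 : ℂ)‖ - ‖u‖ ≤ _ := norm_sub_norm_le _ _
    rwa [hun, norm_one] at h1
  have hne : 1 - (ρ : ℂ) * u ≠ 0 := norm_pos_iff.1 (by linarith)
  have hne' : 1 - u ≠ 0 := norm_pos_iff.1 (by linarith)
  have hee : (starRingEnd ℂ) e * e = 1 := by
    rw [mul_comm, Complex.mul_conj, Complex.normSq_eq_norm_sq, he]; simp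
  have hz_eq : z = e * u := by rw [hu, ← mul_assoc, mul_comm e, hee, one_mul]
  have hh : herglotz z θ = -(1 + u) / (1 - u) := by
    unfold herglotz
    rw [← hedef]
    have h1 : z - e ≠ 0 := by
      have : z - e = -e * (1 - u) := by rw [hz_eq]; ring
      rw [this]; exact mul_ne_zero (neg_ne_zero.2 he0) hne'
    rw [div_eq_div_iff h1 hne']
    rw [hz_eq]; ring
  have key : blaschke (ρ * e) z - 1 - herglotz z θ * ((1 - ρ : ℝ) : ℂ) =
      ((1 - ρ : ℝ) : ℂ) ^ 2 * (u * (1 + u)) / ((1 - ρ * u) * (1 - u)) := by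
    rw [blaschke_polar hρ he, hh, ← hu]
    field_simp
    push_cast
    ring
  rw [key, norm_div, norm_mul, norm_mul (1 - (ρ : ℂ) * u), norm_mul u, norm_pow,
    Complex.norm_real, Real.norm_eq_abs,
    sq_abs, div_mul_eq_mul_div]
  have h2 : ‖1 + u‖ ≤ 2 := by
    have := norm_add_le (1 : ℂ) u
    rw [norm_one, hun] at this; linarith
  have h3 : ‖u‖ ≤ 1 := by rw [hun]; exact hz.le
  apply div_le_div₀ (by positivity) _ (by positivity)
  · rw [sq]; exact mul_le_mul hlow hlow' hz'.le (norm_nonneg _)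
  · rw [mul_comm]
    apply mul_le_mul_of_nonneg_right _ (sq_nonneg _)
    calc ‖u‖ * ‖1 + u‖ ≤ 1 * 2 := mul_le_mul h3 h2 (norm_nonneg _) zero_le_one
      _ = 2 := one_mul 2

/-- Allows `w = 1` as a dummy zero: its factor is trivial and contributes nothing to `∑ (1 - ‖w‖)`.
-/
theorem blaschke_one {z : ℂ} (hz : ‖z‖ < 1) : blaschke 1 z = 1 := by
  have : (1 : ℂ) - z ≠ 0 := by
    intro h; rw [← sub_eq_zero.1 h] at hz; simp at hz
  simp [blaschke, this]

theorem norm_blaschke_zero (w : ℂ) : ‖blaschke w 0‖ = ‖w‖ := by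
  rw [norm_blaschke]; simp

theorem blaschke_eq_zero_iff {w z : ℂ} (hw : ‖w‖ ≤ 1) (hz : ‖z‖ < 1) :
    blaschke w z = 0 ↔ z = w := by
  rw [← norm_eq_zero, norm_blaschke, div_eq_zero_iff, norm_eq_zero, norm_eq_zero, sub_eq_zero]
  simp only [one_sub_conj_mul_ne_zero hw hz, or_false]
  exact eq_comm

/-- The quotient of a Blaschke factor by `z - w`. -/
def blaschkeQuot (w z : ℂ) : ℂ :=
  if w = 0 then 1 else -((‖w‖ : ℂ) / w) / (1 - (starRingEnd ℂ) w * z)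

theorem blaschke_eq_mul (w z : ℂ) : blaschke w z = (z - w) * blaschkeQuot w z := by
  unfold blaschke blaschkeQuot
  split_ifs with h
  · simp [h]
  · ring

theorem blaschkeQuot_ne_zero {w z : ℂ} (hw : ‖w‖ ≤ 1) (hz : ‖z‖ < 1) : blaschkeQuot w z ≠ 0 := by
  unfold blaschkeQuot
  split_ifs with h
  · exact one_ne_zero
  · have := one_sub_conj_mul_ne_zero hw hz
    have h2 : (‖w‖ : ℂ) ≠ 0 := by simpa using h
    exact div_ne_zero (neg_ne_zero.2 (div_ne_zero h2 h)) this

theorem differentiableOn_blaschkeQuot {w : ℂ} (hw : ‖w‖ ≤ 1) :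
    DifferentiableOn ℂ (blaschkeQuot w) disk := by
  unfold blaschkeQuot
  split_ifs with h
  · exact differentiableOn_const _
  · refine DifferentiableOn.div (differentiableOn_const _) (by fun_prop) fun z hz => ?_
    exact one_sub_conj_mul_ne_zero hw (mem_ball_zero_iff.1 hz)

theorem differentiableOn_blaschke {w : ℂ} (hw : ‖w‖ ≤ 1) :
    DifferentiableOn ℂ (blaschke w) disk := by
  have : blaschke w = fun z => (z - w) * blaschkeQuot w z := funext fun z => blaschke_eq_mul w z
  rw [this]
  exact DifferentiableOn.mul (by fun_prop) (differentiableOn_blaschkeQuot hw)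

theorem analyticOrderAt_blaschke {w z : ℂ} (hw : ‖w‖ ≤ 1) (hz : ‖z‖ < 1) :
    analyticOrderAt (blaschke w) z = if z = w then 1 else 0 := by
  have hd : z ∈ disk := mem_ball_zero_iff.2 hz
  have han : AnalyticAt ℂ (blaschke w) z :=
    (differentiableOn_blaschke hw).analyticAt (Metric.isOpen_ball.mem_nhds hd)
  split_ifs with h
  · subst h
    have := (han.analyticOrderAt_eq_natCast (n := 1)).2
      ⟨blaschkeQuot z, (differentiableOn_blaschkeQuot hw).analyticAt
        (Metric.isOpen_ball.mem_nhds hd), blaschkeQuot_ne_zero hw hz,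
        Eventually.of_forall fun x => by simp [blaschke_eq_mul]⟩
    exact_mod_cast this
  · rw [han.analyticOrderAt_eq_zero]
    exact fun h' => h ((blaschke_eq_zero_iff hw hz).1 h')

end Blaschke

/-! ### Contractive holomorphic functions and the removal of one zero. -/

section Contractive
variable {n : ℕ}

theorem differentiableOn_entry {A : ℂ → Mat n} {s : Set ℂ} (hA : DifferentiableOn ℂ A s)
    (i j : Fin n) : DifferentiableOn ℂ (fun z => A z i j) s :=
  (LinearMap.toContinuousLinearMap (entryLinearMap ℂ ℂ i j :
    Mat n →ₗ[ℂ] ℂ)).differentiable.comp_differentiableOn hA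

theorem differentiableOn_of_entry {A : ℂ → Mat n} {s : Set ℂ}
    (hA : ∀ i j, DifferentiableOn ℂ (fun z => A z i j) s) : DifferentiableOn ℂ A s := by
  have : A = fun z => ∑ i, ∑ j, A z i j • Matrix.single i j (1 : ℂ) := by
    funext z
    conv_lhs => rw [matrix_eq_sum_single (A z)]
    simp [smul_single]
  rw [this]
  exact DifferentiableOn.fun_sum fun i _ => DifferentiableOn.fun_sum fun j _ =>
    (hA i j).smul_const _

theorem differentiableOn_det {A : ℂ → Mat n} {s : Set ℂ} (hA : DifferentiableOn ℂ A s) :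
    DifferentiableOn ℂ (fun z => (A z).det) s := by
  simp only [det_apply]
  exact DifferentiableOn.fun_sum fun σ _ => DifferentiableOn.const_smul
    (DifferentiableOn.fun_finsetProd fun i _ => differentiableOn_entry hA _ _) _

/-- Matrix-valued holomorphic functions on the disk whose values are contractions. -/
structure Contractive (A : ℂ → Mat n) : Prop where
  diff : DifferentiableOn ℂ A disk
  norm_le : ∀ z ∈ disk, ‖A z‖ ≤ 1

theorem IsSchur.toContractive {A : ℂ → Mat n} (hA : IsSchur A) : Contractive A :=
  ⟨differentiableOn_of_entry hA.analytic,
    fun z hz => (norm_le_one_iff_posSemidef _).2 (hA.contractive z hz)⟩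

theorem Contractive.det_diff {A : ℂ → Mat n} (hA : Contractive A) :
    DifferentiableOn ℂ (fun z => (A z).det) disk := differentiableOn_det hA.diff

theorem Contractive.norm_det_le {A : ℂ → Mat n} (hA : Contractive A) {z : ℂ} (hz : z ∈ disk) :
    ‖(A z).det‖ ≤ 1 := norm_det_le_one (hA.norm_le z hz)

/-- A version of the maximum principle: boundary bounds that tend to `1`. -/
theorem norm_le_one_of_boundary {F : Type*} [NormedAddCommGroup F] [NormedSpace ℂ F] {f : ℂ → F}
    (hf : DifferentiableOn ℂ f disk)
    (hb : ∀ ε > 0, ∃ r < 1, ∀ z, r < ‖z‖ → ‖z‖ < 1 → ‖f z‖ ≤ 1 + ε) {z : ℂ} (hz : z ∈ disk) :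
    ‖f z‖ ≤ 1 := by
  refine le_of_forall_pos_le_add fun ε hε => ?_
  obtain ⟨r, hr, h⟩ := hb ε hε
  have hz1 : ‖z‖ < 1 := mem_ball_zero_iff.1 hz
  obtain ⟨ρ, hρ1, hρ2⟩ := exists_between (max_lt hr hz1)
  have hρ0 : 0 < ρ := (norm_nonneg z).trans_lt ((le_max_right _ _).trans_lt hρ1)
  refine Complex.norm_le_of_forall_mem_frontier_norm_le (U := Metric.ball 0 ρ)
    Metric.isBounded_ball (DifferentiableOn.diffContOnCl (hf.mono ?_)) (fun y hy => ?_)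
    (subset_closure (mem_ball_zero_iff.2 ((le_max_right _ _).trans_lt hρ1)))
  · exact Metric.closure_ball_subset_closedBall.trans (Metric.closedBall_subset_ball hρ2)
  · rw [frontier_ball _ hρ0.ne', mem_sphere_zero_iff_norm] at hy
    exact h y (by rw [hy]; exact (le_max_left _ _).trans_lt hρ1) (by rw [hy]; exact hρ2)

theorem bpFactor_mul_inv {w : ℂ} {P : Mat n} (hP : IsStarProjection P) {z : ℂ}
    (hz : blaschke w z ≠ 0) :
    (1 - P + (blaschke w z)⁻¹ • P) * bpFactor w P z = 1 := by
  have h2 := isStarProjection_mul_self hP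
  unfold bpFactor
  simp only [add_mul, mul_add, sub_mul, mul_sub, one_mul, mul_one, smul_mul_assoc, mul_smul_comm,
    h2, sub_self]
  rw [zero_add, smul_smul, mul_inv_cancel₀ hz, one_smul]
  simp

/-- The bound `1 - |β_w(z)|² ≤ (1 - |z|²) / (1 - |w|)²` tends to 0 at the circle, which gives the
boundary control that `norm_le_one_of_boundary` asks for. -/
theorem norm_inv_blaschke_le {w : ℂ} (hw : ‖w‖ < 1) {ε : ℝ} (hε : 0 < ε) :
    ∃ r < 1, ∀ z, r < ‖z‖ → ‖z‖ < 1 → blaschke w z ≠ 0 ∧ ‖(blaschke w z)⁻¹‖ ≤ 1 + ε := by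
  have h1 : Tendsto (fun t : ℝ => 1 - (1 - t ^ 2) / (1 - ‖w‖) ^ 2) (𝓝 1) (𝓝 1) := by
    have : Continuous fun t : ℝ => 1 - (1 - t ^ 2) / (1 - ‖w‖) ^ 2 := by fun_prop
    simpa using this.tendsto 1
  have h2 : ((1 + ε)⁻¹) ^ 2 < 1 := by
    have : (1 + ε)⁻¹ < 1 := inv_lt_one_of_one_lt₀ (by linarith)
    have h0 : 0 < (1 + ε)⁻¹ := by positivity
    nlinarith
  obtain ⟨δ, hδ, h⟩ := Metric.eventually_nhds_iff.1 (h1.eventually_const_lt h2)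
  refine ⟨1 - δ, by linarith, fun z hz1 hz2 => ?_⟩
  have h3 := h (y := ‖z‖) (by rw [Real.dist_eq, abs_lt]; constructor <;> linarith)
  have h4 := one_sub_norm_blaschke_sq_le hw hz2
  have h5 : ((1 + ε)⁻¹) ^ 2 < ‖blaschke w z‖ ^ 2 := by linarith
  have h6 : (1 + ε)⁻¹ < ‖blaschke w z‖ := lt_of_pow_lt_pow_left₀ 2 (norm_nonneg _) h5
  have h0 : 0 < (1 + ε)⁻¹ := by positivity
  refine ⟨norm_pos_iff.1 (h0.trans h6), ?_⟩
  rw [norm_inv]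
  exact inv_le_of_inv_le₀ (by positivity) h6.le

/-- If `P A(w) = 0`, then `P A` can be divided by `β_w` holomorphically, and `A' = (1 - P) A + β_w⁻¹
P A`. Near the circle `A' = b⁻¹ A` with `‖b⁻¹‖` close to 1, so the maximum principle makes `A'`
contractive. -/
theorem Contractive.exists_factor {A : ℂ → Mat n} (hA : Contractive A) {w : ℂ} (hw : w ∈ disk)
    (hdet : (A w).det = 0) :
    ∃ (P : Mat n) (A' : ℂ → Mat n), IsStarProjection P ∧ P.trace = 1 ∧ P.rank = 1 ∧
      Contractive A' ∧ (∀ z ∈ disk, A z = bpFactor w P z * A' z) ∧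
      ∀ z ∈ disk, (A z).det = blaschke w z * (A' z).det := by
  obtain ⟨P, hP, htr, hrk, hPA, hPdet⟩ := exists_rankOne_projection hdet
  have hw1 : ‖w‖ < 1 := mem_ball_zero_iff.1 hw
  have hPP := isStarProjection_mul_self hP
  set D : ℂ → Mat n := dslope (fun z => P * A z) w with hD
  have hPAd : DifferentiableOn ℂ (fun z => P * A z) disk := hA.diff.const_mul P
  have hDd : DifferentiableOn ℂ D disk :=
    (Complex.differentiableOn_dslope (Metric.isOpen_ball.mem_nhds hw)).2 hPAd
  -- The second term is `β_w⁻¹ P A` with the singularity at `w` removed: `D` is `P A` divided by `z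
  -- - w`, and the quotient of `β_w` by `z - w` has no zeros.
  set A' : ℂ → Mat n := fun z => (1 - P) * A z + (blaschkeQuot w z)⁻¹ • (P * D z) with hA'
  have hA'd : DifferentiableOn ℂ A' disk := by
    refine (hA.diff.const_mul _).add (DifferentiableOn.fun_smul ?_ (hDd.const_mul _))
    exact (differentiableOn_blaschkeQuot hw1.le).inv
      fun z hz => blaschkeQuot_ne_zero hw1.le (mem_ball_zero_iff.1 hz)
  have hfac : ∀ z ∈ disk, A z = bpFactor w P z * A' z := by
    intro z hz
    have hq := blaschkeQuot_ne_zero hw1.le (mem_ball_zero_iff.1 hz)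
    have h1 : (z - w) • D z = P * A z := by
      have := sub_smul_dslope (fun z => P * A z) w z
      rw [this]
      simp [hPA]
    have h2 : P * (1 - P) = 0 := by rw [mul_sub, mul_one, hPP, sub_self]
    have h3 : (1 - P) * (1 - P) = 1 - P := by
      rw [sub_mul, one_mul, h2, sub_zero]
    have h4 : (1 - P) * P = 0 := by rw [sub_mul, one_mul, hPP, sub_self]
    simp only [bpFactor, hA', add_mul, mul_add, smul_mul_assoc, mul_smul_comm]
    rw [← mul_assoc, ← mul_assoc, ← mul_assoc (1 - P) P, ← mul_assoc P P, h2, h3, h4, hPP,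
      blaschke_eq_mul, zero_mul, zero_mul, smul_zero, add_zero, zero_add, smul_smul,
      mul_comm (z - w), ← mul_assoc, inv_mul_cancel₀ hq, one_mul,
      ← mul_smul_comm, h1, ← mul_assoc, hPP]
    simp [sub_mul]
  refine ⟨P, A', hP, htr, hrk, ⟨hA'd, fun z hz => ?_⟩, hfac, fun z hz => ?_⟩
  · refine norm_le_one_of_boundary hA'd (fun ε hε => ?_) hz
    obtain ⟨r, hr, h⟩ := norm_inv_blaschke_le hw1 hε
    refine ⟨r, hr, fun y hy1 hy2 => ?_⟩
    obtain ⟨h0, h1⟩ := h y hy1 hy2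
    have hy : y ∈ disk := mem_ball_zero_iff.2 hy2
    have hge : 1 ≤ ‖(blaschke w y)⁻¹‖ := by
      rw [norm_inv]
      exact (one_le_inv₀ (norm_pos_iff.2 h0)).2 (norm_blaschke_le_one hw1.le hy2)
    have : A' y = (1 - P + (blaschke w y)⁻¹ • P) * A y := by
      rw [hfac y hy, ← mul_assoc, bpFactor_mul_inv hP h0, one_mul]
    rw [this]
    calc _ ≤ ‖1 - P + (blaschke w y)⁻¹ • P‖ * ‖A y‖ := norm_mul_le _ _
      _ ≤ (1 + ε) * 1 := mul_le_mul ((norm_one_sub_add_smul_le_norm hP hge).trans h1)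
          (hA.norm_le y hy) (norm_nonneg _) (by linarith)
      _ = 1 + ε := mul_one _
  · conv_lhs => rw [hfac z hz]
    rw [det_mul, bpFactor, hPdet]

end Contractive

/-! ### Removal of all zeros and convergence of the product. -/

section BlaschkePotapov
variable {n : ℕ}

/-- One step of the greedy extraction of zeros of `det A`: either a zero `w` of least modulus is
split off, or there is no zero and the step is trivial, with `w = 1`. -/
structure GreedyStep (A A' : ℂ → Mat n) (w : ℂ) (P : Mat n) : Prop where
  norm_le : ‖w‖ ≤ 1
  proj : IsStarProjection P
  eq_mul : ∀ z ∈ disk, A z = bpFactor w P z * A' z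
  det_eq : ∀ z ∈ disk, (A z).det = blaschke w z * (A' z).det
  alt : (w ∈ disk ∧ P.rank = 1 ∧ (A w).det = 0 ∧ ∀ z ∈ disk, (A z).det = 0 → ‖w‖ ≤ ‖z‖) ∨
    (w = 1 ∧ ∀ z ∈ disk, (A z).det ≠ 0)

/-- A zero of least modulus exists because the zeros in the closed disk through a given zero form a
compact set. -/
theorem Contractive.exists_greedyStep {A : ℂ → Mat n} (hA : Contractive A) :
    ∃ (A' : ℂ → Mat n) (w : ℂ) (P : Mat n), Contractive A' ∧ GreedyStep A A' w P := by
  by_cases h : ∃ z ∈ disk, (A z).det = 0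
  · obtain ⟨z₀, hz₀, hz₀'⟩ := h
    have hsub : Metric.closedBall (0 : ℂ) ‖z₀‖ ⊆ disk :=
      Metric.closedBall_subset_ball (mem_ball_zero_iff.1 hz₀)
    have hK : IsCompact (Metric.closedBall (0 : ℂ) ‖z₀‖ ∩ (fun z => (A z).det) ⁻¹' {0}) :=
      (isCompact_closedBall _ _).of_isClosed_subset
        ((hA.det_diff.continuousOn.mono hsub).preimage_isClosed_of_isClosed
          Metric.isClosed_closedBall isClosed_singleton) inter_subset_left
    obtain ⟨w, ⟨hw1, hw2⟩, hmin⟩ := hK.exists_isMinOn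
      ⟨z₀, by simp, hz₀'⟩ continuous_norm.continuousOn
    obtain ⟨P, A', hP, -, hrk, hA', h1, h2⟩ := hA.exists_factor (hsub hw1) hw2
    refine ⟨A', w, P, hA', (mem_ball_zero_iff.1 (hsub hw1)).le, hP, h1, h2,
      Or.inl ⟨hsub hw1, hrk, hw2, fun z hz hz0 => ?_⟩⟩
    by_cases hzz : ‖z‖ ≤ ‖z₀‖
    · exact hmin ⟨mem_closedBall_zero_iff.2 hzz, hz0⟩
    · exact (mem_closedBall_zero_iff.1 hw1).trans (not_le.1 hzz).le
  · push Not at h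
    refine ⟨A, 1, 0, hA, by simp, IsStarProjection.zero (R := Mat n), fun z hz => ?_,
      fun z hz => ?_, Or.inr ⟨rfl, h⟩⟩
    · simp [bpFactor]
    · rw [blaschke_one (mem_ball_zero_iff.1 hz), one_mul]

theorem Contractive.exists_greedy_sequence {A : ℂ → Mat n} (hA : Contractive A) :
    ∃ (a : ℕ → ℂ → Mat n) (w : ℕ → ℂ) (P : ℕ → Mat n), a 0 = A ∧ (∀ k, Contractive (a k)) ∧
      ∀ k, GreedyStep (a k) (a (k + 1)) (w k) (P k) := by
  choose next w P hnext hstep using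
    fun X : {X : ℂ → Mat n // Contractive X} => X.2.exists_greedyStep
  let a : ℕ → {X : ℂ → Mat n // Contractive X} :=
    fun k => Nat.rec ⟨A, hA⟩ (fun _ X => ⟨next X, hnext X⟩) k
  exact ⟨fun k => (a k).1, fun k => w (a k), fun k => P (a k), rfl, fun k => (a k).2,
    fun k => hstep (a k)⟩

section Sequence
variable {a : ℕ → ℂ → Mat n} {w : ℕ → ℂ} {P : ℕ → Mat n}

theorem det_eq_prod_blaschke (h : ∀ k, GreedyStep (a k) (a (k + 1)) (w k) (P k)) (k : ℕ) {z : ℂ}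
    (hz : z ∈ disk) :
    (a 0 z).det = (∏ i ∈ Finset.range k, blaschke (w i) z) * (a k z).det := by
  induction k with
  | zero => simp
  | succ k ih => rw [ih, (h k).det_eq z hz, Finset.prod_range_succ]; ring

theorem norm_det_le_norm_det_succ (h : ∀ k, GreedyStep (a k) (a (k + 1)) (w k) (P k)) {j k : ℕ}
    (hjk : j ≤ k) {z : ℂ} (hz : z ∈ disk) : ‖(a j z).det‖ ≤ ‖(a k z).det‖ := by
  induction k, hjk using Nat.le_induction with
  | base => exact le_rfl
  | succ k hk ih =>
    refine ih.trans ?_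
    rw [(h k).det_eq z hz, norm_mul]
    exact mul_le_of_le_one_left (norm_nonneg _)
      (norm_blaschke_le_one (h k).norm_le (mem_ball_zero_iff.1 hz))

/-- The Blaschke condition: `|det A(z₀)| ≤ ∏ |β_{w_i}(z₀)| ≤ exp(-c ∑ (1 - |w_i|))`, with `c` from
`le_one_sub_norm_blaschke`. -/
theorem summable_one_sub_norm (hc : ∀ k, Contractive (a k))
    (h : ∀ k, GreedyStep (a k) (a (k + 1)) (w k) (P k)) {z₀ : ℂ}
    (hz₀ : z₀ ∈ disk) (hdet : (a 0 z₀).det ≠ 0) : Summable fun k => 1 - ‖w k‖ := by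
  have hz1 : ‖z₀‖ < 1 := mem_ball_zero_iff.1 hz₀
  set c := (1 - ‖z₀‖ ^ 2) / 8
  have hcpos : 0 < c := by
    have : 0 < 1 - ‖z₀‖ ^ 2 := by nlinarith [norm_nonneg z₀]
    positivity
  have hnn : ∀ k, 0 ≤ 1 - ‖w k‖ := fun k => by linarith [(h k).norm_le]
  refine summable_of_sum_range_le (c := -Real.log ‖(a 0 z₀).det‖ / c) hnn fun m => ?_
  rw [le_div_iff₀ hcpos, mul_comm, Finset.mul_sum, le_neg]
  rw [Real.log_le_iff_le_exp (norm_pos_iff.2 hdet), ← Finset.sum_neg_distrib, Real.exp_sum]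
  calc ‖(a 0 z₀).det‖ ≤ ∏ i ∈ Finset.range m, ‖blaschke (w i) z₀‖ := by
        rw [det_eq_prod_blaschke h m hz₀, norm_mul, norm_prod]
        exact mul_le_of_le_one_right (Finset.prod_nonneg fun _ _ => norm_nonneg _)
          ((hc m).norm_det_le hz₀)
    _ ≤ _ := Finset.prod_le_prod (fun _ _ => norm_nonneg _) fun i _ => by
        have h1 : c * (1 - ‖w i‖) ≤ _ := le_one_sub_norm_blaschke (h i).norm_le hz1
        have h2 := Real.add_one_le_exp (-(c * (1 - ‖w i‖)))
        linarith

/-- The greedy choice matters here: if `z` stayed a zero forever, every `w k` would satisfy `|w k| ≤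
|z|`, contrary to `1 - |w k| → 0`. -/
theorem exists_det_ne_zero (h : ∀ k, GreedyStep (a k) (a (k + 1)) (w k) (P k))
    (hs : Summable fun k => 1 - ‖w k‖) {z : ℂ} (hz : z ∈ disk) : ∃ k, (a k z).det ≠ 0 := by
  by_contra! hall
  have hz1 : ‖z‖ < 1 := mem_ball_zero_iff.1 hz
  have hge : ∀ k, 1 - ‖z‖ ≤ 1 - ‖w k‖ := fun k => by
    rcases (h k).alt with h1 | h1
    · linarith [h1.2.2.2 z hz (hall k)]
    · exact absurd (hall k) (h1.2 z hz)
  have := ge_of_tendsto' hs.tendsto_atTop_zero hge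
  linarith

/-- The ordered partial products of Blaschke–Potapov factors. -/
def bpPartial (w : ℕ → ℂ) (P : ℕ → Mat n) (k : ℕ) (z : ℂ) : Mat n :=
  ((List.range k).map fun i => bpFactor (w i) (P i) z).prod

theorem bpPartial_succ (w : ℕ → ℂ) (P : ℕ → Mat n) (k : ℕ) (z : ℂ) :
    bpPartial w P (k + 1) z = bpPartial w P k z * bpFactor (w k) (P k) z := by
  simp [bpPartial, List.range_succ]

theorem norm_bpFactor_le_one {w : ℂ} {P : Mat n} (hw : ‖w‖ ≤ 1) (hP : IsStarProjection P) {z : ℂ}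
    (hz : ‖z‖ < 1) : ‖bpFactor w P z‖ ≤ 1 :=
  norm_one_sub_add_smul_le_one hP (norm_blaschke_le_one hw hz)

theorem norm_one_sub_bpFactor_le {w : ℂ} {P : Mat n} (hw : ‖w‖ ≤ 1) (hP : IsStarProjection P)
    {z : ℂ} (hz : ‖z‖ < 1) : ‖1 - bpFactor w P z‖ ≤ 2 / (1 - ‖z‖) * (1 - ‖w‖) := by
  have : 1 - bpFactor w P z = (1 - blaschke w z) • P := by
    rw [bpFactor, sub_smul, one_smul]; abel
  rw [this, norm_smul]
  exact (mul_le_of_le_one_right (norm_nonneg _) (norm_isStarProjection_le_one hP)).trans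
    (norm_one_sub_blaschke_le hw hz)

theorem norm_bpPartial_le_one (h : ∀ k, GreedyStep (a k) (a (k + 1)) (w k) (P k)) (k : ℕ) {z : ℂ}
    (hz : z ∈ disk) : ‖bpPartial w P k z‖ ≤ 1 := by
  induction k with
  | zero => simpa [bpPartial] using norm_one_le_one
  | succ k ih =>
    rw [bpPartial_succ]
    exact (norm_mul_le _ _).trans (mul_le_one₀ ih (norm_nonneg _)
      (norm_bpFactor_le_one (h k).norm_le (h k).proj (mem_ball_zero_iff.1 hz)))

theorem eq_bpPartial_mul (h : ∀ k, GreedyStep (a k) (a (k + 1)) (w k) (P k)) (k : ℕ) {z : ℂ}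
    (hz : z ∈ disk) : a 0 z = bpPartial w P k z * a k z := by
  induction k with
  | zero => simp [bpPartial]
  | succ k ih => rw [ih, (h k).eq_mul z hz, bpPartial_succ, mul_assoc]

theorem dist_bpPartial_succ_le (h : ∀ k, GreedyStep (a k) (a (k + 1)) (w k) (P k)) (k : ℕ) {z : ℂ}
    (hz : z ∈ disk) : dist (bpPartial w P k z) (bpPartial w P (k + 1) z) ≤
      2 / (1 - ‖z‖) * (1 - ‖w k‖) := by
  rw [dist_eq_norm, bpPartial_succ]
  have : bpPartial w P k z - bpPartial w P k z * bpFactor (w k) (P k) z =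
    bpPartial w P k z * (1 - bpFactor (w k) (P k) z) := by rw [mul_sub, mul_one]
  rw [this]
  exact (norm_mul_le _ _).trans ((mul_le_of_le_one_left (norm_nonneg _)
    (norm_bpPartial_le_one h k hz)).trans
    (norm_one_sub_bpFactor_le (h k).norm_le (h k).proj (mem_ball_zero_iff.1 hz)))

/-- The remainders obey the same increment bound as the partial products, so their limit is obtained
directly, without inverting the limit product. -/
theorem dist_remainder_succ_le (hc : ∀ k, Contractive (a k))
    (h : ∀ k, GreedyStep (a k) (a (k + 1)) (w k) (P k)) (k : ℕ) {z : ℂ}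
    (hz : z ∈ disk) : dist (a k z) (a (k + 1) z) ≤ 2 / (1 - ‖z‖) * (1 - ‖w k‖) := by
  rw [dist_comm, dist_eq_norm, (h k).eq_mul z hz]
  have : a (k + 1) z - bpFactor (w k) (P k) z * a (k + 1) z =
    (1 - bpFactor (w k) (P k) z) * a (k + 1) z := by rw [sub_mul, one_mul]
  rw [this]
  exact (norm_mul_le _ _).trans ((mul_le_of_le_one_right (norm_nonneg _)
    ((hc (k + 1)).norm_le z hz)).trans
    (norm_one_sub_bpFactor_le (h k).norm_le (h k).proj (mem_ball_zero_iff.1 hz)))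

/-- A sequence of functions on the disk with increments bounded by `2 / (1 - ‖z‖)` times a summable
sequence converges locally uniformly. -/
theorem tendstoLocallyUniformlyOn_of_summable {f : ℕ → ℂ → Mat n} {d : ℕ → ℝ} (hd : Summable d)
    (hd0 : ∀ k, 0 ≤ d k)
    (hf : ∀ k, ∀ z ∈ disk, dist (f k z) (f (k + 1) z) ≤ 2 / (1 - ‖z‖) * d k) :
    ∃ F : ℂ → Mat n, TendstoLocallyUniformlyOn f F atTop disk := by
  have hlim : ∀ z, ∃ y, z ∈ disk → Tendsto (fun k => f k z) atTop (𝓝 y) := fun z => by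
    by_cases hz : z ∈ disk
    · obtain ⟨y, hy⟩ := cauchySeq_tendsto_of_complete
        (cauchySeq_of_dist_le_of_summable _ (hf · z hz) (hd.mul_left _))
      exact ⟨y, fun _ => hy⟩
    · exact ⟨0, fun h => absurd h hz⟩
  choose F hF using hlim
  refine ⟨F, ?_⟩
  rw [tendstoLocallyUniformlyOn_iff_forall_isCompact Metric.isOpen_ball]
  intro K hK hKc
  rcases K.eq_empty_or_nonempty with rfl | hne
  · exact tendstoUniformlyOn_empty
  obtain ⟨x, hx, hmax⟩ := hKc.exists_isMaxOn hne continuous_norm.continuousOn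
  have hx1 : ‖x‖ < 1 := mem_ball_zero_iff.1 (hK hx)
  rw [Metric.tendstoUniformlyOn_iff]
  intro ε hε
  have ht : Tendsto (fun k => ∑' m, 2 / (1 - ‖x‖) * d (k + m)) atTop (𝓝 0) := by
    refine Tendsto.congr (fun k => ?_) (tendsto_sum_nat_add fun m => 2 / (1 - ‖x‖) * d m)
    simp only [add_comm k]
  filter_upwards [ht.eventually_lt_const hε] with k hk z hz
  have hzx : ‖z‖ ≤ ‖x‖ := hmax hz
  rw [dist_comm]
  refine lt_of_le_of_lt (dist_le_tsum_of_dist_le_of_tendsto (fun m => 2 / (1 - ‖x‖) * d m)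
    (fun m => (hf m z (hK hz)).trans ?_) (hd.mul_left _) (hF z (hK hz)) k) hk
  apply mul_le_mul_of_nonneg_right _ (hd0 m)
  exact div_le_div_of_nonneg_left (by norm_num) (by linarith) (by linarith)

/-- Each removed factor with zero `z` lowers the order of the determinant at `z` by exactly one;
other factors do not change it. -/
theorem analyticOrderAt_det_eq (hc : ∀ k, Contractive (a k))
    (h : ∀ k, GreedyStep (a k) (a (k + 1)) (w k) (P k)) (k : ℕ) {z : ℂ} (hz : z ∈ disk) :
    analyticOrderAt (fun z => (a 0 z).det) z =
      (((Finset.range k).filter fun i => w i = z).card : ℕ∞) +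
        analyticOrderAt (fun z => (a k z).det) z := by
  have hnhds : disk ∈ 𝓝 z := Metric.isOpen_ball.mem_nhds hz
  induction k with
  | zero => simp
  | succ k ih =>
    have h1 : (fun z => (a k z).det) =ᶠ[𝓝 z] blaschke (w k) * fun z => (a (k + 1) z).det := by
      filter_upwards [hnhds] with y hy using (h k).det_eq y hy
    rw [ih, analyticOrderAt_congr h1, analyticOrderAt_mul
      ((differentiableOn_blaschke (h k).norm_le).analyticAt hnhds)
      ((hc (k + 1)).det_diff.analyticAt hnhds),
      analyticOrderAt_blaschke (h k).norm_le (mem_ball_zero_iff.1 hz), ← add_assoc]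
    congr 1
    rw [Finset.range_add_one, Finset.filter_insert]
    by_cases hk : w k = z
    · rw [if_pos hk.symm, if_pos hk, Finset.card_insert_of_notMem (by simp)]
      push_cast; rfl
    · rw [if_neg (Ne.symm hk), if_neg hk, add_zero]

/-- After a dummy step the determinant is zero-free, and its modulus can only grow afterwards, so no
zero reappears. -/
theorem not_mem_disk_of_le (h : ∀ k, GreedyStep (a k) (a (k + 1)) (w k) (P k)) {j k : ℕ}
    (hjk : j ≤ k) (hj : w j ∉ disk) : w k ∉ disk := by
  have hall : ∀ z ∈ disk, (a j z).det ≠ 0 := by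
    rcases (h j).alt with h1 | h1
    · exact absurd h1.1 hj
    · exact h1.2
  rcases (h k).alt with h1 | h1
  · have := norm_det_le_norm_det_succ h hjk h1.1
    rw [h1.2.2.1, norm_zero, norm_le_zero_iff] at this
    exact absurd this (hall _ h1.1)
  · rw [h1.1]; simp

-- The genuine steps form an initial segment: the length is the first dummy index, or `⊤` if there
-- is none.
open Classical in
theorem exists_length (h : ∀ k, GreedyStep (a k) (a (k + 1)) (w k) (P k)) :
    ∃ l : ℕ∞, ∀ i : ℕ, (i : ℕ∞) < l ↔ w i ∈ disk := by
  by_cases hex : ∃ k, w k ∉ disk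
  · refine ⟨(Nat.find hex : ℕ), fun i => ?_⟩
    rw [Nat.cast_lt, Nat.lt_find_iff]
    constructor
    · exact fun hi => not_not.1 (hi i le_rfl)
    · exact fun hi m hm => fun hm' => not_mem_disk_of_le h hm hm' hi
  · push Not at hex
    exact ⟨⊤, fun i => by simpa using hex i⟩

end Sequence

/-- Extraction of the Blaschke–Potapov product: the remaining factor has a zero-free
determinant. -/
theorem Contractive.exists_bpProduct {A : ℂ → Mat n} (hA : Contractive A)
    (hdet : ∃ z ∈ disk, (A z).det ≠ 0) :
    ∃ F A' : ℂ → Mat n, Contractive A' ∧ (∀ z ∈ disk, (A' z).det ≠ 0) ∧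
      (∀ z ∈ disk, A z = F z * A' z) ∧
      ∀ U ∈ unitaryGroup (Fin n) ℂ, ∃ B : BPProduct n,
        B.CorrespondsToZeros (fun z => (A z).det) ∧ B.ConvergesTo fun z => F z * U := by
  obtain ⟨a, w, P, rfl, hc, h⟩ := hA.exists_greedy_sequence
  obtain ⟨z₀, hz₀, hdet⟩ := hdet
  have hs := summable_one_sub_norm hc h hz₀ hdet
  have hnn : ∀ k, 0 ≤ 1 - ‖w k‖ := fun k => by linarith [(h k).norm_le]
  obtain ⟨F, hF⟩ := tendstoLocallyUniformlyOn_of_summable hs hnn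
    fun k z hz => dist_bpPartial_succ_le h k hz
  obtain ⟨A', hA'⟩ := tendstoLocallyUniformlyOn_of_summable hs hnn
    fun k z hz => dist_remainder_succ_le hc h k hz
  refine ⟨F, A', ⟨?_, fun z hz => ?_⟩, fun z hz => ?_, fun z hz => ?_, fun U hU => ?_⟩
  · exact hA'.differentiableOn (Eventually.of_forall fun k => (hc k).diff) Metric.isOpen_ball
  · exact le_of_tendsto' (hA'.tendsto_at hz).norm fun k => (hc k).norm_le z hz
  -- The moduli of the remaining determinants at `z` are nondecreasing and positive from index `k`
  -- on, so the limit is not zero.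
  · obtain ⟨k, hk⟩ := exists_det_ne_zero h hs hz
    have ht : Tendsto (fun k => ‖(a k z).det‖) atTop (𝓝 ‖(A' z).det‖) :=
      ((Continuous.matrix_det continuous_id).tendsto _ |>.comp (hA'.tendsto_at hz)).norm
    have hle := ge_of_tendsto ht
      (eventually_atTop.2 ⟨k, fun m hm => norm_det_le_norm_det_succ h hm hz⟩)
    exact norm_pos_iff.1 ((norm_pos_iff.2 hk).trans_le hle)
  · refine tendsto_nhds_unique (tendsto_const_nhds (x := a 0 z) (f := atTop (α := ℕ))) ?_
    exact ((hF.tendsto_at hz).mul (hA'.tendsto_at hz)).congr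
      fun k => (eq_bpPartial_mul h k hz).symm
  · obtain ⟨l, hl⟩ := exists_length h
    have hrk : ∀ i, w i ∈ disk → (P i).rank = 1 := fun i hi => by
      rcases (h i).alt with h1 | h1
      · exact h1.2.1
      · rw [h1.1] at hi; simp at hi
    have hP0 : ∀ i, w i ∉ disk → ∀ z ∈ disk, bpFactor (w i) (P i) z = 1 := fun i hi z hz => by
      rcases (h i).alt with h1 | h1
      · exact absurd h1.1 hi
      · rw [h1.1, bpFactor, blaschke_one (mem_ball_zero_iff.1 hz), one_smul, sub_add_cancel]
    let B : BPProduct n :=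
      { length := l
        zero := w
        proj := P
        left := 1
        right := U
        zero_mem := fun i hi => (hl i).1 hi
        proj_isStarProjection := fun i _ => (h i).proj
        proj_ne_zero := fun i hi h0 => by
          have := hrk i ((hl i).1 hi)
          rw [h0, rank_zero] at this
          exact zero_ne_one this
        left_unitary := one_mem _
        right_unitary := hU }
    refine ⟨B, fun z hz => ?_, ?_⟩
    -- Once the remaining determinant is nonzero at `z`, no later factor has its zero there, so the
    -- first `k` indices contain all relevant ones.
    · obtain ⟨k, hk⟩ := exists_det_ne_zero h hs hz
      refine ⟨(Finset.range k).filter fun i => w i = z, fun i => ?_, ?_⟩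
      · rw [Finset.mem_filter, Finset.mem_range]
        change _ ↔ (i : ℕ∞) < l ∧ w i = z
        rw [hl]
        constructor
        · rintro ⟨-, rfl⟩; exact ⟨hz, rfl⟩
        · rintro ⟨hi, rfl⟩
          refine ⟨?_, rfl⟩
          by_contra hik
          have := norm_det_le_norm_det_succ h (not_lt.1 hik) hi
          rcases (h i).alt with h1 | h1
          · rw [h1.2.2.1, norm_zero, norm_le_zero_iff] at this
            exact hk this
          · rw [h1.1] at hi; simp at hi
      · have h0 : analyticOrderAt (fun z => (a k z).det) z = 0 := by
          rw [((hc k).det_diff.analyticAt (Metric.isOpen_ball.mem_nhds hz)).analyticOrderAt_eq_zero]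
          exact hk
        rw [analyticOrderAt_det_eq hc h k hz, h0, add_zero, Finset.card_eq_sum_ones]
        congr 1
        refine Finset.sum_congr rfl fun i hi => ?_
        rw [Finset.mem_filter] at hi
        exact (hrk i (hi.2 ▸ hz)).symm
    · have hpart : ∀ k, ∀ z ∈ disk, bpPartial w P k z * U = B.partialProd k z := fun k z hz => by
        unfold BPProduct.partialProd bpPartial
        change _ = 1 * _ * U
        rw [one_mul]
        congr 2
        refine List.map_congr_left fun i _ => ?_
        change _ = if (i : ℕ∞) < l then bpFactor (w i) (P i) z else 1
        split_ifs with hi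
        · rfl
        · exact hP0 i (fun hw => hi ((hl i).2 hw)) z hz
      refine TendstoLocallyUniformlyOn.congr (F := fun k z => bpPartial w P k z * U) ?_ hpart
      rw [tendstoLocallyUniformlyOn_iff_forall_isCompact Metric.isOpen_ball] at hF ⊢
      intro K hK hKc
      have := hF K hK hKc
      rw [Metric.tendstoUniformlyOn_iff] at this ⊢
      intro ε hε
      filter_upwards [this ε hε] with k hk z hz
      refine lt_of_le_of_lt ?_ (hk z hz)
      rw [dist_eq_norm, dist_eq_norm, ← sub_mul]
      exact (norm_mul_le _ _).trans
        (mul_le_of_le_one_right (norm_nonneg _) (norm_le_one_of_mem_unitaryGroup hU))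

end BlaschkePotapov

/-! ### Finite factorization of inner functions, with zeros sorted by argument. -/

section Inner
variable {n : ℕ}

/-- The argument of a complex number, normalized to lie in `[0, 2π)`. -/
def angle (w : ℂ) : ℝ := if 0 ≤ w.arg then w.arg else w.arg + 2 * Real.pi

theorem angle_mem (w : ℂ) : angle w ∈ Icc 0 (2 * Real.pi) := by
  have h1 := Complex.neg_pi_lt_arg w
  have h2 := Complex.arg_le_pi w
  unfold angle
  split_ifs with h <;> constructor <;> linarith [Real.pi_pos]

theorem norm_mul_exp_angle (w : ℂ) : (‖w‖ : ℂ) * Complex.exp (angle w * Complex.I) = w := by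
  unfold angle
  split_ifs with h
  · exact Complex.norm_mul_exp_arg_mul_I w
  · push_cast
    rw [add_mul, Complex.exp_add, Complex.exp_two_pi_mul_I, mul_one]
    exact Complex.norm_mul_exp_arg_mul_I w

/-- The modulus of `g` tends to `1` at the unit circle (or exceeds `1`). -/
def BoundaryUnimodular (g : ℂ → ℂ) : Prop :=
  ∀ ε > 0, ∃ r < 1, ∀ z, r < ‖z‖ → ‖z‖ < 1 → 1 - ε ≤ ‖g z‖

theorem norm_toEuclideanCLM_of_mem_unitaryGroup {U : Mat n} (hU : U ∈ unitaryGroup (Fin n) ℂ)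
    (x : EuclideanSpace ℂ (Fin n)) : ‖toEuclideanCLM (𝕜 := ℂ) U x‖ = ‖x‖ := by
  have hle : ∀ V : Mat n, ‖V‖ ≤ 1 → ∀ y, ‖toEuclideanCLM (𝕜 := ℂ) V y‖ ≤ ‖y‖ := fun V hV y =>
    (ContinuousLinearMap.le_opNorm _ _).trans (mul_le_of_le_one_left (norm_nonneg _)
      (by rwa [l2_opNorm_toEuclideanCLM]))
  have h1 := norm_le_one_of_mem_unitaryGroup hU
  refine le_antisymm (hle U h1 x) ?_
  have h2 : Uᴴ * U = 1 := mem_unitaryGroup_iff'.1 hU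
  have h3 : toEuclideanCLM (𝕜 := ℂ) Uᴴ (toEuclideanCLM (𝕜 := ℂ) U x) = x := by
    rw [← mul_apply_eq_comp, ← map_mul, h2, map_one, one_apply_eq_self]
  conv_lhs => rw [← h3]
  exact hle _ (by rwa [l2_opNorm_conjTranspose]) _

/-- For each vector `x` the map `z ↦ A(z) x` has constant norm, hence is constant by the maximum
principle in a strictly convex space. Vectors are used because the operator norm need not be
strictly convex. -/
theorem eq_const_of_mem_unitaryGroup {A : ℂ → Mat n} (hA : DifferentiableOn ℂ A disk)
    (hU : ∀ z ∈ disk, A z ∈ unitaryGroup (Fin n) ℂ) {z : ℂ} (hz : z ∈ disk) : A z = A 0 := by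
  have h0 : (0 : ℂ) ∈ disk := by simp
  refine (toEuclideanCLM (n := Fin n) (𝕜 := ℂ)).injective (ContinuousLinearMap.ext fun x => ?_)
  let T : Mat n →ₗ[ℂ] (EuclideanSpace ℂ (Fin n) →L[ℂ] EuclideanSpace ℂ (Fin n)) :=
    (toEuclideanCLM (n := Fin n) (𝕜 := ℂ)).toAlgEquiv.toLinearMap
  let f : ℂ → EuclideanSpace ℂ (Fin n) := fun z => T (A z) x
  have hd : DifferentiableOn ℂ f disk :=
    ((LinearMap.toContinuousLinearMap T).differentiable.comp_differentiableOn hA).clm_apply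
      (differentiableOn_const x)
  have hnorm : ∀ y ∈ disk, ‖f y‖ = ‖x‖ :=
    fun y hy => norm_toEuclideanCLM_of_mem_unitaryGroup (hU y hy) x
  have hmax : IsMaxOn (norm ∘ f) disk 0 := fun y hy => by
    change ‖f y‖ ≤ ‖f 0‖
    rw [hnorm y hy, hnorm 0 h0]
  exact Complex.eqOn_of_isPreconnected_of_isMaxOn_norm (convex_ball _ _).isPreconnected
    Metric.isOpen_ball hd h0 hmax hz

/-- The maximum principle applied to `1 / det A` gives `|det A| = 1` on the disk. A contraction with
unimodular determinant is unitary, and a holomorphic unitary-valued function is constant. -/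
theorem Contractive.eq_unitary_of_zeroFree {A : ℂ → Mat n} (hA : Contractive A)
    (hb : BoundaryUnimodular fun z => (A z).det) (h0 : ∀ z ∈ disk, (A z).det ≠ 0) :
    A 0 ∈ unitaryGroup (Fin n) ℂ ∧ ∀ z ∈ disk, A z = A 0 := by
  have hdet : ∀ z ∈ disk, ‖(A z).det‖ = 1 := fun z hz => by
    refine le_antisymm (hA.norm_det_le hz) ?_
    have h1 : ‖((A z).det)⁻¹‖ ≤ 1 := by
      refine norm_le_one_of_boundary (f := fun z => ((A z).det)⁻¹) (hA.det_diff.inv h0)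
        (fun ε hε => ?_) hz
      obtain ⟨r, hr, h⟩ := hb (1 - (1 + ε)⁻¹)
        (sub_pos.2 (inv_lt_one_of_one_lt₀ (by linarith)))
      refine ⟨r, hr, fun y hy1 hy2 => ?_⟩
      have h2 := h y hy1 hy2
      rw [sub_sub_cancel] at h2
      rw [norm_inv]
      exact inv_le_of_inv_le₀ (by positivity) h2
    rw [norm_inv] at h1
    exact (inv_le_one₀ (norm_pos_iff.2 (h0 z hz))).1 h1
  have hU : ∀ z ∈ disk, A z ∈ unitaryGroup (Fin n) ℂ :=
    fun z hz => mem_unitaryGroup_of_norm_det (hA.norm_le z hz) (hdet z hz)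
  exact ⟨hU 0 (by simp), fun z hz => eq_const_of_mem_unitaryGroup hA.diff hU hz⟩

theorem finite_zeros_of_subset {g : ℂ → ℂ} (hg : DifferentiableOn ℂ g disk) (h0 : g 0 ≠ 0) {r : ℝ}
    (hr : r < 1) (hz : ∀ z ∈ disk, g z = 0 → ‖z‖ ≤ r) : {z | z ∈ disk ∧ g z = 0}.Finite := by
  by_contra hinf
  have hsub : {z | z ∈ disk ∧ g z = 0} ⊆ Metric.closedBall 0 r :=
    fun z hz' => mem_closedBall_zero_iff.2 (hz z hz'.1 hz'.2)
  obtain ⟨x, hx, hacc⟩ := Set.Infinite.exists_accPt_of_subset_isCompact hinf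
    (isCompact_closedBall 0 r) hsub
  have hxd : x ∈ disk := Metric.closedBall_subset_ball hr hx
  have hfreq : ∃ᶠ y in 𝓝[≠] x, g y = 0 := (accPt_iff_frequently_nhdsNE.1 hacc).mono
    fun y hy => hy.2
  exact h0 ((hg.analyticOnNhd Metric.isOpen_ball).eqOn_zero_of_preconnected_of_frequently_eq_zero
    (convex_ball _ _).isPreconnected hxd hfreq (by simp))

/-- The conditions on a finite list of pairs (zero, projection) that arises from factoring. -/
structure IsFactorList (g : ℂ → ℂ) (l : List (ℂ × Mat n)) : Prop where
  zero_mem : ∀ p ∈ l, p.1 ∈ disk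
  zero_eq : ∀ p ∈ l, g p.1 = 0
  proj : ∀ p ∈ l, IsStarProjection p.2
  trace : ∀ p ∈ l, p.2.trace = 1
  sorted : l.Pairwise fun p q => angle p.1 ≤ angle q.1

theorem isStarProjection_conj {U P : Mat n} (hU : U ∈ unitaryGroup (Fin n) ℂ)
    (hP : IsStarProjection P) : IsStarProjection (Uᴴ * P * U) := by
  have h1 : U * Uᴴ = 1 := mem_unitaryGroup_iff.1 hU
  refine ⟨?_, ?_⟩
  · change Uᴴ * P * U * (Uᴴ * P * U) = Uᴴ * P * U
    calc Uᴴ * P * U * (Uᴴ * P * U) = Uᴴ * P * (U * Uᴴ) * P * U := by simp only [mul_assoc]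
      _ = Uᴴ * (P * P) * U := by rw [h1, mul_one, mul_assoc Uᴴ]
      _ = _ := by rw [isStarProjection_mul_self hP]
  · change (Uᴴ * P * U)ᴴ = _
    rw [conjTranspose_mul, conjTranspose_mul, conjTranspose_conjTranspose,
      isStarProjection_conjTranspose hP, mul_assoc]

/-- Moves a unitary constant to the left of a factor; the zero is unchanged and only the projection
is conjugated. -/
theorem bpFactor_mul_unitary {U P : Mat n} (hU : U ∈ unitaryGroup (Fin n) ℂ) (w z : ℂ) :
    bpFactor w P z * U = U * bpFactor w (Uᴴ * P * U) z := by
  have h1 : U * Uᴴ = 1 := mem_unitaryGroup_iff.1 hU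
  have h2 : U * (Uᴴ * P * U) = P * U := by rw [← mul_assoc, ← mul_assoc, h1, one_mul]
  simp only [bpFactor, add_mul, mul_add, sub_mul, mul_sub, one_mul, mul_one, smul_mul_assoc,
    mul_smul_comm, h2]

/-- Finite factorization of an inner function, with the zeros sorted by their arguments. -/
theorem Contractive.exists_finite_factorization_aux {r : ℝ} (hr : r < 1) (m : ℕ) :
    ∀ {A : ℂ → Mat n}, Contractive A → (BoundaryUnimodular fun z => (A z).det) →
      (∀ z ∈ disk, (A z).det = 0 → ‖z‖ ≤ r) → (A 0).det ≠ 0 → r ^ m < ‖(A 0).det‖ →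
      ∃ U ∈ unitaryGroup (Fin n) ℂ, ∃ l : List (ℂ × Mat n),
        IsFactorList (fun z => (A z).det) l ∧
        (∀ z ∈ disk, A z = U * (l.map fun p => bpFactor p.1 p.2 z).prod) ∧
        ‖(A 0).det‖ = (l.map fun p => ‖p.1‖).prod := by
  have h0d : (0 : ℂ) ∈ disk := by simp
  -- Every removed zero has modulus at most `r`, so its removal multiplies `|det A(0)|` by at least
  -- `1 / r`. As this modulus never exceeds 1, the exponent `m` bounds the number of removals.
  induction m with
  | zero =>
    intro A hA _ _ _ h
    rw [pow_zero] at h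
    exact absurd (hA.norm_det_le h0d) (not_le.2 h)
  | succ m ih =>
    intro A hA hb hz hA0 hlt
    rcases {z | z ∈ disk ∧ (A z).det = 0}.eq_empty_or_nonempty with he | hne
    · have hzf : ∀ z ∈ disk, (A z).det ≠ 0 := fun z hz h0 => by
        have : z ∈ {z | z ∈ disk ∧ (A z).det = 0} := ⟨hz, h0⟩
        rw [he] at this; exact this
      obtain ⟨hU, hconst⟩ := hA.eq_unitary_of_zeroFree hb hzf
      refine ⟨A 0, hU, [], ⟨by simp, by simp, by simp, by simp, by simp⟩, fun z hz => ?_, ?_⟩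
      · simpa using hconst z hz
      · simpa using norm_det_of_mem_unitaryGroup hU
    -- Removing the zero of least argument first makes the list sorted, because the zeros of the
    -- remaining factor are among those of `A`.
    · obtain ⟨w, ⟨hw, hw0⟩, hmin⟩ := Set.exists_min_image _ angle
        (finite_zeros_of_subset hA.det_diff hA0 hr hz) hne
      obtain ⟨P, A', hP, htr, -, hA', hfac, hdet⟩ := hA.exists_factor hw hw0
      have hw1 : ‖w‖ < 1 := mem_ball_zero_iff.1 hw
      have hdet0 : ‖(A 0).det‖ = ‖w‖ * ‖(A' 0).det‖ := by
        rw [hdet 0 h0d, norm_mul, norm_blaschke_zero]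
      have hle : ∀ z ∈ disk, ‖(A z).det‖ ≤ ‖(A' z).det‖ := fun z hz => by
        rw [hdet z hz, norm_mul]
        exact mul_le_of_le_one_left (norm_nonneg _)
          (norm_blaschke_le_one hw1.le (mem_ball_zero_iff.1 hz))
      have hzz : ∀ z ∈ disk, (A' z).det = 0 → (A z).det = 0 := fun z hz h => by
        rw [hdet z hz, h, mul_zero]
      have hwpos : 0 < ‖w‖ := by
        rw [norm_pos_iff]; rintro rfl; exact hA0 hw0
      have hwr : ‖w‖ ≤ r := hz w hw hw0
      have hb' : BoundaryUnimodular fun z => (A' z).det := fun ε hε => by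
        obtain ⟨ρ, hρ, h⟩ := hb ε hε
        exact ⟨ρ, hρ, fun z hz1 hz2 => (h z hz1 hz2).trans (hle z (mem_ball_zero_iff.2 hz2))⟩
      have hlt' : r ^ m < ‖(A' 0).det‖ := by
        have hr0 : 0 < r := hwpos.trans_le hwr
        rw [pow_succ, hdet0] at hlt
        have : r ^ m * r < ‖(A' 0).det‖ * r :=
          hlt.trans_le (by rw [mul_comm]; exact mul_le_mul_of_nonneg_left hwr (norm_nonneg _))
        exact lt_of_mul_lt_mul_right this hr0.le
      have hA0' : (A' 0).det ≠ 0 := fun h => hA0 (hzz 0 h0d h)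
      obtain ⟨U, hU, l, hl, hprod, hnorm⟩ := ih hA' hb'
        (fun z hz' h => hz z hz' (hzz z hz' h)) hA0' hlt'
      refine ⟨U, hU, (w, Uᴴ * P * U) :: l, ⟨?_, ?_, ?_, ?_, ?_⟩, fun z hz' => ?_, ?_⟩
      · simpa using ⟨mem_ball_zero_iff.1 hw, by simpa using hl.zero_mem⟩
      · refine List.forall_mem_cons.2 ⟨hw0, fun p hp => ?_⟩
        exact hzz _ (hl.zero_mem p hp) (hl.zero_eq p hp)
      · exact List.forall_mem_cons.2 ⟨isStarProjection_conj hU hP, hl.proj⟩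
      · refine List.forall_mem_cons.2 ⟨?_, hl.trace⟩
        have h1 : U * Uᴴ = 1 := mem_unitaryGroup_iff.1 hU
        rw [mul_assoc, trace_mul_comm, mul_assoc, h1, mul_one, htr]
      · refine List.pairwise_cons.2 ⟨fun p hp => ?_, hl.sorted⟩
        exact hmin _ ⟨hl.zero_mem p hp, hzz _ (hl.zero_mem p hp) (hl.zero_eq p hp)⟩
      · rw [hfac z hz', hprod z hz', ← mul_assoc, bpFactor_mul_unitary hU, List.map_cons,
          List.prod_cons, mul_assoc]
      · rw [hdet0, hnorm, List.map_cons, List.prod_cons]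

theorem Contractive.exists_finite_factorization {A : ℂ → Mat n} (hA : Contractive A)
    (hb : BoundaryUnimodular fun z => (A z).det) (hA0 : (A 0).det ≠ 0) :
    ∃ U ∈ unitaryGroup (Fin n) ℂ, ∃ l : List (ℂ × Mat n),
      IsFactorList (fun z => (A z).det) l ∧
      (∀ z ∈ disk, A z = U * (l.map fun p => bpFactor p.1 p.2 z).prod) ∧
      ‖(A 0).det‖ = (l.map fun p => ‖p.1‖).prod := by
  obtain ⟨r, hr, h⟩ := hb (1 / 2) (by norm_num)
  have hz : ∀ z ∈ disk, (A z).det = 0 → ‖z‖ ≤ max r 0 := fun z hz h0 => by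
    by_contra hlt
    have : 1 - 1 / 2 ≤ ‖(A z).det‖ :=
      h z ((le_max_left _ _).trans_lt (not_le.1 hlt)) (mem_ball_zero_iff.1 hz)
    rw [h0, norm_zero] at this
    norm_num at this
  have hr1 : max r 0 < 1 := max_lt hr one_pos
  obtain ⟨m, hm⟩ := exists_pow_lt_of_lt_one (norm_pos_iff.2 hA0) hr1
  exact Contractive.exists_finite_factorization_aux hr1 m hA hb hz hA0 hm

end Inner

/-! ### The Cayley transform between positive real part and contractions. -/

section Cayley
variable {n : ℕ}

/-- A kernel vector `v` of `X + 1` would satisfy `v* (X + Xᴴ) v = -2 |v|² < 0`. -/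
theorem det_add_one_ne_zero {X : Mat n} (hX : (X + Xᴴ).PosSemidef) : (X + 1).det ≠ 0 := by
  intro h
  obtain ⟨v, hv0, hv⟩ := exists_mulVec_eq_zero_iff.2 h
  rw [add_mulVec, one_mulVec] at hv
  have hXv : X *ᵥ v = -v := eq_neg_of_add_eq_zero_left hv
  have h1 := hX.dotProduct_mulVec_nonneg v
  have h2 : star v ⬝ᵥ Xᴴ *ᵥ v = -(star v ⬝ᵥ v) := by
    rw [dotProduct_mulVec, ← star_mulVec, hXv, star_neg, neg_dotProduct]
  rw [add_mulVec, dotProduct_add, h2, hXv, dotProduct_neg] at h1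
  have h3 : 0 < star v ⬝ᵥ v := dotProduct_star_self_pos_iff.2 hv0
  have h4 : (0 : ℂ) < 0 := by
    calc (0 : ℂ) < star v ⬝ᵥ v + star v ⬝ᵥ v := add_pos h3 h3
      _ ≤ 0 := by
        have := neg_nonneg.1 (by rwa [← neg_add] at h1)
        exact this
  exact lt_irrefl _ h4

/-- The Cayley transform. -/
def cayley (X : Mat n) : Mat n := (X - 1) * (X + 1)⁻¹

/-- With `Y = (X + 1)⁻¹` and `C` the transform, `1 - Cᴴ C = Yᴴ (2 (X + Xᴴ)) Y`. -/
theorem norm_cayley_le_one {X : Mat n} (hX : (X + Xᴴ).PosSemidef) : ‖cayley X‖ ≤ 1 := by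
  have hu : IsUnit (X + 1).det := (det_add_one_ne_zero hX).isUnit
  rw [← l2_opNorm_conjTranspose, norm_le_one_iff_posSemidef, conjTranspose_conjTranspose]
  set Y := (X + 1)⁻¹
  have h1 : (X + 1) * Y = 1 := mul_nonsing_inv _ hu
  have h2 : Yᴴ * (X + 1)ᴴ = 1 := by rw [← conjTranspose_mul, h1, conjTranspose_one]
  have h3 : 1 - (cayley X)ᴴ * cayley X = Yᴴ * ((2 : ℂ) • (X + Xᴴ)) * Y := by
    have h4 : (2 : ℂ) • (X + Xᴴ) = (X + 1)ᴴ * (X + 1) - (X - 1)ᴴ * (X - 1) := by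
      simp only [conjTranspose_add, conjTranspose_sub, conjTranspose_one, add_mul, mul_add,
        sub_mul, mul_sub, one_mul, mul_one, two_smul]
      abel
    calc 1 - (cayley X)ᴴ * cayley X
        = Yᴴ * (X + 1)ᴴ * ((X + 1) * Y) - (cayley X)ᴴ * cayley X := by rw [h1, h2, one_mul]
      _ = _ := by
        rw [h4, cayley, conjTranspose_mul, mul_sub Yᴴ, sub_mul (Yᴴ * _) _ Y]
        simp only [mul_assoc, Y]
  rw [h3]
  exact (hX.smul (by norm_num : (0 : ℂ) ≤ 2)).conjTranspose_mul_mul_same Y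

theorem det_cayley (X : Mat n) : (cayley X).det = (X - 1).det / (X + 1).det := by
  rw [cayley, det_mul, det_nonsing_inv, Ring.inverse_eq_inv', div_eq_mul_inv]

theorem norm_det_cayley_of_skew {X : Mat n} (hX : Xᴴ = -X) : ‖(cayley X).det‖ = 1 := by
  have h0 : (X + 1).det ≠ 0 := det_add_one_ne_zero (by rw [hX, add_neg_cancel]; exact .zero)
  have h1 : (X - 1)ᴴ = -(X + 1) := by rw [conjTranspose_sub, hX, conjTranspose_one]; abel
  have h2 : ‖(X - 1).det‖ = ‖(X + 1).det‖ := by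
    rw [← norm_star, ← det_conjTranspose, h1, det_neg, norm_mul, norm_pow, norm_neg, norm_one,
      one_pow, one_mul]
  rw [det_cayley, norm_div, h2, div_self (norm_ne_zero_iff.2 h0)]

/-- The inverse Cayley transform. -/
def invCayley (G : Mat n) : Mat n := (1 + G) * (1 - G)⁻¹

theorem isUnit_det_one_sub {G : Mat n} (hG : ‖G‖ < 1) : IsUnit (1 - G).det :=
  (isUnit_iff_isUnit_det _).1 (isUnit_one_sub_of_norm_lt_one hG)

theorem cayley_invCayley {G : Mat n} (hG : ‖G‖ < 1) : cayley (invCayley G) = G := by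
  have hu := isUnit_det_one_sub hG
  have h1 : (1 - G) * (1 - G)⁻¹ = 1 := mul_nonsing_inv _ hu
  have h1' : (1 - G)⁻¹ * (1 - G) = 1 := nonsing_inv_mul _ hu
  have h2 : invCayley G - 1 = (2 : ℂ) • (G * (1 - G)⁻¹) := by
    rw [invCayley]
    conv_lhs => enter [2]; rw [← h1]
    rw [← sub_mul, two_smul, ← add_mul]; congr 1; abel
  have h3 : invCayley G + 1 = (2 : ℂ) • (1 - G)⁻¹ := by
    rw [invCayley]
    conv_lhs => enter [2]; rw [← h1]
    rw [← add_mul, two_smul, ← two_mul]; congr 1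
    rw [add_add_sub_cancel]; norm_num
  have h4 : (invCayley G + 1)⁻¹ = (2⁻¹ : ℂ) • (1 - G) := by
    apply inv_eq_right_inv
    rw [h3, smul_mul_assoc, mul_smul_comm, h1', smul_smul]; norm_num
  rw [cayley, h2, h4, smul_mul_assoc, mul_smul_comm, smul_smul, mul_assoc, h1']
  norm_num

theorem invCayley_add_conjTranspose {G : Mat n} (hG : ‖G‖ < 1) :
    invCayley G + (invCayley G)ᴴ =
      ((1 - G)⁻¹)ᴴ * ((2 : ℂ) • (1 - Gᴴ * G)) * (1 - G)⁻¹ := by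
  have hu := isUnit_det_one_sub hG
  set Y := (1 - G)⁻¹ with hY
  have h1 : (1 - G) * Y = 1 := mul_nonsing_inv _ hu
  have h2 : Yᴴ * (1 - G)ᴴ = 1 := by rw [← conjTranspose_mul, h1, conjTranspose_one]
  have h4 : (2 : ℂ) • (1 - Gᴴ * G) = (1 - G)ᴴ * (1 + G) + (1 + G)ᴴ * (1 - G) := by
    simp only [conjTranspose_add, conjTranspose_sub, conjTranspose_one, add_mul, mul_add,
        sub_mul, mul_sub, one_mul, mul_one, two_smul]
    abel
  rw [h4, mul_add, add_mul, ← mul_assoc, h2, one_mul, mul_assoc, mul_assoc, h1, mul_one,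
    invCayley, conjTranspose_mul]

theorem posSemidef_invCayley {G : Mat n} (hG : ‖G‖ < 1) :
    (invCayley G + (invCayley G)ᴴ).PosSemidef := by
  rw [invCayley_add_conjTranspose hG]
  refine PosSemidef.conjTranspose_mul_mul_same (PosSemidef.smul ?_ (by norm_num)) _
  have := (norm_le_one_iff_posSemidef Gᴴ).1 (by rw [l2_opNorm_conjTranspose]; exact hG.le)
  rwa [conjTranspose_conjTranspose] at this

/-- Strict contractivity makes the real part invertible. These real parts become the weights of the
Herglotz sums, whose invertibility controls the behaviour at the poles. -/
theorem det_invCayley_add_ne_zero {G : Mat n} (hG : ‖G‖ < 1) :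
    (invCayley G + (invCayley G)ᴴ).det ≠ 0 := by
  have hu := isUnit_det_one_sub hG
  rw [invCayley_add_conjTranspose hG, det_mul, det_mul, det_smul, det_conjTranspose]
  have h1 : (1 - G)⁻¹.det ≠ 0 := by
    rw [det_nonsing_inv, Ring.inverse_eq_inv']
    exact inv_ne_zero hu.ne_zero
  have h2 : (1 - Gᴴ * G).det ≠ 0 := by
    refine (isUnit_det_one_sub ?_).ne_zero
    rw [l2_opNorm_conjTranspose_mul_self]
    nlinarith [norm_nonneg G]
  have h3 : star (1 - G)⁻¹.det ≠ 0 := star_ne_zero.2 h1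
  exact mul_ne_zero (mul_ne_zero h3 (mul_ne_zero (pow_ne_zero _ two_ne_zero) h2)) h1

theorem differentiableAt_matrix_inv {X : Mat n} (hX : IsUnit X.det) :
    DifferentiableAt ℂ (fun Y : Mat n => Y⁻¹) X := by
  have : (fun Y : Mat n => Y⁻¹) = Ring.inverse := by
    funext Y; exact nonsing_inv_eq_ringInverse Y
  rw [this]
  exact differentiableAt_inverse ((isUnit_iff_isUnit_det X).2 hX)

theorem differentiableAt_cayley {X : Mat n} (hX : (X + 1).det ≠ 0) :
    DifferentiableAt ℂ (cayley : Mat n → Mat n) X := by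
  have h1 : DifferentiableAt ℂ (fun Y : Mat n => (Y + 1)⁻¹) X :=
    DifferentiableAt.comp X (g := fun Y : Mat n => Y⁻¹) (f := fun Y : Mat n => Y + 1)
      (differentiableAt_matrix_inv hX.isUnit) (by fun_prop)
  exact DifferentiableAt.mul (by fun_prop) h1

theorem differentiableAt_invCayley {G : Mat n} (hG : ‖G‖ < 1) :
    DifferentiableAt ℂ (invCayley : Mat n → Mat n) G := by
  have h1 : DifferentiableAt ℂ (fun Y : Mat n => (1 - Y)⁻¹) G :=
    DifferentiableAt.comp G (g := fun Y : Mat n => Y⁻¹) (f := fun Y : Mat n => 1 - Y)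
      (differentiableAt_matrix_inv (isUnit_det_one_sub hG)) (by fun_prop)
  exact DifferentiableAt.mul (by fun_prop) h1

end Cayley

/-! ### Cayley transforms of finite Herglotz sums are inner. -/

section RationalInner
variable {n : ℕ}

/-- Compactness of the circle turns local lower bounds into a bound on one annulus. -/
theorem boundaryUnimodular_of_nhds {g : ℂ → ℂ}
    (h : ∀ ζ : ℂ, ‖ζ‖ = 1 → ∀ ε > 0, ∀ᶠ z in 𝓝 ζ, ‖z‖ < 1 → 1 - ε ≤ ‖g z‖) :
    BoundaryUnimodular g := by
  intro ε hε
  have hmem : {z : ℂ | ‖z‖ < 1 → 1 - ε ≤ ‖g z‖} ∈ 𝓝ˢ (Metric.sphere (0 : ℂ) 1) := by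
    rw [mem_nhdsSet_iff_forall]
    exact fun ζ hζ => h ζ (mem_sphere_zero_iff_norm.1 hζ) ε hε
  obtain ⟨V, hVo, hVs, hV⟩ := mem_nhdsSet_iff_exists.1 hmem
  obtain ⟨δ, hδ, hsub⟩ := (isCompact_sphere (0 : ℂ) 1).exists_thickening_subset_open hVo hVs
  refine ⟨max 0 (1 - δ), max_lt one_pos (by linarith), fun z hz1 hz2 => ?_⟩
  have hz0 : 0 < ‖z‖ := (le_max_left _ _).trans_lt hz1
  refine hV (hsub (Metric.mem_thickening_iff.2 ⟨(‖z‖⁻¹ : ℝ) • z, ?_, ?_⟩)) hz2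
  · rw [mem_sphere_zero_iff_norm, norm_smul, norm_inv, norm_norm, inv_mul_cancel₀ hz0.ne']
  · have : z - (‖z‖⁻¹ : ℝ) • z = (1 - ‖z‖⁻¹ : ℝ) • z := by rw [sub_smul, one_smul]
    rw [dist_eq_norm, this, norm_smul, Real.norm_eq_abs, abs_of_nonpos
      (sub_nonpos.2 ((one_le_inv₀ hz0).2 hz2.le)), neg_sub, sub_mul, inv_mul_cancel₀ hz0.ne']
    linarith [(le_max_right 0 (1 - δ)).trans_lt hz1]

theorem re_kernel (ζ z : ℂ) :
    ((ζ + z) / (ζ - z)).re = (‖ζ‖ ^ 2 - ‖z‖ ^ 2) / ‖ζ - z‖ ^ 2 := by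
  have := congrFun (poissonKernel_eq_re_herglotzRieszKernel (c := 0) (w := z)) ζ
  simpa [poissonKernel, herglotzRieszKernel] using this.symm

/-- A finite sum of Herglotz kernels with matrix weights. -/
def kernelSum {ι : Type*} (s : Finset ι) (K : Mat n) (ζ : ι → ℂ) (H : ι → Mat n) (z : ℂ) : Mat n :=
  K + ∑ k ∈ s, ((ζ k + z) / (ζ k - z)) • H k

variable {ι : Type*} {s : Finset ι} {K : Mat n} {ζ : ι → ℂ} {H : ι → Mat n}

theorem kernelSum_add_conjTranspose (hK : Kᴴ = -K) (hH : ∀ k ∈ s, (H k).PosSemidef) (z : ℂ) :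
    kernelSum s K ζ H z + (kernelSum s K ζ H z)ᴴ =
      ∑ k ∈ s, ((2 * ((ζ k + z) / (ζ k - z)).re : ℝ) : ℂ) • H k := by
  have h1 : (kernelSum s K ζ H z)ᴴ =
      -K + ∑ k ∈ s, star ((ζ k + z) / (ζ k - z)) • H k := by
    rw [kernelSum, conjTranspose_add, hK, conjTranspose_sum]
    congr 1
    refine Finset.sum_congr rfl fun k hk => ?_
    rw [conjTranspose_smul, (hH k hk).isHermitian.eq]
  rw [h1, kernelSum, add_add_add_comm, add_neg_cancel, zero_add, ← Finset.sum_add_distrib]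
  refine Finset.sum_congr rfl fun k _ => ?_
  rw [← add_smul]
  congr 1
  exact Complex.add_conj _

theorem posSemidef_kernelSum (hK : Kᴴ = -K) (hζ : ∀ k ∈ s, ‖ζ k‖ = 1)
    (hH : ∀ k ∈ s, (H k).PosSemidef) {z : ℂ} (hz : ‖z‖ ≤ 1) :
    (kernelSum s K ζ H z + (kernelSum s K ζ H z)ᴴ).PosSemidef := by
  rw [kernelSum_add_conjTranspose hK hH]
  refine posSemidef_sum _ fun k hk => (hH k hk).smul ?_
  rw [Complex.zero_le_real, re_kernel, hζ k hk]
  have : 0 ≤ 1 ^ 2 - ‖z‖ ^ 2 := by nlinarith [norm_nonneg z]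
  positivity

theorem differentiableAt_kernelSum {z : ℂ} (hz : ∀ k ∈ s, z ≠ ζ k) :
    DifferentiableAt ℂ (kernelSum s K ζ H) z := by
  unfold kernelSum
  refine DifferentiableAt.const_add _ (DifferentiableAt.fun_sum fun k hk => ?_)
  refine DifferentiableAt.smul_const (DifferentiableAt.fun_div (by fun_prop) (by fun_prop) ?_) _
  exact sub_ne_zero.2 (hz k hk).symm

theorem contractive_cayley_kernelSum (hK : Kᴴ = -K) (hζ : ∀ k ∈ s, ‖ζ k‖ = 1)
    (hH : ∀ k ∈ s, (H k).PosSemidef) : Contractive fun z => cayley (kernelSum s K ζ H z) := by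
  refine ⟨fun z hz => ?_, fun z hz => norm_cayley_le_one
    (posSemidef_kernelSum hK hζ hH (mem_ball_zero_iff.1 hz).le)⟩
  have hz1 := mem_ball_zero_iff.1 hz
  refine DifferentiableAt.differentiableWithinAt (DifferentiableAt.comp z
    (differentiableAt_cayley (det_add_one_ne_zero (posSemidef_kernelSum hK hζ hH hz1.le)))
    (differentiableAt_kernelSum fun k hk h => ?_))
  rw [h, hζ k hk] at hz1
  exact lt_irrefl _ hz1

theorem eventually_norm_det_of_tendsto {g : ℂ → ℂ} {ζ c : ℂ} (hg : Tendsto g (𝓝[≠] ζ) (𝓝 c))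
    (hc : ‖c‖ = 1) (hζ : ‖ζ‖ = 1) {ε : ℝ} (hε : 0 < ε) :
    ∀ᶠ z in 𝓝 ζ, ‖z‖ < 1 → 1 - ε ≤ ‖g z‖ := by
  have h1 : ∀ᶠ z in 𝓝[≠] ζ, 1 - ε < ‖g z‖ :=
    hg.norm.eventually_const_lt (by rw [hc]; linarith)
  rw [eventually_nhdsWithin_iff] at h1
  filter_upwards [h1] with z hz hz1
  refine (hz ?_).le
  rintro rfl
  exact hz1.ne hζ

/-- On the circle away from the nodes the sum is skew-Hermitian, so its Cayley transform has
unimodular determinant. At a node `ζ_j`, multiplying numerator and denominator of the transform by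
`ζ_j - z` makes both determinants tend to `det(2 ζ_j H_j) ≠ 0`, so their quotient tends to 1. -/
theorem boundaryUnimodular_cayley_kernelSum [DecidableEq ι] (hK : Kᴴ = -K)
    (hζ : ∀ k ∈ s, ‖ζ k‖ = 1) (hinj : Set.InjOn ζ s) (hH : ∀ k ∈ s, (H k).PosSemidef)
    (hdet : ∀ k ∈ s, (H k).det ≠ 0) :
    BoundaryUnimodular fun z => (cayley (kernelSum s K ζ H z)).det := by
  have hcont : ∀ (M : Mat n), Continuous fun X : Mat n => (X + M).det := fun M =>
    Continuous.matrix_det (continuous_id.add continuous_const)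
  refine boundaryUnimodular_of_nhds fun ξ hξ ε hε => ?_
  by_cases hnode : ∃ j ∈ s, ξ = ζ j
  · obtain ⟨j, hj, rfl⟩ := hnode
    set R := kernelSum (s.erase j) K ζ H with hR
    have hRd : ContinuousAt R (ζ j) := (differentiableAt_kernelSum fun k hk h => by
      rw [Finset.mem_erase] at hk
      exact hk.1 (hinj hk.2 hj h.symm)).continuousAt
    have hlim : ∀ M : Mat n, Tendsto
        (fun z => ((ζ j + z) • H j + (ζ j - z) • (R z + M)).det) (𝓝[≠] (ζ j))
        (𝓝 ((2 * ζ j) • H j).det) := fun M => by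
      have hc : ContinuousAt (fun z => ((ζ j + z) • H j + (ζ j - z) • (R z + M)).det) (ζ j) := by
        refine ContinuousAt.comp (g := fun X : Mat n => X.det)
          (Continuous.matrix_det continuous_id).continuousAt ?_
        exact ContinuousAt.add
          (ContinuousAt.smul (f := fun z => ζ j + z) (by fun_prop) continuousAt_const)
          (ContinuousAt.smul (f := fun z => ζ j - z) (by fun_prop) (hRd.add continuousAt_const))
      have := hc.tendsto.mono_left (nhdsWithin_le_nhds (s := {ζ j}ᶜ))
      simpa [two_mul] using this
    have hne : ((2 * ζ j) • H j).det ≠ 0 := by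
      rw [det_smul]
      have : ζ j ≠ 0 := by rw [← norm_pos_iff, hζ j hj]; exact one_pos
      exact mul_ne_zero (pow_ne_zero _ (mul_ne_zero two_ne_zero this)) (hdet j hj)
    have hq := (hlim (-1)).div (hlim 1) hne
    rw [div_self hne] at hq
    refine eventually_norm_det_of_tendsto (c := 1) (hq.congr' ?_) norm_one hξ hε
    filter_upwards [self_mem_nhdsWithin] with z hz
    have hz' : ζ j - z ≠ 0 := sub_ne_zero.2 (Ne.symm hz)
    have hsplit : ∀ M : Mat n, (ζ j + z) • H j + (ζ j - z) • (R z + M) =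
        (ζ j - z) • (kernelSum s K ζ H z + M) := fun M => by
      have : kernelSum s K ζ H z = ((ζ j + z) / (ζ j - z)) • H j + R z := by
        rw [hR, kernelSum, kernelSum, ← Finset.add_sum_erase _ _ hj]; abel
      rw [this, add_assoc, smul_add (ζ j - z) (_ • H j), smul_smul, mul_div_cancel₀ _ hz']
    simp only [Pi.div_apply]
    rw [hsplit, hsplit, det_smul, det_smul, mul_div_mul_left _ _ (pow_ne_zero _ hz'), det_cayley,
      sub_eq_add_neg]
  · push Not at hnode
    have hF : ContinuousAt (kernelSum s K ζ H) ξ :=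
      (differentiableAt_kernelSum hnode).continuousAt
    have hskew : (kernelSum s K ζ H ξ)ᴴ = -kernelSum s K ζ H ξ := by
      have := kernelSum_add_conjTranspose (ζ := ζ) hK hH ξ
      rw [Finset.sum_eq_zero] at this
      · exact eq_neg_of_add_eq_zero_right this
      · intro k hk
        rw [re_kernel, hζ k hk, hξ]
        simp
    have hne : (kernelSum s K ζ H ξ + 1).det ≠ 0 :=
      det_add_one_ne_zero (by rw [hskew, add_neg_cancel]; exact .zero)
    have hc : ContinuousAt (fun z => (cayley (kernelSum s K ζ H z)).det) ξ := by
      simp only [det_cayley, sub_eq_add_neg]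
      exact ((hcont _).continuousAt.comp hF).div ((hcont _).continuousAt.comp hF) hne
    exact eventually_norm_det_of_tendsto (hc.tendsto.mono_left nhdsWithin_le_nhds)
      (norm_det_cayley_of_skew hskew) hξ hε

end RationalInner

/-! ### Riemann sums of continuous vector-valued functions. -/

section RiemannSum
variable {E : Type*} [NormedAddCommGroup E] [NormedSpace ℝ E] [CompleteSpace E]

theorem tendsto_riemannSum {g : ℝ → E} (hg : Continuous g) {T : ℝ} (hT : 0 < T) :
    Tendsto (fun N : ℕ => ((N + 1 : ℝ)⁻¹) •
        ∑ k ∈ Finset.range (N + 1), g (T * (k / (N + 1 : ℝ)))) atTop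
      (𝓝 (T⁻¹ • ∫ x in (0 : ℝ)..T, g x)) := by
  rw [Metric.tendsto_atTop]
  intro ε hε
  have huc := (isCompact_Icc (a := 0) (b := T)).uniformContinuousOn_of_continuous hg.continuousOn
  obtain ⟨δ, hδ, huc⟩ := Metric.uniformContinuousOn_iff_le.1 huc (ε / 2) (by positivity)
  obtain ⟨M, hM⟩ := exists_nat_gt (T / δ)
  refine ⟨M, fun N hN => ?_⟩
  have hN1 : (0 : ℝ) < N + 1 := by positivity
  set x : ℕ → ℝ := fun k => T * (k / (N + 1 : ℝ)) with hx
  have hstep : ∀ k, x (k + 1) - x k = T / (N + 1) := fun k => by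
    simp only [hx]; push_cast; field_simp; ring
  have hsmall : T / (N + 1) ≤ δ := by
    rw [div_le_iff₀ hN1]
    rw [div_lt_iff₀ hδ] at hM
    have : (M : ℝ) ≤ N := by exact_mod_cast hN
    nlinarith
  have hinteg : ∀ a b, IntervalIntegrable g MeasureTheory.volume a b :=
    fun a b => hg.intervalIntegrable a b
  have hsum : ∑ k ∈ Finset.range (N + 1), ∫ t in x k..x (k + 1), g t = ∫ t in (0 : ℝ)..T, g t := by
    rw [intervalIntegral.sum_integral_adjacent_intervals fun k _ => hinteg _ _]
    have h0 : x 0 = 0 := by simp [hx]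
    have h1 : x (N + 1) = T := by simp only [hx]; push_cast; field_simp
    rw [h0, h1]
  have hterm : ∀ k ∈ Finset.range (N + 1),
      ‖(T / (N + 1)) • g (x k) - ∫ t in x k..x (k + 1), g t‖ ≤ ε / 2 * (T / (N + 1)) := by
    intro k hk
    rw [Finset.mem_range] at hk
    have hle : x k ≤ x (k + 1) := by
      rw [← sub_nonneg, hstep]; positivity
    have hc : (T / (N + 1)) • g (x k) = ∫ _ in x k..x (k + 1), g (x k) := by
      rw [intervalIntegral.integral_const, hstep]
    rw [hc, ← intervalIntegral.integral_sub (by simp) (hinteg _ _)]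
    have hb := intervalIntegral.norm_integral_le_of_norm_le_const (a := x k) (b := x (k + 1))
      (C := ε / 2) (f := fun t => g (x k) - g t) fun t ht => ?_
    · rwa [hstep, abs_of_nonneg (by positivity)] at hb
    · rw [uIoc_of_le hle] at ht
      have hk0 : 0 ≤ x k := by simp only [hx]; positivity
      have hkT : x (k + 1) ≤ T := by
        simp only [hx]
        refine mul_le_of_le_one_right hT.le ((div_le_one hN1).2 ?_)
        exact_mod_cast hk
      rw [← dist_eq_norm]
      refine huc _ ⟨hk0, hle.trans hkT⟩ _ ⟨hk0.trans ht.1.le, ht.2.trans hkT⟩ ?_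
      rw [Real.dist_eq, abs_of_nonpos (by linarith [ht.1])]
      linarith [ht.2, hstep k]
  have hkey : ((N + 1 : ℝ)⁻¹) • ∑ k ∈ Finset.range (N + 1), g (x k) - T⁻¹ • ∫ t in (0 : ℝ)..T, g t
      = T⁻¹ • ∑ k ∈ Finset.range (N + 1),
        ((T / (N + 1)) • g (x k) - ∫ t in x k..x (k + 1), g t) := by
    rw [Finset.sum_sub_distrib, hsum, ← Finset.smul_sum, smul_sub, smul_smul]
    congr 2
    field_simp
  rw [dist_eq_norm, hkey, norm_smul, norm_inv, Real.norm_of_nonneg hT.le]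
  have : ‖∑ k ∈ Finset.range (N + 1),
      ((T / (N + 1)) • g (x k) - ∫ t in x k..x (k + 1), g t)‖ ≤ ε / 2 * T := by
    refine (norm_sum_le_of_le _ hterm).trans_eq ?_
    rw [Finset.sum_const, Finset.card_range, nsmul_eq_mul]
    push_cast
    field_simp
  calc T⁻¹ * _ ≤ T⁻¹ * (ε / 2 * T) := mul_le_mul_of_nonneg_left this (by positivity)
    _ = ε / 2 := by field_simp
    _ < ε := by linarith

end RiemannSum

/-! ### The Herglotz formula and approximation by rational inner functions. -/

section Herglotz
variable {n : ℕ}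

theorem circleAverage_conjTranspose {f : ℂ → Mat n} (hf : CircleIntegrable f 0 1) :
    Real.circleAverage (fun ζ => (f ζ)ᴴ) 0 1 = (Real.circleAverage f 0 1)ᴴ :=
  (ContinuousLinearMap.circleAverage_comp_comm
    ((starL' ℝ : Mat n ≃L[ℝ] Mat n) : Mat n →L[ℝ] Mat n) hf)

/-- With `k` the kernel, `k (f + fᴴ) / 2 = k f / 2 - (k f)ᴴ / 2 + (Re k · f)ᴴ`. The averages of `k
f` and `Re k · f` are `2 f(w) - f(0)` and `f(w)`, by the Cauchy and Poisson formulas. -/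
theorem herglotz_formula {f : ℂ → Mat n} (hf : DiffContOnCl ℂ f (Metric.ball 0 1)) {w : ℂ}
    (hw : w ∈ disk) :
    Real.circleAverage (fun ζ => ((ζ + w) / (ζ - w)) • ((2⁻¹ : ℂ) • (f ζ + (f ζ)ᴴ))) 0 1 =
      f w - (2⁻¹ : ℂ) • (f 0 - (f 0)ᴴ) := by
  have hw1 : ‖w‖ < 1 := mem_ball_zero_iff.1 hw
  have hne : ∀ ζ ∈ Metric.sphere (0 : ℂ) 1, ζ - w ≠ 0 := fun ζ hζ h => by
    rw [sub_eq_zero.1 h, mem_sphere_zero_iff_norm] at hζ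
    linarith
  have hfc : ContinuousOn f (Metric.sphere (0 : ℂ) 1) :=
    hf.continuousOn_ball.mono Metric.sphere_subset_closedBall
  have hkc : ContinuousOn (fun ζ : ℂ => (ζ + w) / (ζ - w)) (Metric.sphere (0 : ℂ) 1) :=
    ContinuousOn.div (by fun_prop) (by fun_prop) hne
  have hlc : ContinuousOn (fun ζ : ℂ => ζ / (ζ - w)) (Metric.sphere (0 : ℂ) 1) :=
    ContinuousOn.div (by fun_prop) (by fun_prop) hne
  set p : ℂ → Mat n := fun ζ => ((ζ + w) / (ζ - w)) • f ζ with hp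
  set q : ℂ → Mat n := fun ζ => (((ζ + w) / (ζ - w)).re : ℝ) • f ζ with hq
  have hpi : CircleIntegrable p 0 1 := (hkc.smul hfc).circleIntegrable zero_le_one
  have hqi : CircleIntegrable q 0 1 :=
    ((Complex.continuous_re.comp_continuousOn hkc).smul hfc).circleIntegrable zero_le_one
  have hq' : Real.circleAverage q 0 1 = f w := by
    have := hf.circleAverage_re_herglotzRieszKernel_smul' (c := 0) (R := 1) (w := w) hw
    simpa using this
  have hp' : Real.circleAverage p 0 1 = (2 : ℝ) • f w - f 0 := by
    have h1 : Real.circleAverage (fun ζ => (ζ / (ζ - w)) • f ζ) 0 1 = f w := by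
      have := DiffContOnCl.circleAverage_smul_div (c := 0) (R := 1) (w := w) (f := f)
        (by simpa using hf) (by simpa using hw1)
      simpa using this
    have h2 : Real.circleAverage f 0 1 = f 0 :=
      DiffContOnCl.circleAverage (c := 0) (R := 1) (by simpa using hf)
    rw [← h1, ← h2, ← Real.circleAverage_fun_smul, ← Real.circleAverage_fun_sub]
    · refine Real.circleAverage_congr_sphere fun ζ hζ => ?_
      have := hne ζ (by simpa using hζ)
      simp only [hp]
      have hk : (ζ + w) / (ζ - w) = ((2 : ℝ) : ℂ) * (ζ / (ζ - w)) - 1 := by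
        field_simp; push_cast; ring
      rw [hk, sub_smul, one_smul, mul_smul, Complex.coe_smul]
    · exact (ContinuousOn.const_smul (hlc.smul hfc) (2 : ℝ)).circleIntegrable zero_le_one
    · exact hfc.circleIntegrable zero_le_one
  have hps : CircleIntegrable (fun ζ => (p ζ)ᴴ) 0 1 :=
    (continuous_star.comp_continuousOn (hkc.smul hfc)).circleIntegrable zero_le_one
  have hqs : CircleIntegrable (fun ζ => (q ζ)ᴴ) 0 1 :=
    (continuous_star.comp_continuousOn
      ((Complex.continuous_re.comp_continuousOn hkc).smul hfc)).circleIntegrable zero_le_one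
  have hpi' : CircleIntegrable (fun ζ => (2⁻¹ : ℝ) • p ζ) 0 1 :=
    (ContinuousOn.const_smul (hkc.smul hfc) (2⁻¹ : ℝ)).circleIntegrable zero_le_one
  have hps' : CircleIntegrable (fun ζ => (2⁻¹ : ℝ) • (p ζ)ᴴ) 0 1 :=
    (ContinuousOn.const_smul (continuous_star.comp_continuousOn (hkc.smul hfc))
      (2⁻¹ : ℝ)).circleIntegrable zero_le_one
  have hdi : CircleIntegrable (fun ζ => (2⁻¹ : ℝ) • p ζ - (2⁻¹ : ℝ) • (p ζ)ᴴ) 0 1 := hpi'.sub hps'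
  have hsplit : (fun ζ : ℂ => ((ζ + w) / (ζ - w)) • ((2⁻¹ : ℂ) • (f ζ + (f ζ)ᴴ))) =
      fun ζ => ((2⁻¹ : ℝ) • p ζ - (2⁻¹ : ℝ) • (p ζ)ᴴ) + (q ζ)ᴴ := by
    funext ζ
    simp only [hp, hq]
    set c := (ζ + w) / (ζ - w)
    have hc : (c.re : ℂ) = 2⁻¹ * c + 2⁻¹ * star c := by
      have := Complex.add_conj c
      rw [starRingEnd_apply] at this
      rw [← mul_add, this]; push_cast; ring
    have hqq : ((c.re : ℝ) • f ζ)ᴴ = (c.re : ℂ) • (f ζ)ᴴ := by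
      rw [conjTranspose_smul, star_trivial, Complex.coe_smul]
    have hreal : ∀ X : Mat n, (2⁻¹ : ℝ) • X = (2⁻¹ : ℂ) • X := fun X => by
      rw [← Complex.coe_smul]; push_cast; rfl
    rw [hqq, hc, hreal, hreal, conjTranspose_smul]
    module
  rw [hsplit, Real.circleAverage_fun_add, Real.circleAverage_fun_sub,
    Real.circleAverage_fun_smul, Real.circleAverage_fun_smul, circleAverage_conjTranspose hpi,
    circleAverage_conjTranspose hqi, hp', hq', conjTranspose_sub, conjTranspose_smul, star_trivial]
  · have hreal : ∀ X : Mat n, (2⁻¹ : ℂ) • X = (2⁻¹ : ℝ) • X := fun X => by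
      rw [← Complex.coe_smul]; push_cast; rfl
    rw [hreal]
    module
  · exact hpi'
  · exact hps'
  · exact hdi
  · exact hqs

/-- The nodes of the Riemann sums: the roots of unity. -/
def node (N k : ℕ) : ℂ := circleMap 0 1 (2 * Real.pi * (k / (N + 1 : ℝ)))

theorem norm_node (N k : ℕ) : ‖node N k‖ = 1 := by simp [node]

theorem injOn_node (N : ℕ) : Set.InjOn (node N) (Finset.range (N + 1)) := by
  intro j hj k hk h
  have hN : (0 : ℝ) < N + 1 := by positivity
  have hmem : ∀ i ∈ (Finset.range (N + 1) : Set ℕ),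
      2 * Real.pi * (i / (N + 1 : ℝ)) ∈ Ico 0 (2 * Real.pi) := fun i hi => by
    have hi' : (i : ℝ) < N + 1 := by
      have : i < N + 1 := by simpa using hi
      exact_mod_cast this
    refine ⟨by positivity, ?_⟩
    have := (div_lt_one hN).2 hi'
    nlinarith [Real.pi_pos]
  have h1 := injOn_circleMap_of_abs_sub_le' (a := 0) (b := 2 * Real.pi) one_ne_zero (by simp)
    (hmem j hj) (hmem k hk) h
  have h2 := mul_left_cancel₀ (by positivity) h1
  rw [div_left_inj' hN.ne'] at h2
  exact_mod_cast h2

/-- The Riemann sum approximation to the Herglotz formula. -/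
def herglotzApprox (f : ℂ → Mat n) (N : ℕ) (z : ℂ) : Mat n :=
  kernelSum (Finset.range (N + 1)) ((2⁻¹ : ℂ) • (f 0 - (f 0)ᴴ)) (node N)
    (fun k => (((N + 1 : ℝ)⁻¹ / 2 : ℝ) : ℂ) • (f (node N k) + (f (node N k))ᴴ)) z

theorem tendsto_herglotzApprox {f : ℂ → Mat n} (hf : DiffContOnCl ℂ f (Metric.ball 0 1)) {z : ℂ}
    (hz : z ∈ disk) : Tendsto (fun N => herglotzApprox f N z) atTop (𝓝 (f z)) := by
  have hz1 : ‖z‖ < 1 := mem_ball_zero_iff.1 hz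
  set g : ℝ → Mat n := fun t => ((circleMap 0 1 t + z) / (circleMap 0 1 t - z)) •
    ((2⁻¹ : ℂ) • (f (circleMap 0 1 t) + (f (circleMap 0 1 t))ᴴ)) with hg
  have hfc : Continuous fun t => f (circleMap 0 1 t) :=
    hf.continuousOn_ball.comp_continuous (continuous_circleMap 0 1)
      fun t => circleMap_mem_closedBall 0 zero_le_one t
  have hgc : Continuous g := by
    have hk : Continuous fun t => (circleMap 0 1 t + z) / (circleMap 0 1 t - z) := by
      refine Continuous.div ((continuous_circleMap 0 1).add continuous_const)
        ((continuous_circleMap 0 1).sub continuous_const) fun t h => ?_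
      rw [← sub_eq_zero.1 h] at hz1
      simp at hz1
    have h2 : Continuous fun t => f (circleMap 0 1 t) + (f (circleMap 0 1 t))ᴴ :=
      hfc.add (continuous_star.comp hfc)
    exact hk.smul ((continuous_const_smul (2⁻¹ : ℂ)).comp h2)
  have hlim := tendsto_riemannSum hgc Real.two_pi_pos
  have hinteg : (2 * Real.pi)⁻¹ • ∫ t in (0 : ℝ)..2 * Real.pi, g t =
      f z - (2⁻¹ : ℂ) • (f 0 - (f 0)ᴴ) := herglotz_formula hf hz
  rw [hinteg] at hlim
  have := (tendsto_const_nhds (x := (2⁻¹ : ℂ) • (f 0 - (f 0)ᴴ))).add hlim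
  rw [add_sub_cancel] at this
  refine this.congr fun N => ?_
  rw [herglotzApprox, kernelSum, Finset.smul_sum]
  congr 1
  refine Finset.sum_congr rfl fun k _ => ?_
  simp only [hg, node]
  rw [← Complex.coe_smul, smul_smul, smul_smul, smul_smul]
  congr 1
  push_cast
  ring

/-- Rational inner approximants to a contractive function. -/
def innerApprox (A : ℂ → Mat n) (i : ℕ × ℕ) (z : ℂ) : Mat n :=
  cayley (herglotzApprox
    (fun z => invCayley (((1 - ((i.1 : ℝ) + 2)⁻¹ : ℝ) : ℂ) • A ((1 - ((i.1 : ℝ) + 2)⁻¹ : ℝ) * z)))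
    i.2 z)

theorem scale_mem (m : ℕ) : (1 - ((m : ℝ) + 2)⁻¹) ∈ Ioo (0 : ℝ) 1 := by
  have h : (0 : ℝ) < ((m : ℝ) + 2)⁻¹ := by positivity
  have h2 : ((m : ℝ) + 2)⁻¹ < 1 := inv_lt_one_of_one_lt₀ (by
    have : (0 : ℝ) ≤ m := by positivity
    linarith)
  constructor <;> linarith

/-- The outer factor `r` gives strict contractivity, needed for the inverse Cayley transform; the
inner one keeps the argument inside the open disk even when `|z| = 1`. -/
theorem Contractive.norm_scale_lt {A : ℂ → Mat n} (hA : Contractive A) {r : ℝ}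
    (hr : r ∈ Ioo (0 : ℝ) 1) {z : ℂ} (hz : ‖z‖ ≤ 1) : ‖(r : ℂ) • A (r * z)‖ < 1 := by
  have hrn : ‖(r : ℂ)‖ = r := by rw [Complex.norm_real, Real.norm_of_nonneg hr.1.le]
  have hmem : (r : ℂ) * z ∈ disk := by
    rw [mem_ball_zero_iff, norm_mul, hrn]
    nlinarith [hr.1, hr.2, norm_nonneg z]
  rw [norm_smul, hrn]
  nlinarith [hA.norm_le _ hmem, hr.1, hr.2]

theorem Contractive.diffContOnCl_scale {A : ℂ → Mat n} (hA : Contractive A) {r : ℝ}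
    (hr : r ∈ Ioo (0 : ℝ) 1) :
    DiffContOnCl ℂ (fun z => invCayley ((r : ℂ) • A (r * z))) (Metric.ball 0 1) := by
  refine DifferentiableOn.diffContOnCl fun z hz => ?_
  have hz1 : ‖z‖ ≤ 1 := mem_closedBall_zero_iff.1 (Metric.closure_ball_subset_closedBall hz)
  have hrn : ‖(r : ℂ)‖ = r := by rw [Complex.norm_real, Real.norm_of_nonneg hr.1.le]
  have hmem : (r : ℂ) * z ∈ disk := by
    rw [mem_ball_zero_iff, norm_mul, hrn]
    nlinarith [hr.1, hr.2, norm_nonneg z]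
  refine DifferentiableAt.differentiableWithinAt (DifferentiableAt.comp z
    (g := invCayley) (f := fun z => (r : ℂ) • A (r * z))
    (differentiableAt_invCayley (hA.norm_scale_lt hr hz1)) ?_)
  have hcomp : DifferentiableAt ℂ (fun z => A (r * z)) z :=
    DifferentiableAt.comp z (g := A) (f := fun z => (r : ℂ) * z)
      (hA.diff.differentiableAt (Metric.isOpen_ball.mem_nhds hmem)) (by fun_prop)
  exact hcomp.const_smul (r : ℂ)

theorem Contractive.innerApprox_spec {A : ℂ → Mat n} (hA : Contractive A) (i : ℕ × ℕ) :
    Contractive (innerApprox A i) ∧ BoundaryUnimodular fun z => (innerApprox A i z).det := by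
  obtain ⟨m, N⟩ := i
  have hr := scale_mem m
  set r : ℝ := 1 - ((m : ℝ) + 2)⁻¹
  have hK : ∀ X : Mat n, ((2⁻¹ : ℂ) • (X - Xᴴ))ᴴ = -((2⁻¹ : ℂ) • (X - Xᴴ)) := fun X => by
    have : star (2⁻¹ : ℂ) = 2⁻¹ := by simp
    rw [conjTranspose_smul, conjTranspose_sub, conjTranspose_conjTranspose, this, ← smul_neg,
      neg_sub]
  have hpos : 0 < ((N + 1 : ℝ)⁻¹ / 2 : ℝ) := by positivity
  have hlt : ∀ k, ‖(r : ℂ) • A (r * node N k)‖ < 1 :=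
    fun k => hA.norm_scale_lt hr (norm_node N k).le
  refine ⟨contractive_cayley_kernelSum (hK _) (fun k _ => norm_node N k) fun k _ => ?_,
    boundaryUnimodular_cayley_kernelSum (hK _) (fun k _ => norm_node N k) (injOn_node N)
      (fun k _ => ?_) fun k _ => ?_⟩
  · exact (posSemidef_invCayley (hlt k)).smul (Complex.zero_le_real.2 hpos.le)
  · exact (posSemidef_invCayley (hlt k)).smul (Complex.zero_le_real.2 hpos.le)
  · rw [det_smul]
    refine mul_ne_zero (pow_ne_zero _ ?_) (det_invCayley_add_ne_zero (hlt k))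
    exact_mod_cast hpos.ne'

/-- An iterated limit, first in the number of nodes at fixed radius, then in the radius. The curried
filter expresses it without a diagonal sequence. -/
theorem Contractive.tendsto_innerApprox {A : ℂ → Mat n} (hA : Contractive A) {z : ℂ}
    (hz : z ∈ disk) :
    Tendsto (fun i => innerApprox A i z) ((atTop : Filter ℕ).curry (atTop : Filter ℕ))
      (𝓝 (A z)) := by
  have hz1 : ‖z‖ < 1 := mem_ball_zero_iff.1 hz
  have hinner : ∀ m : ℕ, Tendsto (fun N => innerApprox A (m, N) z) atTop
      (𝓝 (((1 - ((m : ℝ) + 2)⁻¹ : ℝ) : ℂ) • A ((1 - ((m : ℝ) + 2)⁻¹ : ℝ) * z))) := fun m => by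
    have hr := scale_mem m
    have h1 := tendsto_herglotzApprox (hA.diffContOnCl_scale hr) hz
    have hlt := hA.norm_scale_lt hr hz1.le
    have hc : ContinuousAt (cayley : Mat n → Mat n) _ :=
      (differentiableAt_cayley (det_add_one_ne_zero (posSemidef_invCayley hlt))).continuousAt
    have h2 := hc.tendsto.comp h1
    rw [cayley_invCayley hlt] at h2
    exact h2
  have houter : Tendsto (fun m : ℕ =>
      ((1 - ((m : ℝ) + 2)⁻¹ : ℝ) : ℂ) • A ((1 - ((m : ℝ) + 2)⁻¹ : ℝ) * z)) atTop (𝓝 (A z)) := by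
    have h1 : Tendsto (fun m : ℕ => ((1 - ((m : ℝ) + 2)⁻¹ : ℝ) : ℂ)) atTop (𝓝 1) := by
      have h2 : Tendsto (fun m : ℕ => ((m : ℝ) + 2)⁻¹) atTop (𝓝 0) :=
        tendsto_inv_atTop_zero.comp (tendsto_atTop_add_const_right _ _ tendsto_natCast_atTop_atTop)
      have h3 := (Complex.continuous_ofReal.tendsto _).comp (h2.const_sub 1)
      simpa [Function.comp_def] using h3
    have hAc : ContinuousAt A z :=
      (hA.diff.differentiableAt (Metric.isOpen_ball.mem_nhds hz)).continuousAt
    have h4 : Tendsto (fun m : ℕ => ((1 - ((m : ℝ) + 2)⁻¹ : ℝ) : ℂ) * z) atTop (𝓝 z) := by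
      simpa using h1.mul_const z
    simpa using h1.smul (hAc.tendsto.comp h4)
  intro s hs
  obtain ⟨V, hVs, hVo, hzV⟩ := mem_nhds_iff.1 hs
  rw [mem_map, mem_curry_iff]
  filter_upwards [houter.eventually (hVo.mem_nhds hzV)] with m hm
  filter_upwards [(hinner m).eventually (hVo.mem_nhds hm)] with N hN
  exact hVs hN

end Herglotz

/-! ### Second-order estimates for exponentials. -/

section Exponential
variable {n : ℕ}

theorem norm_pow_le_pow (X : Mat n) (k : ℕ) : ‖X ^ k‖ ≤ ‖X‖ ^ k := by
  rcases Nat.eq_zero_or_pos k with rfl | hk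
  · simpa using norm_one_le_one
  · exact norm_pow_le' X hk

theorem norm_matrix_exp_le (X : Mat n) : ‖NormedSpace.exp X‖ ≤ Real.exp ‖X‖ := by
  have h1 := NormedSpace.exp_series_hasSum_exp' (𝕂 := ℂ) X
  have h2 := NormedSpace.exp_series_hasSum_exp' (𝕂 := ℝ) ‖X‖
  rw [← Real.exp_eq_exp_ℝ] at h2
  rw [← h1.tsum_eq]
  refine tsum_of_norm_bounded h2 fun k => ?_
  rw [norm_smul, norm_inv, Complex.norm_natCast, smul_eq_mul]
  exact mul_le_mul_of_nonneg_left (norm_pow_le_pow X k) (by positivity)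

theorem norm_matrix_exp_sub_one_sub_le (X : Mat n) :
    ‖NormedSpace.exp X - 1 - X‖ ≤ ‖X‖ ^ 2 * Real.exp ‖X‖ := by
  have h1 := (hasSum_nat_add_iff' 2).2 (NormedSpace.exp_series_hasSum_exp' (𝕂 := ℂ) X)
  have h2 := (NormedSpace.exp_series_hasSum_exp' (𝕂 := ℝ) ‖X‖).mul_left (‖X‖ ^ 2)
  rw [← Real.exp_eq_exp_ℝ] at h2
  have h3 : NormedSpace.exp X - ∑ i ∈ Finset.range 2, ((i.factorial : ℂ)⁻¹) • X ^ i =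
      NormedSpace.exp X - 1 - X := by
    simp [Finset.sum_range_succ, sub_sub]
  rw [h3] at h1
  rw [← h1.tsum_eq]
  refine tsum_of_norm_bounded h2 fun k => ?_
  rw [norm_smul, norm_inv, Complex.norm_natCast, smul_eq_mul]
  have h4 : (((k + 2).factorial : ℝ))⁻¹ ≤ ((k.factorial : ℝ))⁻¹ := by
    refine inv_anti₀ (by positivity) ?_
    exact_mod_cast Nat.factorial_le (by omega)
  calc (((k + 2).factorial : ℝ))⁻¹ * ‖X ^ (k + 2)‖ ≤ ((k.factorial : ℝ))⁻¹ * ‖X‖ ^ (k + 2) :=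
        mul_le_mul h4 (norm_pow_le_pow X _) (norm_nonneg _) (by positivity)
    _ = _ := by ring

theorem norm_cexp_sub_one_le (x : ℂ) : ‖Complex.exp x - 1‖ ≤ ‖x‖ * Real.exp ‖x‖ := by
  simpa using Complex.norm_exp_sub_sum_le_norm_mul_exp x 1

theorem norm_cexp_sub_one_sub_le (x : ℂ) :
    ‖Complex.exp x - 1 - x‖ ≤ ‖x‖ ^ 2 * Real.exp ‖x‖ := by
  have := Complex.norm_exp_sub_sum_le_norm_mul_exp x 2
  simpa [Finset.sum_range_succ, sub_sub] using this

end Exponential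

/-! ### Truncation to an interval. -/

section Clamp

/-- The projection of `t` to `[0, d]`. -/
def clamp (d t : ℝ) : ℝ := max 0 (min t d)

theorem clamp_nonneg (d t : ℝ) : 0 ≤ clamp d t := le_max_left _ _

theorem clamp_mono (d : ℝ) : Monotone (clamp d) :=
  fun _ _ h => max_le_max le_rfl (min_le_min h le_rfl)

theorem clamp_of_nonpos {d t : ℝ} (ht : t ≤ 0) : clamp d t = 0 :=
  max_eq_left ((min_le_left _ _).trans ht)

theorem clamp_of_le {d t : ℝ} (hd : 0 ≤ d) (h : d ≤ t) : clamp d t = d := by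
  rw [clamp, min_eq_right h, max_eq_right hd]

theorem clamp_of_mem {d t : ℝ} (h0 : 0 ≤ t) (h : t ≤ d) : clamp d t = t := by
  rw [clamp, min_eq_left h, max_eq_right h0]

theorem clamp_le {d t : ℝ} (hd : 0 ≤ d) : clamp d t ≤ d := max_le hd (min_le_right _ _)

theorem clamp_sub_le (d : ℝ) {s t : ℝ} (h : s ≤ t) : clamp d t - clamp d s ≤ t - s := by
  unfold clamp
  rcases max_cases 0 (min t d) with ⟨h1, h1'⟩ | ⟨h1, h1'⟩ <;>
  rcases max_cases 0 (min s d) with ⟨h2, h2'⟩ | ⟨h2, h2'⟩ <;>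
  rcases min_cases t d with ⟨h3, h3'⟩ | ⟨h3, h3'⟩ <;>
  rcases min_cases s d with ⟨h4, h4'⟩ | ⟨h4, h4'⟩ <;> linarith

/-- Progress along two adjacent intervals is the sum of the progress along each; this matches the
recursion that shifts the argument by the length of the first step. -/
theorem clamp_add {d e : ℝ} (hd : 0 ≤ d) (he : 0 ≤ e) (t : ℝ) :
    clamp (d + e) t = clamp d t + clamp e (t - d) := by
  rcases le_total t 0 with h | h
  · rw [clamp_of_nonpos h, clamp_of_nonpos h, clamp_of_nonpos (by linarith), add_zero]
  rcases le_total t d with h1 | h1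
  · rw [clamp_of_mem h h1, clamp_of_mem h (by linarith), clamp_of_nonpos (by linarith), add_zero]
  rw [clamp_of_le hd h1]
  rcases le_total t (d + e) with h2 | h2
  · rw [clamp_of_mem h h2, clamp_of_mem (by linarith) (by linarith)]; ring
  · rw [clamp_of_le (by linarith) h2, clamp_of_le he (by linarith)]

end Clamp

/-! ### Lists of steps and their ordered products of exponentials. -/

section StepData
variable {n : ℕ}

/-- A step: a length, an angle and a projection. -/
structure Step (n : ℕ) where
  len : ℝ
  ang : ℝ
  proj : Mat n

/-- The conditions on a list of steps: the angles increase, and the projections have trace `1`. -/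
structure ValidSteps (l : List (Step n)) : Prop where
  len_nonneg : ∀ p ∈ l, 0 ≤ p.len
  len_le : ∀ p ∈ l, p.len ≤ 1
  ang_mem : ∀ p ∈ l, p.ang ∈ Icc 0 (2 * Real.pi)
  proj : ∀ p ∈ l, IsStarProjection p.proj
  trace : ∀ p ∈ l, p.proj.trace = 1
  sorted : l.Pairwise fun p q => p.ang ≤ q.ang

theorem ValidSteps.tail {p : Step n} {l : List (Step n)} (h : ValidSteps (p :: l)) :
    ValidSteps l :=
  ⟨fun q hq => h.len_nonneg q (List.mem_cons_of_mem _ hq),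
    fun q hq => h.len_le q (List.mem_cons_of_mem _ hq),
    fun q hq => h.ang_mem q (List.mem_cons_of_mem _ hq),
    fun q hq => h.proj q (List.mem_cons_of_mem _ hq),
    fun q hq => h.trace q (List.mem_cons_of_mem _ hq), (List.pairwise_cons.1 h.sorted).2⟩

/-- Total length. -/
def total (l : List (Step n)) : ℝ := (l.map Step.len).sum

theorem total_cons (p : Step n) (l : List (Step n)) : total (p :: l) = p.len + total l := by
  simp [total]

theorem ValidSteps.total_nonneg {l : List (Step n)} (h : ValidSteps l) : 0 ≤ total l :=
  List.sum_nonneg fun x hx => by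
    obtain ⟨p, hp, rfl⟩ := List.mem_map.1 hx
    exact h.len_nonneg p hp

/-- The exponential of `a • P` for a projection `P`. -/
def expFactor (a : ℂ) (P : Mat n) : Mat n := 1 - P + Complex.exp a • P

theorem expFactor_zero (P : Mat n) : expFactor 0 P = 1 := by simp [expFactor]

theorem expFactor_add {P : Mat n} (hP : IsStarProjection P) (a b : ℂ) :
    expFactor (a + b) P = expFactor a P * expFactor b P := by
  have h2 := isStarProjection_mul_self hP
  simp only [expFactor, Complex.exp_add, add_mul, mul_add, sub_mul, mul_sub, one_mul, mul_one,
    smul_mul_assoc, mul_smul_comm, h2]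
  module

theorem norm_expFactor_le_one {P : Mat n} (hP : IsStarProjection P) {a : ℂ} (ha : a.re ≤ 0) :
    ‖expFactor a P‖ ≤ 1 :=
  norm_one_sub_add_smul_le_one hP (by rw [Complex.norm_exp]; exact Real.exp_le_one_iff.2 ha)

/-- The ordered product of the exponentials over the part of the steps between `s` and `t`. -/
def cocycle (c : ℝ → ℂ) : List (Step n) → ℝ → ℝ → Mat n
  | [], _, _ => 1
  | p :: l, s, t => expFactor (c p.ang * ((clamp p.len t - clamp p.len s : ℝ) : ℂ)) p.proj *
      cocycle c l (s - p.len) (t - p.len)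

/-- The first-order part of `cocycle`. -/
def linearPart (c : ℝ → ℂ) : List (Step n) → ℝ → ℝ → Mat n
  | [], _, _ => 0
  | p :: l, s, t => (c p.ang * ((clamp p.len t - clamp p.len s : ℝ) : ℂ)) • p.proj +
      linearPart c l (s - p.len) (t - p.len)

/-- The accumulated weight up to `t`. -/
def weight : List (Step n) → ℝ → Mat n
  | [], _ => 0
  | p :: l, t => ((clamp p.len t : ℝ) : ℂ) • p.proj + weight l (t - p.len)

/-- The angle at `t`. -/
def angleAt : List (Step n) → ℝ → ℝ
  -- Beyond the last step the largest admissible angle is used, so that the function stays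
  -- increasing.
  | [], _ => 2 * Real.pi
  | p :: l, t => if t < p.len then p.ang else angleAt l (t - p.len)

theorem ValidSteps.angleAt_mem {l : List (Step n)} (h : ValidSteps l) (t : ℝ) :
    angleAt l t ∈ Icc 0 (2 * Real.pi) := by
  induction l generalizing t with
  | nil => exact ⟨Real.two_pi_pos.le, le_rfl⟩
  | cons p l ih =>
    rw [angleAt]
    split_ifs
    · exact h.ang_mem p List.mem_cons_self
    · exact ih h.tail _

theorem le_angleAt {l : List (Step n)} {φ : ℝ} (hφ : φ ≤ 2 * Real.pi) (h : ∀ p ∈ l, φ ≤ p.ang)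
    (t : ℝ) : φ ≤ angleAt l t := by
  induction l generalizing t with
  | nil => exact hφ
  | cons p l ih =>
    rw [angleAt]
    split_ifs
    · exact h p List.mem_cons_self
    · exact ih (fun q hq => h q (List.mem_cons_of_mem _ hq)) _

theorem ValidSteps.angleAt_mono {l : List (Step n)} (h : ValidSteps l) : Monotone (angleAt l) := by
  induction l with
  | nil => exact monotone_const
  | cons p l ih =>
    intro s t hst
    rw [angleAt, angleAt]
    split_ifs with h1 h2 h2
    · exact le_rfl
    · exact le_angleAt (h.ang_mem p List.mem_cons_self).2 (List.pairwise_cons.1 h.sorted).1 _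
    · linarith
    · exact ih h.tail (by linarith)

theorem cocycle_of_nonpos (c : ℝ → ℂ) {l : List (Step n)} (h : ValidSteps l) {s t : ℝ} (hs : s ≤ 0)
    (ht : t ≤ 0) : cocycle c l s t = 1 := by
  induction l generalizing s t with
  | nil => rfl
  | cons p l ih =>
    have hp := h.len_nonneg p List.mem_cons_self
    rw [cocycle, clamp_of_nonpos hs, clamp_of_nonpos ht, ih h.tail (by linarith) (by linarith)]
    simp [expFactor_zero]

/-- No commutation is needed: if `t` is past the first step, its factor over `[t, u]` is trivial;
otherwise the tail over `[s, t]` is trivial. -/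
theorem cocycle_mul (c : ℝ → ℂ) {l : List (Step n)} (h : ValidSteps l) {s t u : ℝ} (hst : s ≤ t)
    (htu : t ≤ u) : cocycle c l s t * cocycle c l t u = cocycle c l s u := by
  induction l generalizing s t u with
  | nil => simp [cocycle]
  | cons p l ih =>
    have hp := h.len_nonneg p List.mem_cons_self
    have hP := h.proj p List.mem_cons_self
    have hih := ih h.tail (s := s - p.len) (t := t - p.len) (u := u - p.len) (by linarith)
      (by linarith)
    have hadd : expFactor (c p.ang * ((clamp p.len u - clamp p.len s : ℝ) : ℂ)) p.proj =
        expFactor (c p.ang * ((clamp p.len t - clamp p.len s : ℝ) : ℂ)) p.proj *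
        expFactor (c p.ang * ((clamp p.len u - clamp p.len t : ℝ) : ℂ)) p.proj := by
      rw [← expFactor_add hP]; congr 1; push_cast; ring
    simp only [cocycle]
    rw [hadd, ← hih]
    rcases le_total p.len t with h1 | h1
    · have h2 : expFactor (c p.ang * ((clamp p.len u - clamp p.len t : ℝ) : ℂ)) p.proj = 1 := by
        rw [clamp_of_le hp h1, clamp_of_le hp (h1.trans htu), sub_self]
        simp [expFactor_zero]
      rw [h2, one_mul, mul_one, mul_assoc]
    · rw [cocycle_of_nonpos c h.tail (by linarith : s - p.len ≤ 0) (by linarith : t - p.len ≤ 0)]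
      simp only [mul_one, one_mul, mul_assoc]

theorem norm_cocycle_le_one {c : ℝ → ℂ} (hc : ∀ φ, (c φ).re ≤ 0) {l : List (Step n)}
    (h : ValidSteps l) {s t : ℝ} (hst : s ≤ t) : ‖cocycle c l s t‖ ≤ 1 := by
  induction l generalizing s t with
  | nil => exact norm_one_le_one
  | cons p l ih =>
    rw [cocycle]
    refine (norm_mul_le _ _).trans (mul_le_one₀ (norm_expFactor_le_one
      (h.proj p List.mem_cons_self) ?_) (norm_nonneg _) (ih h.tail (by linarith)))
    rw [Complex.re_mul_ofReal]
    exact mul_nonpos_of_nonpos_of_nonneg (hc _) (sub_nonneg.2 (clamp_mono _ hst))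

theorem weight_trace {l : List (Step n)} (h : ValidSteps l) (t : ℝ) :
    (weight l t).trace = ((clamp (total l) t : ℝ) : ℂ) := by
  induction l generalizing t with
  | nil => simp [weight, total, clamp]
  | cons p l ih =>
    rw [weight, trace_add, trace_smul, h.trace p List.mem_cons_self, ih h.tail, total_cons,
      clamp_add (h.len_nonneg p List.mem_cons_self) h.tail.total_nonneg]
    simp

theorem weight_isHermitian {l : List (Step n)} (h : ValidSteps l) (t : ℝ) :
    (weight l t).IsHermitian := by
  induction l generalizing t with
  | nil => exact isHermitian_zero
  | cons p l ih =>
    refine IsHermitian.add ?_ (ih h.tail _)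
    exact ((posSemidef_of_isStarProjection (h.proj p List.mem_cons_self)).smul
      (Complex.zero_le_real.2 (clamp_nonneg _ _))).isHermitian

theorem weight_sub_posSemidef {l : List (Step n)} (h : ValidSteps l) {s t : ℝ} (hst : s ≤ t) :
    (weight l t - weight l s).PosSemidef := by
  induction l generalizing s t with
  | nil => simpa [weight] using PosSemidef.zero
  | cons p l ih =>
    have h1 : weight (p :: l) t - weight (p :: l) s =
        ((clamp p.len t - clamp p.len s : ℝ) : ℂ) • p.proj +
          (weight l (t - p.len) - weight l (s - p.len)) := by
      rw [weight, weight, Complex.ofReal_sub, sub_smul]; abel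
    rw [h1]
    exact ((posSemidef_of_isStarProjection (h.proj p List.mem_cons_self)).smul
      (Complex.zero_le_real.2 (sub_nonneg.2 (clamp_mono _ hst)))).add (ih h.tail (by linarith))

theorem norm_weight_sub_le {l : List (Step n)} (h : ValidSteps l) {s t : ℝ} (hst : s ≤ t) :
    ‖weight l t - weight l s‖ ≤ clamp (total l) t - clamp (total l) s := by
  induction l generalizing s t with
  | nil => simp [weight, total, clamp]
  | cons p l ih =>
    have h1 : weight (p :: l) t - weight (p :: l) s =
        ((clamp p.len t - clamp p.len s : ℝ) : ℂ) • p.proj +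
          (weight l (t - p.len) - weight l (s - p.len)) := by
      rw [weight, weight, Complex.ofReal_sub, sub_smul]; abel
    have hp := h.len_nonneg p List.mem_cons_self
    have hcl := sub_nonneg.2 (clamp_mono p.len hst)
    rw [h1, total_cons, clamp_add hp h.tail.total_nonneg, clamp_add hp h.tail.total_nonneg]
    refine (norm_add_le _ _).trans ?_
    have h2 : ‖((clamp p.len t - clamp p.len s : ℝ) : ℂ) • p.proj‖ ≤
        clamp p.len t - clamp p.len s := by
      rw [norm_smul, Complex.norm_real, Real.norm_of_nonneg hcl]
      exact mul_le_of_le_one_right hcl (norm_isStarProjection_le_one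
        (h.proj p List.mem_cons_self))
    linarith [ih h.tail (s := s - p.len) (t := t - p.len) (by linarith)]

theorem weight_zero {l : List (Step n)} (h : ValidSteps l) {t : ℝ} (ht : t ≤ 0) :
    weight l t = 0 := by
  induction l generalizing t with
  | nil => rfl
  | cons p l ih =>
    have hp := h.len_nonneg p List.mem_cons_self
    rw [weight, clamp_of_nonpos ht, ih h.tail (by linarith)]
    simp

/-- Induction on the steps: the product of the first-order errors of head and tail fits into the
cross term of `(m + e)²`. Contractivity keeps the constants independent of the number of steps, and
lengths at most 1 account for `exp C`. -/
theorem cocycle_estimates {c : ℝ → ℂ} {C : ℝ} (hC : 0 ≤ C) (hcC : ∀ φ, ‖c φ‖ ≤ C)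
    (hc : ∀ φ, (c φ).re ≤ 0) {l : List (Step n)} (h : ValidSteps l) {s t : ℝ} (hst : s ≤ t) :
    ‖cocycle c l s t - 1‖ ≤ C * Real.exp C * (clamp (total l) t - clamp (total l) s) ∧
    ‖cocycle c l s t - 1 - linearPart c l s t‖ ≤
      (C * Real.exp C) ^ 2 * (clamp (total l) t - clamp (total l) s) ^ 2 := by
  induction l generalizing s t with
  | nil => simp [cocycle, linearPart, total, clamp]
  | cons p l ih =>
    have hp := h.len_nonneg p List.mem_cons_self
    have hP := h.proj p List.mem_cons_self
    have hPn := norm_isStarProjection_le_one hP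
    obtain ⟨ih1, ih2⟩ := ih h.tail (s := s - p.len) (t := t - p.len) (by linarith)
    have hb1 := norm_cocycle_le_one hc h.tail (by linarith : s - p.len ≤ t - p.len)
    rw [total_cons, clamp_add hp h.tail.total_nonneg, clamp_add hp h.tail.total_nonneg]
    have hm := sub_nonneg.2 (clamp_mono p.len hst)
    have hm1 : clamp p.len t - clamp p.len s ≤ 1 := by
      linarith [clamp_nonneg p.len s, clamp_le hp (t := t), h.len_le p List.mem_cons_self]
    have he := sub_nonneg.2 (clamp_mono (total l) (by linarith : s - p.len ≤ t - p.len))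
    rw [cocycle, linearPart]
    set m := clamp p.len t - clamp p.len s
    set e := clamp (total l) (t - p.len) - clamp (total l) (s - p.len) with hedef
    set b := cocycle c l (s - p.len) (t - p.len)
    set q := linearPart c l (s - p.len) (t - p.len)
    set x : ℂ := c p.ang * ((m : ℝ) : ℂ) with hx
    have hxn : ‖x‖ ≤ C * m := by
      rw [hx, norm_mul, Complex.norm_real, Real.norm_of_nonneg hm]
      exact mul_le_mul_of_nonneg_right (hcC _) hm
    have hxC : ‖x‖ ≤ C := hxn.trans (mul_le_of_le_one_right hC hm1)
    have hexp : Real.exp ‖x‖ ≤ Real.exp C := Real.exp_le_exp.2 hxC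
    have hexp1 : 1 ≤ Real.exp C := Real.one_le_exp hC
    have ha1 : ‖expFactor x p.proj - 1‖ ≤ C * Real.exp C * m := by
      have : expFactor x p.proj - 1 = (Complex.exp x - 1) • p.proj := by
        rw [expFactor, sub_smul, one_smul]; abel
      rw [this, norm_smul]
      calc _ ≤ ‖x‖ * Real.exp ‖x‖ * 1 := mul_le_mul (norm_cexp_sub_one_le x) hPn (norm_nonneg _)
            (by positivity)
        _ ≤ C * m * Real.exp C * 1 := by gcongr
        _ = _ := by ring
    have ha2 : ‖expFactor x p.proj - 1 - x • p.proj‖ ≤ (C * Real.exp C) ^ 2 * m ^ 2 := by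
      have : expFactor x p.proj - 1 - x • p.proj = (Complex.exp x - 1 - x) • p.proj := by
        rw [expFactor, sub_smul, sub_smul, one_smul]; abel
      rw [this, norm_smul]
      calc _ ≤ ‖x‖ ^ 2 * Real.exp ‖x‖ * 1 := mul_le_mul (norm_cexp_sub_one_sub_le x) hPn
            (norm_nonneg _) (by positivity)
        _ ≤ (C * m) ^ 2 * (Real.exp C * Real.exp C) * 1 := by
          gcongr
          nlinarith
        _ = _ := by ring
    have ha0 : ‖expFactor x p.proj‖ ≤ 1 := norm_expFactor_le_one hP (by
      rw [hx, Complex.re_mul_ofReal]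
      exact mul_nonpos_of_nonpos_of_nonneg (hc _) hm)
    constructor
    · have : expFactor x p.proj * b - 1 = (expFactor x p.proj - 1) * b + (b - 1) := by
        rw [sub_mul, one_mul]; abel
      rw [this]
      calc _ ≤ ‖expFactor x p.proj - 1‖ * ‖b‖ + ‖b - 1‖ :=
            (norm_add_le _ _).trans (add_le_add (norm_mul_le _ _) le_rfl)
        _ ≤ C * Real.exp C * m * 1 + C * Real.exp C * e :=
            add_le_add (mul_le_mul ha1 hb1 (norm_nonneg _) (by positivity)) ih1
        _ = C * Real.exp C * (m + e) := by ring
        _ = _ := by rw [hedef]; ring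
    · have : expFactor x p.proj * b - 1 - (x • p.proj + q) =
          (expFactor x p.proj - 1) * (b - 1) + (expFactor x p.proj - 1 - x • p.proj) +
            (b - 1 - q) := by
        simp only [sub_mul, mul_sub, one_mul, mul_one]; abel
      rw [this]
      calc _ ≤ ‖expFactor x p.proj - 1‖ * ‖b - 1‖ + ‖expFactor x p.proj - 1 - x • p.proj‖ +
            ‖b - 1 - q‖ := (norm_add₃_le).trans
              (add_le_add (add_le_add (norm_mul_le _ _) le_rfl) le_rfl)
        _ ≤ (C * Real.exp C * m) * (C * Real.exp C * e) + (C * Real.exp C) ^ 2 * m ^ 2 +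
            (C * Real.exp C) ^ 2 * e ^ 2 := by
            gcongr
        _ ≤ (C * Real.exp C) ^ 2 * (m + e) ^ 2 := by
            have : 0 ≤ (C * Real.exp C) ^ 2 * (m * e) := by positivity
            nlinarith
        _ = _ := by rw [hedef]; ring

/-- Only steps meeting `[s, t]` in positive length contribute, and their angles are values of
`angleAt` on `[s, t)`. The restriction `0 ≤ u` is there because the recursion shifts `s` to negative
values. -/
theorem norm_linearPart_sub_le {c : ℝ → ℂ} {c₀ : ℂ} {D : ℝ} {l : List (Step n)}
    (h : ValidSteps l) {s t : ℝ} (hst : s ≤ t)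
    (hD : ∀ u, 0 ≤ u → s ≤ u → u < t → ‖c (angleAt l u) - c₀‖ ≤ D) :
    ‖linearPart c l s t - c₀ • (weight l t - weight l s)‖ ≤
      D * (clamp (total l) t - clamp (total l) s) := by
  induction l generalizing s t with
  | nil => simp [linearPart, weight, total, clamp]
  | cons p l ih =>
    have hp := h.len_nonneg p List.mem_cons_self
    have hP := h.proj p List.mem_cons_self
    have hPn := norm_isStarProjection_le_one hP
    have hih := ih h.tail (s := s - p.len) (t := t - p.len) (by linarith) fun u hu0 hu1 hu2 => by
      have := hD (u + p.len) (by linarith) (by linarith) (by linarith)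
      rwa [angleAt, if_neg (by linarith), add_sub_cancel_right] at this
    rw [total_cons, clamp_add hp h.tail.total_nonneg, clamp_add hp h.tail.total_nonneg]
    have hm := sub_nonneg.2 (clamp_mono p.len hst)
    have h1 : linearPart c (p :: l) s t - c₀ • (weight (p :: l) t - weight (p :: l) s) =
        ((c p.ang - c₀) * ((clamp p.len t - clamp p.len s : ℝ) : ℂ)) • p.proj +
        (linearPart c l (s - p.len) (t - p.len) -
          c₀ • (weight l (t - p.len) - weight l (s - p.len))) := by
      simp only [linearPart, weight]
      push_cast
      module
    have h2 : ‖((c p.ang - c₀) * ((clamp p.len t - clamp p.len s : ℝ) : ℂ)) • p.proj‖ ≤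
        D * (clamp p.len t - clamp p.len s) := by
      rcases hm.eq_or_lt with h0 | hpos
      · rw [← h0]; simp
      · have hu : ‖c p.ang - c₀‖ ≤ D := by
          have ht0 : 0 < t := by
            by_contra hle
            rw [clamp_of_nonpos (not_lt.1 hle), clamp_of_nonpos (hst.trans (not_lt.1 hle))] at hpos
            simp at hpos
          have hslt : s < t := by
            rcases hst.eq_or_lt with rfl | hlt
            · simp at hpos
            · exact hlt
          have hsl : max 0 s < p.len := by
            by_contra hle
            rw [not_lt] at hle
            rcases le_max_iff.1 hle with h3 | h3
            · have : p.len = 0 := le_antisymm h3 hp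
              rw [this] at hpos
              have e1 := clamp_le (le_refl (0 : ℝ)) (t := t)
              have e2 := clamp_nonneg 0 s
              linarith
            · rw [clamp_of_le hp h3, clamp_of_le hp (h3.trans hst)] at hpos
              simp at hpos
          have := hD (max 0 s) (le_max_left _ _) (le_max_right _ _) (max_lt ht0 hslt)
          rwa [angleAt, if_pos hsl] at this
        rw [norm_smul, norm_mul, Complex.norm_real, Real.norm_of_nonneg hm]
        have hD0 : 0 ≤ D := (norm_nonneg _).trans hu
        calc _ ≤ D * (clamp p.len t - clamp p.len s) * 1 :=
              mul_le_mul (mul_le_mul_of_nonneg_right hu hm) hPn (norm_nonneg _) (by positivity)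
          _ = _ := mul_one _
    rw [h1]
    refine (norm_add_le _ _).trans ((add_le_add h2 hih).trans_eq ?_)
    ring

theorem cocycle_eq_prod (c : ℝ → ℂ) {l : List (Step n)} (h : ValidSteps l) {s T : ℝ} (hs : s ≤ 0)
    (hT : total l ≤ T) :
    cocycle c l s T = (l.map fun p => expFactor (c p.ang * ((p.len : ℝ) : ℂ)) p.proj).prod := by
  induction l generalizing s T with
  | nil => rfl
  | cons p l ih =>
    have hp := h.len_nonneg p List.mem_cons_self
    have htl := h.tail.total_nonneg
    rw [total_cons] at hT
    rw [cocycle, List.map_cons, List.prod_cons, ih h.tail (by linarith) (by linarith),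
      clamp_of_nonpos hs, clamp_of_le hp (by linarith), sub_zero]

end StepData

/-! ### Bounds for the kernel `h_z`. -/

section Kernel

theorem one_sub_norm_le_norm_sub_exp (z : ℂ) (φ : ℝ) :
    1 - ‖z‖ ≤ ‖z - Complex.exp (φ * Complex.I)‖ := by
  have := norm_sub_norm_le (Complex.exp (φ * Complex.I)) z
  rwa [Complex.norm_exp_ofReal_mul_I, norm_sub_rev] at this

theorem norm_herglotz_le {z : ℂ} (hz : ‖z‖ < 1) (φ : ℝ) :
    ‖herglotz z φ‖ ≤ 2 / (1 - ‖z‖) := by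
  rw [herglotz, norm_div]
  refine div_le_div₀ (by norm_num) ?_ (by linarith) (one_sub_norm_le_norm_sub_exp z φ)
  refine (norm_add_le _ _).trans ?_
  rw [Complex.norm_exp_ofReal_mul_I]; linarith

/-- The real part is minus a Poisson kernel. This makes all the exponential factors contractions. -/
theorem re_herglotz_nonpos {z : ℂ} (hz : ‖z‖ < 1) (φ : ℝ) : (herglotz z φ).re ≤ 0 := by
  rw [herglotz, re_kernel, Complex.norm_exp_ofReal_mul_I]
  refine div_nonpos_of_nonpos_of_nonneg ?_ (sq_nonneg _)
  nlinarith [norm_nonneg z]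

theorem norm_exp_sub_exp_le (φ ψ : ℝ) :
    ‖Complex.exp (φ * Complex.I) - Complex.exp (ψ * Complex.I)‖ ≤ |φ - ψ| := by
  have h : Complex.exp (φ * Complex.I) - Complex.exp (ψ * Complex.I) =
      Complex.exp (ψ * Complex.I) * (Complex.exp (Complex.I * ((φ - ψ : ℝ) : ℂ)) - 1) := by
    rw [mul_sub, ← Complex.exp_add, mul_one]; congr 2; push_cast; ring
  rw [h, norm_mul, Complex.norm_exp_ofReal_mul_I, one_mul]
  exact Real.norm_exp_I_mul_ofReal_sub_one_le

theorem norm_herglotz_sub_le {z : ℂ} (hz : ‖z‖ < 1) (φ ψ : ℝ) :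
    ‖herglotz z φ - herglotz z ψ‖ ≤ 2 / (1 - ‖z‖) ^ 2 * |φ - ψ| := by
  have h1 := one_sub_norm_le_norm_sub_exp z φ
  have h2 := one_sub_norm_le_norm_sub_exp z ψ
  have hz' : 0 < 1 - ‖z‖ := by linarith
  have n1 : z - Complex.exp (φ * Complex.I) ≠ 0 := norm_pos_iff.1 (hz'.trans_le h1)
  have n2 : z - Complex.exp (ψ * Complex.I) ≠ 0 := norm_pos_iff.1 (hz'.trans_le h2)
  have h3 := norm_exp_sub_exp_le φ ψ
  unfold herglotz
  set e := Complex.exp (φ * Complex.I)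
  set f := Complex.exp (ψ * Complex.I)
  have : (z + e) / (z - e) - (z + f) / (z - f) = 2 * z * (e - f) / ((z - e) * (z - f)) := by
    rw [div_sub_div _ _ n1 n2]; congr 1; ring
  rw [this, norm_div, norm_mul, norm_mul, norm_mul, Complex.norm_two, div_mul_eq_mul_div]
  refine div_le_div₀ (by positivity) ?_ (by positivity) ?_
  · calc 2 * ‖z‖ * ‖e - f‖ ≤ 2 * 1 * |φ - ψ| := by gcongr
      _ = _ := by ring
  · rw [sq]; exact mul_le_mul h1 h2 hz'.le (norm_nonneg _)

end Kernel

/-! ### A criterion for multiplicative integrals. -/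

section MultIntegral
variable {n : ℕ}

/-- Telescoping: the factors are exchanged one at a time, with contractive values of `Φ` on the left
and a product of the `x i` on the right whose norm is at most the exponential of `C` times its
length. -/
theorem norm_ofFn_prod_sub_le {Φ : ℝ → ℝ → Mat n} {C : ℝ} (hC : 0 ≤ C)
    (hmul : ∀ s t u, s ≤ t → t ≤ u → Φ s t * Φ t u = Φ s u)
    (hone : ∀ s, Φ s s = 1) (hnorm : ∀ s t, s ≤ t → ‖Φ s t‖ ≤ 1) (m : ℕ) :
    ∀ (p : Fin (m + 1) → ℝ) (x : Fin m → Mat n), Monotone p →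
      (∀ i, ‖x i‖ ≤ Real.exp (C * (p i.succ - p i.castSucc))) →
      ‖(List.ofFn x).prod‖ ≤ Real.exp (C * (p (Fin.last m) - p 0)) ∧
      ‖(List.ofFn x).prod - Φ (p 0) (p (Fin.last m))‖ ≤
        (∑ i, ‖x i - Φ (p i.castSucc) (p i.succ)‖) * Real.exp (C * (p (Fin.last m) - p 0)) := by
  induction m with
  | zero =>
    intro p x _ _
    simp [hone, norm_one_le_one]
  | succ m ih =>
    intro p x hp hx
    obtain ⟨ih1, ih2⟩ := ih (fun i => p i.succ) (fun i => x i.succ)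
      (hp.comp (Fin.strictMono_succ).monotone) (fun i => hx i.succ)
    have h01 : p 0 ≤ p (Fin.succ 0) := hp (Fin.zero_le _)
    have h1l : p (Fin.succ 0) ≤ p (Fin.last (m + 1)) := hp (Fin.le_last _)
    have hx0 : ‖x 0‖ ≤ Real.exp (C * (p (Fin.succ 0) - p 0)) := hx 0
    rw [List.ofFn_succ, List.prod_cons, Fin.sum_univ_succ]
    rw [Fin.succ_last] at ih1 ih2
    set X := (List.ofFn fun i => x i.succ).prod
    have hsplit : Real.exp (C * (p (Fin.last (m + 1)) - p 0)) =
        Real.exp (C * (p (Fin.succ 0) - p 0)) *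
          Real.exp (C * (p (Fin.last (m + 1)) - p (Fin.succ 0))) := by
      rw [← Real.exp_add]; congr 1; ring
    have hge : Real.exp (C * (p (Fin.last (m + 1)) - p (Fin.succ 0))) ≤
        Real.exp (C * (p (Fin.last (m + 1)) - p 0)) :=
      Real.exp_le_exp.2 (mul_le_mul_of_nonneg_left (by linarith) hC)
    constructor
    · rw [hsplit]
      exact (norm_mul_le _ _).trans (mul_le_mul hx0 ih1 (norm_nonneg _) (Real.exp_pos _).le)
    · have h2 : x 0 * X - Φ (p 0) (p (Fin.last (m + 1))) =
          (x 0 - Φ (p 0) (p (Fin.succ 0))) * X +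
          Φ (p 0) (p (Fin.succ 0)) * (X - Φ (p (Fin.succ 0)) (p (Fin.last (m + 1)))) := by
        rw [← hmul _ _ _ h01 h1l, sub_mul, mul_sub]; abel
      rw [h2]
      refine (norm_add_le _ _).trans ?_
      rw [add_mul]
      refine add_le_add ?_ ?_
      · exact (norm_mul_le _ _).trans
          (mul_le_mul_of_nonneg_left (ih1.trans hge) (norm_nonneg _))
      · refine (norm_mul_le _ _).trans ((mul_le_of_le_one_left (norm_nonneg _)
          (hnorm _ _ h01)).trans (ih2.trans ?_))
        exact mul_le_mul_of_nonneg_left hge (Finset.sum_nonneg fun _ _ => norm_nonneg _)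

/-- The uniform partition into `m + 1` intervals, tagged at the left endpoints. -/
def uniformPartition {L : ℝ} (hL : 0 ≤ L) (m : ℕ) : TaggedPartition 0 L where
  size := m + 1
  point := fun i => L * ((i : ℕ) / (m + 1 : ℝ))
  monotone_point := fun i j hij => by
    have : ((i : ℕ) : ℝ) ≤ ((j : ℕ) : ℝ) := by exact_mod_cast hij
    dsimp only
    gcongr
  point_first := by simp
  point_last := by
    have : (m + 1 : ℝ) ≠ 0 := by positivity
    simp [Fin.val_last, this]
  tag := fun i => L * ((i : ℕ) / (m + 1 : ℝ))
  tag_mem := fun i => by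
    constructor
    · simp
    · simp only [Fin.val_succ]
      push_cast
      gcongr
      linarith

/-- An interval longer than the uniform mesh has a uniform point strictly inside, which the
refinement must contain as a partition point. -/
theorem mesh_le_of_refines {L : ℝ} (hL : 0 ≤ L) (m : ℕ) {τ : TaggedPartition 0 L}
    (h : τ.Refines (uniformPartition hL m)) (i : Fin τ.size) :
    τ.point i.succ - τ.point i.castSucc ≤ L / (m + 1) := by
  have hm : (0 : ℝ) < m + 1 := by positivity
  by_contra hlt
  rw [not_le] at hlt
  have hlast : τ.point i.succ ≤ L := (τ.monotone_point (Fin.le_last _)).trans_eq τ.point_last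
  have hfirst : 0 ≤ τ.point i.castSucc :=
    τ.point_first.symm.le.trans (τ.monotone_point (Fin.zero_le _))
  -- the least uniform point beyond the left endpoint
  have hex : ∃ j : ℕ, τ.point i.castSucc < L * (j / (m + 1 : ℝ)) := by
    refine ⟨m + 1, ?_⟩
    push_cast
    rw [div_self hm.ne', mul_one]
    have : 0 ≤ L / (m + 1) := by positivity
    linarith
  classical
  set j := Nat.find hex with hj
  have hj1 := Nat.find_spec hex
  have hj0 : j ≠ 0 := by
    intro h0
    rw [← hj, h0] at hj1
    simp at hj1
    linarith
  have hjm : j ≤ m + 1 := by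
    refine Nat.find_min' hex ?_
    push_cast
    rw [div_self hm.ne', mul_one]
    have : 0 ≤ L / (m + 1) := by positivity
    linarith
  have hpred : L * ((j - 1 : ℕ) / (m + 1 : ℝ)) ≤ τ.point i.castSucc :=
    not_lt.1 (Nat.find_min hex (Nat.sub_lt (Nat.pos_of_ne_zero hj0) one_pos))
  have hstep : L * (j / (m + 1 : ℝ)) = L * ((j - 1 : ℕ) / (m + 1 : ℝ)) + L / (m + 1) := by
    rw [Nat.cast_sub (Nat.one_le_iff_ne_zero.2 hj0)]
    push_cast
    field_simp
    ring
  have hmem : L * (j / (m + 1 : ℝ)) ∈ Set.range τ.point :=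
    h ⟨⟨j, Nat.lt_succ_of_le hjm⟩, rfl⟩
  obtain ⟨k, hk⟩ := hmem
  have hki : i.castSucc < k := by
    by_contra hle
    have := τ.monotone_point (not_lt.1 hle)
    linarith
  have : τ.point i.succ ≤ τ.point k := τ.monotone_point (Fin.castSucc_lt_iff_succ_le.1 hki)
  linarith

/-- A contractive cocycle that is well approximated by exponentials is the multiplicative
integral. -/
theorem isMultIntegral_of_cocycle {L : ℝ} (hL : 0 ≤ L) {f : ℝ → ℂ} {E : ℝ → Mat n}
    {Φ : ℝ → ℝ → Mat n} {G : ℝ → ℝ} {C K : ℝ} (hC : 0 ≤ C) (hK : 0 ≤ K)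
    (hmul : ∀ s t u, s ≤ t → t ≤ u → Φ s t * Φ t u = Φ s u)
    (hone : ∀ s, Φ s s = 1) (hnorm : ∀ s t, s ≤ t → ‖Φ s t‖ ≤ 1) (hG : Monotone G)
    (hf : ∀ t, ‖f t‖ ≤ C) (hE : ∀ s t, s ≤ t → ‖E t - E s‖ ≤ t - s)
    (hloc : ∀ s t ξ, 0 ≤ s → t ≤ L → s ≤ ξ → ξ ≤ t →
      ‖Φ s t - NormedSpace.exp (f ξ • (E t - E s))‖ ≤ K * (t - s) * (G t - G s)) :
    IsMultIntegral 0 L f E (Φ 0 L) := by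
  intro ε hε
  have hGL : 0 ≤ G L - G 0 := sub_nonneg.2 (hG hL)
  -- With mesh at most `L / (m + 1)` the local errors sum to `K (L / (m + 1)) (G L - G 0)`; the
  -- telescoping factor `exp(C L)` makes the total `Q / (m + 1)`.
  set Q := K * L * (G L - G 0) * Real.exp (C * L)
  have hQ : 0 ≤ Q := by positivity
  obtain ⟨m, hm⟩ := exists_nat_gt (Q / ε)
  have hm1 : (0 : ℝ) < m + 1 := by positivity
  refine ⟨uniformPartition hL m, fun τ hτ => ?_⟩
  have hmesh := mesh_le_of_refines hL m hτ
  have hstep : ∀ i : Fin τ.size, τ.point i.castSucc ≤ τ.point i.succ :=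
    fun i => τ.monotone_point (Fin.castSucc_lt_succ).le
  have hlast : ∀ k, τ.point k ≤ L := fun k =>
    (τ.monotone_point (Fin.le_last _)).trans_eq τ.point_last
  have hfirst : ∀ k, 0 ≤ τ.point k := fun k =>
    τ.point_first.symm.le.trans (τ.monotone_point (Fin.zero_le _))
  have key := (norm_ofFn_prod_sub_le hC hmul hone hnorm τ.size τ.point
    (fun i => NormedSpace.exp (f (τ.tag i) • (E (τ.point i.succ) - E (τ.point i.castSucc))))
    τ.monotone_point fun i => ?_).2
  · rw [τ.point_first, τ.point_last, sub_zero] at key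
    refine lt_of_le_of_lt key ?_
    have hsum : ∑ i : Fin τ.size, ‖NormedSpace.exp (f (τ.tag i) •
        (E (τ.point i.succ) - E (τ.point i.castSucc))) -
          Φ (τ.point i.castSucc) (τ.point i.succ)‖ ≤
        K * (L / (m + 1)) * (G L - G 0) := by
      calc _ ≤ ∑ i : Fin τ.size, K * (L / (m + 1)) *
            (G (τ.point i.succ) - G (τ.point i.castSucc)) := by
            refine Finset.sum_le_sum fun i _ => ?_
            rw [norm_sub_rev]
            refine (hloc _ _ _ (hfirst _) (hlast _) (τ.tag_mem i).1 (τ.tag_mem i).2).trans ?_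
            have hg := sub_nonneg.2 (hG (hstep i))
            have := hmesh i
            gcongr
        _ = K * (L / (m + 1)) * (G L - G 0) := by
            rw [← Finset.mul_sum]
            congr 1
            have hF : ∑ i : Fin τ.size, (G (τ.point i.succ) - G (τ.point i.castSucc)) =
                G (τ.point (Fin.last τ.size)) - G (τ.point 0) := by
              rw [Finset.sum_sub_distrib, sub_eq_sub_iff_add_eq_add]
              have e1 := Fin.sum_univ_succ fun i => G (τ.point i)
              have e2 := Fin.sum_univ_castSucc fun i => G (τ.point i)
              linarith
            rw [hF, τ.point_first, τ.point_last]
    calc _ ≤ K * (L / (m + 1)) * (G L - G 0) * Real.exp (C * L) :=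
          mul_le_mul_of_nonneg_right hsum (Real.exp_pos _).le
      _ = Q / (m + 1) := by simp only [Q]; field_simp
      _ < ε := by
        rw [div_lt_iff₀ hm1]
        rw [div_lt_iff₀ hε] at hm
        nlinarith
  · refine (norm_matrix_exp_le _).trans (Real.exp_le_exp.2 ?_)
    rw [norm_smul]
    exact mul_le_mul (hf _) (hE _ _ (hstep i)) (norm_nonneg _) hC

end MultIntegral

/-! ### Comparison of a short product with a single exponential. -/

section LocalEstimate
variable {n : ℕ}

/-- Both sides equal 1 plus a linear part up to `O((t - s)²)`, and the linear parts differ by at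
most the oscillation `D` of the kernel times `t - s`. -/
theorem norm_cocycle_sub_exp_le {c : ℝ → ℂ} {C Λ D : ℝ} (hC : 0 ≤ C)
    (hcC : ∀ φ, ‖c φ‖ ≤ C) (hc : ∀ φ, (c φ).re ≤ 0) {l : List (Step n)} (h : ValidSteps l)
    {s t : ℝ} (hs : 0 ≤ s) (hst : s ≤ t) (ht : t ≤ Λ) (φ : ℝ) (hD0 : 0 ≤ D)
    (hD : ∀ u, s ≤ u → u < t → ‖c (angleAt l u) - c φ‖ ≤ D) :
    ‖cocycle c l s t - NormedSpace.exp (c φ • (weight l t - weight l s))‖ ≤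
      ((C * Real.exp C) ^ 2 + C ^ 2 * Real.exp (C * Λ)) * (t - s) ^ 2 + D * (t - s) := by
  have h1 := (cocycle_estimates hC hcC hc h hst).2
  have h2 := norm_linearPart_sub_le (c := c) (c₀ := c φ) (D := D) h hst
    fun u _ hu1 hu2 => hD u hu1 hu2
  have h3 := norm_matrix_exp_sub_one_sub_le (c φ • (weight l t - weight l s))
  have he := clamp_sub_le (total l) hst
  have he0 := sub_nonneg.2 (clamp_mono (total l) hst)
  have hw := norm_weight_sub_le h hst
  set X := c φ • (weight l t - weight l s)
  have hX : ‖X‖ ≤ C * (t - s) := by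
    rw [norm_smul]
    exact mul_le_mul (hcC φ) (hw.trans he) (norm_nonneg _) hC
  have hXΛ : ‖X‖ ≤ C * Λ := hX.trans (mul_le_mul_of_nonneg_left (by linarith) hC)
  have hsplit : cocycle c l s t - NormedSpace.exp X =
      (cocycle c l s t - 1 - linearPart c l s t) + (linearPart c l s t - X) -
        (NormedSpace.exp X - 1 - X) := by abel
  rw [hsplit]
  calc _ ≤ ‖cocycle c l s t - 1 - linearPart c l s t‖ + ‖linearPart c l s t - X‖ +
        ‖NormedSpace.exp X - 1 - X‖ :=
        (norm_sub_le _ _).trans (add_le_add (norm_add_le _ _) le_rfl)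
    _ ≤ (C * Real.exp C) ^ 2 * (t - s) ^ 2 + D * (t - s) +
        (C * (t - s)) ^ 2 * Real.exp (C * Λ) := by
        refine add_le_add (add_le_add (h1.trans ?_) (h2.trans ?_)) (h3.trans ?_)
        · gcongr
        · gcongr
        · gcongr
    _ = _ := by ring

end LocalEstimate

/-! ### Passage to the limit along an ultrafilter. -/

section Limits
variable {n : ℕ} {ι : Type*}

theorem exists_tendsto_of_bounded {X : Type*} [NormedAddCommGroup X] [ProperSpace X]
    (𝒰 : Ultrafilter ι) {f : ι → X} {R : ℝ} (hf : ∀ᶠ i in (𝒰 : Filter ι), ‖f i‖ ≤ R) :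
    ∃ x, Tendsto f 𝒰 (𝓝 x) := by
  have hmem : Metric.closedBall (0 : X) R ∈ 𝒰.map f :=
    Ultrafilter.mem_map.2 (hf.mono fun i hi => mem_closedBall_zero_iff.2 hi)
  obtain ⟨x, -, hx⟩ := (isCompact_closedBall (0 : X) R).ultrafilter_le_nhds' _ hmem
  exact ⟨x, hx⟩

instance : ProperSpace (Mat n) := FiniteDimensional.proper ℂ (Mat n)

open scoped MatrixOrder in
theorem posSemidef_of_tendsto {l : Filter ι} [l.NeBot] {f : ι → Mat n} {X : Mat n}
    (hf : Tendsto f l (𝓝 X)) (h : ∀ᶠ i in l, (f i).PosSemidef) : X.PosSemidef := by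
  have : (0 : Mat n) ≤ X := ge_of_tendsto hf (h.mono fun i hi => hi.nonneg)
  exact Matrix.nonneg_iff_posSemidef.1 this

theorem norm_weight_le {l : List (Step n)} (h : ValidSteps l) (t : ℝ) : ‖weight l t‖ ≤ |t| := by
  rcases le_total t 0 with ht | ht
  · rw [weight_zero h ht, norm_zero]; exact abs_nonneg t
  · have h1 := norm_weight_sub_le h ht
    have h2 := clamp_sub_le (total l) ht
    rw [weight_zero h le_rfl, sub_zero] at h1
    rw [abs_of_nonneg ht]
    linarith

theorem continuous_clamp (t : ℝ) : Continuous fun d => clamp d t := by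
  unfold clamp; fun_prop

theorem continuous_matrix_exp : Continuous (NormedSpace.exp : Mat n → Mat n) :=
  letI : NormedAlgebra ℚ (Mat n) := NormedAlgebra.restrictScalars ℚ ℂ (Mat n)
  NormedSpace.exp_continuous

/-- Limits along an ultrafilter of products of exponentials over lists of steps are multiplicative
integrals. -/
theorem exists_multIntegral_of_tendsto (𝒰 : Ultrafilter ι) {l : ι → List (Step n)}
    {U : ι → Mat n} {Λ : ℝ}
    (hl : ∀ᶠ i in (𝒰 : Filter ι), ValidSteps (l i) ∧ total (l i) ≤ Λ)
    (hU : ∀ᶠ i in (𝒰 : Filter ι), U i ∈ unitaryGroup (Fin n) ℂ) {A : ℂ → Mat n}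
    (hA : ∀ z ∈ disk, Tendsto (fun i => U i * cocycle (herglotz z) (l i) 0 Λ) 𝒰 (𝓝 (A z))) :
    ∃ V ∈ unitaryGroup (Fin n) ℂ, ∃ (L : ℝ) (E : ℝ → Mat n) (θ : ℝ → ℝ),
      0 ≤ L ∧ IncreasingOn E 0 L ∧ (∀ t ∈ Icc 0 L, (E t).trace = (t : ℂ)) ∧
      (∀ t ∈ Icc 0 L, θ t ∈ Icc 0 (2 * Real.pi)) ∧ MonotoneOn θ (Icc 0 L) ∧
      (∀ t ∈ Icc 0 L, ContinuousWithinAt θ (Icc t L) t) ∧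
      ∀ z ∈ disk, ∃ M : Mat n,
        IsMultIntegral 0 L (fun t => herglotz z (θ t)) E M ∧ A z = V * M := by
  have hv : ∀ᶠ i in (𝒰 : Filter ι), ValidSteps (l i) := hl.mono fun i hi => hi.1
  obtain ⟨V, hV⟩ := exists_tendsto_of_bounded 𝒰 (f := U)
    (hU.mono fun i hi => norm_le_one_of_mem_unitaryGroup hi)
  have hVu : V ∈ unitaryGroup (Fin n) ℂ := by
    rw [mem_unitaryGroup_iff]
    have h1 : Tendsto (fun i => U i * star (U i)) 𝒰 (𝓝 (V * star V)) :=
      hV.mul ((continuous_star.tendsto V).comp hV)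
    refine tendsto_nhds_unique h1 (tendsto_const_nhds.congr' ?_)
    filter_upwards [hU] with i hi using (mem_unitaryGroup_iff.1 hi).symm
  obtain ⟨L, hL⟩ := exists_tendsto_of_bounded 𝒰 (f := fun i => total (l i)) (R := Λ) (by
    filter_upwards [hl] with i hi
    rw [Real.norm_of_nonneg hi.1.total_nonneg]; exact hi.2)
  have hL0 : 0 ≤ L := ge_of_tendsto hL (hv.mono fun i hi => hi.total_nonneg)
  have hLΛ : L ≤ Λ := le_of_tendsto hL (hl.mono fun i hi => hi.2)
  have hEex : ∀ t, ∃ X, Tendsto (fun i => weight (l i) t) 𝒰 (𝓝 X) := fun t =>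
    exists_tendsto_of_bounded 𝒰 (hv.mono fun i hi => norm_weight_le hi t)
  choose E hE using hEex
  have hθex : ∀ t, ∃ x, Tendsto (fun i => angleAt (l i) t) 𝒰 (𝓝 x) := fun t =>
    exists_tendsto_of_bounded 𝒰 (R := 2 * Real.pi) (hv.mono fun i hi => by
      rw [Real.norm_of_nonneg (hi.angleAt_mem t).1]; exact (hi.angleAt_mem t).2)
  choose θ₀ hθ₀ using hθex
  have hθ₀mono : Monotone θ₀ := fun s t hst =>
    le_of_tendsto_of_tendsto (hθ₀ s) (hθ₀ t) (hv.mono fun i hi => hi.angleAt_mono hst)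
  have hθ₀mem : ∀ t, θ₀ t ∈ Icc 0 (2 * Real.pi) := fun t =>
    isClosed_Icc.mem_of_tendsto (hθ₀ t) (hv.mono fun i hi => hi.angleAt_mem t)
  -- The pointwise limit `θ₀` need not be right-continuous, so its right limit is taken. The two are
  -- interlaced: `θ s ≤ θ₀ t ≤ θ t` for `s < t`.
  set θ : ℝ → ℝ := fun t => hθ₀mono.stieltjesFunction t with hθ
  have hθmono : Monotone θ := hθ₀mono.stieltjesFunction.mono
  have hle : ∀ t, θ₀ t ≤ θ t := fun t => hθ₀mono.le_rightLim le_rfl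
  have hlt : ∀ s t, s < t → θ s ≤ θ₀ t := fun s t hst => hθ₀mono.rightLim_le hst
  have hclamp : ∀ t, Tendsto (fun i => clamp (total (l i)) t) 𝒰 (𝓝 (clamp L t)) := fun t =>
    ((continuous_clamp t).tendsto L).comp hL
  have hEsub : ∀ s t, s ≤ t → ‖E t - E s‖ ≤ t - s := fun s t hst =>
    le_of_tendsto ((hE t).sub (hE s)).norm (hv.mono fun i hi =>
      (norm_weight_sub_le hi hst).trans (clamp_sub_le _ hst))
  refine ⟨V, hVu, L, E, θ, hL0, ⟨fun t _ => ?_, fun s _ t _ hst => ?_⟩, fun t ht => ?_,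
    fun t _ => ⟨(hθ₀mem t).1.trans (hle t), (hlt t (t + 1) (by linarith)).trans (hθ₀mem _).2⟩,
    hθmono.monotoneOn _, fun t _ => ?_, fun z hz => ?_⟩
  · refine tendsto_nhds_unique (((continuous_star.tendsto _).comp (hE t))) ((hE t).congr' ?_)
    filter_upwards [hv] with i hi using (weight_isHermitian hi t).symm
  · exact posSemidef_of_tendsto ((hE t).sub (hE s))
      (hv.mono fun i hi => weight_sub_posSemidef hi hst)
  · have h1 : Tendsto (fun i => (weight (l i) t).trace) 𝒰 (𝓝 (E t).trace) :=
      ((continuous_id.matrix_trace).tendsto (E t)).comp (hE t)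
    have h2 : Tendsto (fun i => ((clamp (total (l i)) t : ℝ) : ℂ)) 𝒰 (𝓝 ((clamp L t : ℝ) : ℂ)) :=
      (Complex.continuous_ofReal.tendsto _).comp (hclamp t)
    rw [clamp_of_mem ht.1 ht.2] at h2
    refine tendsto_nhds_unique h1 (h2.congr' ?_)
    filter_upwards [hv] with i hi using (weight_trace hi t).symm
  · exact (hθ₀mono.stieltjesFunction.right_continuous t).mono Icc_subset_Ici_self
  · have hz1 : ‖z‖ < 1 := mem_ball_zero_iff.1 hz
    set C := 2 / (1 - ‖z‖)
    have hC : 0 ≤ C := div_nonneg (by norm_num) (by linarith)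
    set Lip := 2 / (1 - ‖z‖) ^ 2
    have hLip : 0 ≤ Lip := by positivity
    have hcC : ∀ φ, ‖herglotz z φ‖ ≤ C := norm_herglotz_le hz1
    have hre : ∀ φ, (herglotz z φ).re ≤ 0 := re_herglotz_nonpos hz1
    have hΦex : ∀ s t, ∃ X, s ≤ t →
        Tendsto (fun i => cocycle (herglotz z) (l i) s t) 𝒰 (𝓝 X) := fun s t => by
      by_cases hst : s ≤ t
      · obtain ⟨X, hX⟩ := exists_tendsto_of_bounded 𝒰
          (hv.mono fun i hi => norm_cocycle_le_one hre hi hst)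
        exact ⟨X, fun _ => hX⟩
      · exact ⟨0, fun h => absurd h hst⟩
    choose Φ hΦ using hΦex
    have hmul : ∀ s t u, s ≤ t → t ≤ u → Φ s t * Φ t u = Φ s u := fun s t u hst htu => by
      refine tendsto_nhds_unique ((hΦ s t hst).mul (hΦ t u htu))
        ((hΦ s u (hst.trans htu)).congr' ?_)
      filter_upwards [hv] with i hi using (cocycle_mul _ hi hst htu).symm
    have hdist : ∀ s t, s ≤ t → ‖Φ s t - 1‖ ≤ C * Real.exp C * (clamp L t - clamp L s) :=
      fun s t hst => le_of_tendsto_of_tendsto ((hΦ s t hst).sub_const 1).norm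
        (((hclamp t).sub (hclamp s)).const_mul _)
        (hv.mono fun i hi => (cocycle_estimates hC hcC hre hi hst).1)
    have hone : ∀ s, Φ s s = 1 := fun s => by
      have := hdist s s le_rfl
      rw [sub_self, mul_zero, norm_le_zero_iff, sub_eq_zero] at this
      exact this
    have hnorm : ∀ s t, s ≤ t → ‖Φ s t‖ ≤ 1 := fun s t hst =>
      le_of_tendsto (hΦ s t hst).norm (hv.mono fun i hi => norm_cocycle_le_one hre hi hst)
    set K₁ := (C * Real.exp C) ^ 2 + C ^ 2 * Real.exp (C * Λ)
    have hK₁ : 0 ≤ K₁ := by positivity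
    -- The difference of max and min bounds the distance from `φ` to every angle on `[s, t)`,
    -- wherever `φ` lies, and it involves only endpoint values, so it passes to the limit.
    have hest : ∀ s t φ, 0 ≤ s → s ≤ t → t ≤ L →
        ‖Φ s t - NormedSpace.exp (herglotz z φ • (E t - E s))‖ ≤
          K₁ * (t - s) ^ 2 + Lip * (max (θ₀ t) φ - min (θ₀ s) φ) * (t - s) := by
      intro s t φ hs hst ht
      have hexp : Tendsto (fun i => NormedSpace.exp
          (herglotz z φ • (weight (l i) t - weight (l i) s))) 𝒰
          (𝓝 (NormedSpace.exp (herglotz z φ • (E t - E s)))) :=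
        (continuous_matrix_exp.tendsto _).comp (((hE t).sub (hE s)).const_smul _)
      have hrhs : Tendsto (fun i => K₁ * (t - s) ^ 2 +
          Lip * (max (angleAt (l i) t) φ - min (angleAt (l i) s) φ) * (t - s)) 𝒰
          (𝓝 (K₁ * (t - s) ^ 2 + Lip * (max (θ₀ t) φ - min (θ₀ s) φ) * (t - s))) :=
        ((((hθ₀ t).max tendsto_const_nhds).sub
          ((hθ₀ s).min tendsto_const_nhds)).const_mul Lip |>.mul_const _).const_add _
      refine le_of_tendsto_of_tendsto ((hΦ s t hst).sub hexp).norm hrhs ?_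
      filter_upwards [hv] with i hi
      have hmm : 0 ≤ max (angleAt (l i) t) φ - min (angleAt (l i) s) φ :=
        sub_nonneg.2 ((min_le_right _ _).trans (le_max_right _ _))
      refine norm_cocycle_sub_exp_le hC hcC hre hi hs hst (ht.trans hLΛ) φ (by positivity)
        fun u hu1 hu2 => ?_
      refine (norm_herglotz_sub_le hz1 _ _).trans (mul_le_mul_of_nonneg_left ?_ hLip)
      have h1 := hi.angleAt_mono hu1
      have h2 := hi.angleAt_mono hu2.le
      rw [abs_le]
      constructor
      · linarith [min_le_left (angleAt (l i) s) φ, le_max_right (angleAt (l i) t) φ]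
      · linarith [min_le_right (angleAt (l i) s) φ, le_max_left (angleAt (l i) t) φ]
    -- The oscillation is at most `θ t - θ₀ s`. Since `θ s ≤ θ₀ t` for `s < t`, the increment of `θ₀
    -- + θ` dominates it; the summand `t` absorbs the quadratic term.
    refine ⟨Φ 0 L, isMultIntegral_of_cocycle hL0 (G := fun t => t + (θ₀ t + θ t))
      (K := K₁ + Lip) hC (by positivity) hmul hone hnorm
      (monotone_id.add (hθ₀mono.add hθmono)) (fun t => hcC _) hEsub ?_, ?_⟩
    · intro s t ξ hs ht hsξ hξt
      have hst := hsξ.trans hξt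
      refine (hest s t (θ ξ) hs hst ht).trans ?_
      rcases hst.eq_or_lt with rfl | hst'
      · simp
      have h1 : max (θ₀ t) (θ ξ) ≤ θ t := max_le (hle t) (hθmono hξt)
      have h2 : θ₀ s ≤ min (θ₀ s) (θ ξ) := le_min le_rfl ((hle s).trans (hθmono hsξ))
      have h3 := hlt s t hst'
      have h4 : 0 ≤ t - s := by linarith
      have h5 : max (θ₀ t) (θ ξ) - min (θ₀ s) (θ ξ) ≤ (t + (θ₀ t + θ t)) - (s + (θ₀ s + θ s)) := by
        linarith
      have h6 : t - s ≤ (t + (θ₀ t + θ t)) - (s + (θ₀ s + θ s)) := by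
        linarith [hθ₀mono hst, hθmono hst]
      set g := (t + (θ₀ t + θ t)) - (s + (θ₀ s + θ s))
      calc K₁ * (t - s) ^ 2 + Lip * (max (θ₀ t) (θ ξ) - min (θ₀ s) (θ ξ)) * (t - s)
          ≤ K₁ * ((t - s) * g) + Lip * g * (t - s) := by
            rw [sq]; gcongr
        _ = (K₁ + Lip) * (t - s) * g := by ring
    · have h1 : A z = V * Φ 0 Λ :=
        tendsto_nhds_unique (hA z hz) (hV.mul (hΦ 0 Λ (hL0.trans hLΛ)))
      -- The total lengths tend to `L`, so the limit cocycle is trivial between `L` and the common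
      -- bound `Λ`.
      have h2 : Φ L Λ = 1 := by
        have := hdist L Λ hLΛ
        rw [clamp_of_le hL0 hLΛ, clamp_of_le hL0 le_rfl, sub_self, mul_zero, norm_le_zero_iff,
          sub_eq_zero] at this
        exact this
      rw [h1, ← hmul 0 L Λ hL0 hLΛ, h2, mul_one]

end Limits

/-! ### Zero-free contractive functions as multiplicative integrals. -/

section Representation
variable {n : ℕ} {ι : Type*}

/-- A pointwise limit without zeros of bounded holomorphic functions keeps the zeros of the
approximants away from every smaller disk. -/
theorem eventually_ne_zero_of_tendsto {F : Filter ι} {g : ι → ℂ → ℂ} {g₀ : ℂ → ℂ}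
    (hg : ∀ i, DifferentiableOn ℂ (g i) disk) (hb : ∀ i, ∀ z ∈ disk, ‖g i z‖ ≤ 1)
    (hlim : ∀ z ∈ disk, Tendsto (fun i => g i z) F (𝓝 (g₀ z))) (h0 : ∀ z ∈ disk, g₀ z ≠ 0)
    {ρ : ℝ} (hρ : ρ < 1) :
    ∀ᶠ i in F, ∀ z ∈ Metric.closedBall (0 : ℂ) ρ, g i z ≠ 0 := by
  refine (isCompact_closedBall (0 : ℂ) ρ).induction_on
    (p := fun s => ∀ᶠ i in F, ∀ z ∈ s, g i z ≠ 0) (by simp)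
    (fun s t hst ht => ht.mono fun i hi z hz => hi z (hst hz))
    (fun s t hs ht => by
      filter_upwards [hs, ht] with i h1 h2 z hz
      exact hz.elim (h1 z) (h2 z)) fun w hw => ?_
  have hw1 : ‖w‖ < 1 := (mem_closedBall_zero_iff.1 hw).trans_lt hρ
  have hwd : w ∈ disk := mem_ball_zero_iff.2 hw1
  set r := 1 - ‖w‖ with hr
  have hr0 : 0 < r := sub_pos.2 hw1
  set c := ‖g₀ w‖ with hc
  have hc0 : 0 < c := norm_pos_iff.2 (h0 w hwd)
  have hsub : Metric.ball w r ⊆ disk := fun z hz => by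
    have h1 : ‖z - w‖ < r := mem_ball_iff_norm.1 hz
    have h2 : ‖z‖ ≤ ‖z - w‖ + ‖w‖ := by simpa using norm_add_le (z - w) w
    exact mem_ball_zero_iff.2 (by linarith)
  -- By the Schwarz lemma `g i` moves by at most `(2 / r) dist z w`, which is less than `c / 2`
  -- within `c r / 4` of `w`. This equicontinuity replaces locally uniform convergence.
  set δ := min r (c * r / 4) with hδ
  have hδ0 : 0 < δ := lt_min hr0 (by positivity)
  refine ⟨Metric.ball w δ, mem_nhdsWithin_of_mem_nhds (Metric.ball_mem_nhds w hδ0), ?_⟩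
  have hev : ∀ᶠ i in F, c / 2 < ‖g i w‖ :=
    (hlim w hwd).norm.eventually (lt_mem_nhds (half_lt_self hc0))
  filter_upwards [hev] with i hi z hz hz0
  have hz1 : dist z w < δ := hz
  have hzr : z ∈ Metric.ball w r := hz1.trans_le (min_le_left _ _)
  have hmaps : MapsTo (g i) (Metric.ball w r) (Metric.closedBall (g i w) 2) := fun y hy => by
    rw [mem_closedBall_iff_norm]
    linarith [norm_sub_le (g i y) (g i w), hb i y (hsub hy), hb i w hwd]
  have h1 := Complex.dist_le_div_mul_dist_of_mapsTo_ball ((hg i).mono hsub) hmaps hzr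
  rw [hz0, dist_zero_left] at h1
  have h2 : 2 / r * dist z w < 2 / r * (c * r / 4) :=
    mul_lt_mul_of_pos_left (hz1.trans_le (min_le_right _ _)) (by positivity)
  have h3 : 2 / r * (c * r / 4) = c / 2 := by field_simp; norm_num
  linarith

/-- The step with the length and the angle that belong to the zero of a Blaschke–Potapov factor. -/
def toStep (p : ℂ × Mat n) : Step n := ⟨1 - ‖p.1‖, angle p.1, p.2⟩

theorem IsFactorList.validSteps {g : ℂ → ℂ} {l : List (ℂ × Mat n)} (h : IsFactorList g l) :
    ValidSteps (l.map toStep) where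
  len_nonneg := by
    simp only [List.forall_mem_map]
    exact fun p hp => sub_nonneg.2 (mem_ball_zero_iff.1 (h.zero_mem p hp)).le
  len_le := by
    simp only [List.forall_mem_map]
    exact fun p _ => sub_le_self _ (norm_nonneg _)
  ang_mem := by
    simp only [List.forall_mem_map]
    exact fun p _ => angle_mem _
  proj := by
    simp only [List.forall_mem_map]
    exact h.proj
  trace := by
    simp only [List.forall_mem_map]
    exact h.trace
  sorted := List.pairwise_map.2 h.sorted

/-- Summation of `1 - x ≤ -log x`. It bounds the total length by `-log |det|` at 0, uniformly over
the approximants. -/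
theorem total_map_toStep_le (l : List (ℂ × Mat n)) (h : ∀ p ∈ l, p.1 ≠ 0) :
    total (l.map toStep) ≤ -Real.log (l.map fun p => ‖p.1‖).prod := by
  induction l with
  | nil => simp [total]
  | cons p l ih =>
    have hp : 0 < ‖p.1‖ := norm_pos_iff.2 (h p List.mem_cons_self)
    have hl : (l.map fun p => ‖p.1‖).prod ≠ 0 := by
      rw [Ne, List.prod_eq_zero_iff, List.mem_map]
      rintro ⟨q, hq, hq0⟩
      exact h q (List.mem_cons_of_mem _ hq) (norm_eq_zero.1 hq0)
    have h1 := ih fun q hq => h q (List.mem_cons_of_mem _ hq)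
    have h2 := Real.log_le_sub_one_of_pos hp
    rw [List.map_cons, total_cons, List.map_cons, List.prod_cons, Real.log_mul hp.ne' hl]
    have h3 : (toStep p).len = 1 - ‖p.1‖ := rfl
    linarith

/-- The constant in the comparison of Blaschke–Potapov factors with exponentials. -/
def factorBound (z : ℂ) : ℝ :=
  2 / (1 - ‖z‖) ^ 2 + (2 / (1 - ‖z‖)) ^ 2 * Real.exp (2 / (1 - ‖z‖))

theorem factorBound_nonneg (z : ℂ) : 0 ≤ factorBound z := by
  unfold factorBound; positivity

/-- The Blaschke factor and the exponential share the first-order expansion `1 + h_z (1 - |w|)`. -/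
theorem norm_bpFactor_sub_expFactor_le {z : ℂ} (hz : ‖z‖ < 1) {w : ℂ} (hw0 : w ≠ 0)
    (hw : ‖w‖ ≤ 1) {P : Mat n} (hP : IsStarProjection P) :
    ‖bpFactor w P z - expFactor (herglotz z (angle w) * ((1 - ‖w‖ : ℝ) : ℂ)) P‖ ≤
      factorBound z * (1 - ‖w‖) ^ 2 := by
  set δ := 1 - ‖w‖ with hδ
  have hδ0 : 0 ≤ δ := sub_nonneg.2 hw
  have hδ1 : δ ≤ 1 := sub_le_self _ (norm_nonneg _)
  set x := herglotz z (angle w) * ((δ : ℝ) : ℂ) with hx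
  set C := 2 / (1 - ‖z‖) with hC
  have hC0 : 0 ≤ C := div_nonneg zero_le_two (by linarith)
  have h1 : ‖blaschke w z - 1 - x‖ ≤ 2 / (1 - ‖z‖) ^ 2 * δ ^ 2 := by
    have := norm_blaschke_sub_one_sub_le (θ := angle w) (norm_pos_iff.2 hw0) hw hz
    rwa [norm_mul_exp_angle] at this
  have hxn : ‖x‖ ≤ C * δ := by
    rw [hx, norm_mul, Complex.norm_real, Real.norm_of_nonneg hδ0]
    exact mul_le_mul_of_nonneg_right (norm_herglotz_le hz _) hδ0
  have h2 : ‖Complex.exp x - 1 - x‖ ≤ C ^ 2 * Real.exp C * δ ^ 2 := by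
    have h3 : Real.exp ‖x‖ ≤ Real.exp C :=
      Real.exp_le_exp.2 (hxn.trans (mul_le_of_le_one_right hC0 hδ1))
    calc ‖Complex.exp x - 1 - x‖ ≤ ‖x‖ ^ 2 * Real.exp ‖x‖ := norm_cexp_sub_one_sub_le x
      _ ≤ (C * δ) ^ 2 * Real.exp C := by gcongr
      _ = _ := by ring
  have h4 : bpFactor w P z - expFactor x P = (blaschke w z - Complex.exp x) • P := by
    rw [bpFactor, expFactor, sub_smul]; abel
  rw [h4, norm_smul]
  refine (mul_le_of_le_one_right (norm_nonneg _) (norm_isStarProjection_le_one hP)).trans ?_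
  have h5 : blaschke w z - Complex.exp x =
      (blaschke w z - 1 - x) - (Complex.exp x - 1 - x) := by ring
  rw [h5]
  refine (norm_sub_le _ _).trans ((add_le_add h1 h2).trans_eq ?_)
  rw [factorBound]; ring

/-- In each error `(1 - |w|)²` one power is at most `η`, and the other powers sum to the total
length. -/
theorem norm_prod_bpFactor_sub_prod_expFactor_le {z : ℂ} (hz : ‖z‖ < 1) {η : ℝ}
    (l : List (ℂ × Mat n)) (h0 : ∀ p ∈ l, p.1 ≠ 0) (h1 : ∀ p ∈ l, ‖p.1‖ ≤ 1)
    (hP : ∀ p ∈ l, IsStarProjection p.2) (hη : ∀ p ∈ l, 1 - ‖p.1‖ ≤ η) :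
    ‖(l.map fun p => bpFactor p.1 p.2 z).prod‖ ≤ 1 ∧
    ‖(l.map fun p => bpFactor p.1 p.2 z).prod - ((l.map toStep).map fun p =>
        expFactor (herglotz z p.ang * ((p.len : ℝ) : ℂ)) p.proj).prod‖ ≤
      factorBound z * η * total (l.map toStep) := by
  induction l with
  | nil => simpa [total] using norm_one_le_one
  | cons p l ih =>
    obtain ⟨ih1, ih2⟩ := ih (fun q hq => h0 q (List.mem_cons_of_mem _ hq))
      (fun q hq => h1 q (List.mem_cons_of_mem _ hq))
      (fun q hq => hP q (List.mem_cons_of_mem _ hq))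
      (fun q hq => hη q (List.mem_cons_of_mem _ hq))
    have hp1 := h1 p List.mem_cons_self
    have hpP := hP p List.mem_cons_self
    have hpη := hη p List.mem_cons_self
    have hδ0 : 0 ≤ 1 - ‖p.1‖ := sub_nonneg.2 hp1
    have hb := norm_bpFactor_le_one hp1 hpP hz
    have hd := norm_bpFactor_sub_expFactor_le hz (h0 p List.mem_cons_self) hp1 hpP
    simp only [List.map_cons, List.prod_cons, total_cons]
    set b := (l.map fun p => bpFactor p.1 p.2 z).prod
    set e := ((l.map toStep).map fun p =>
        expFactor (herglotz z p.ang * ((p.len : ℝ) : ℂ)) p.proj).prod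
    change _ ∧ ‖bpFactor p.1 p.2 z * b -
      expFactor (herglotz z (angle p.1) * ((1 - ‖p.1‖ : ℝ) : ℂ)) p.2 * e‖ ≤
        factorBound z * η * (1 - ‖p.1‖ + total (l.map toStep))
    set x := expFactor (herglotz z (angle p.1) * ((1 - ‖p.1‖ : ℝ) : ℂ)) p.2
    have hx : ‖x‖ ≤ 1 := norm_expFactor_le_one hpP (by
      rw [Complex.re_mul_ofReal]
      exact mul_nonpos_of_nonpos_of_nonneg (re_herglotz_nonpos hz _) hδ0)
    refine ⟨(norm_mul_le _ _).trans (mul_le_one₀ hb (norm_nonneg _) ih1), ?_⟩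
    have h2 : bpFactor p.1 p.2 z * b - x * e = (bpFactor p.1 p.2 z - x) * b + x * (b - e) := by
      noncomm_ring
    have h3 : ‖(bpFactor p.1 p.2 z - x) * b‖ ≤ factorBound z * η * (1 - ‖p.1‖) :=
      calc ‖(bpFactor p.1 p.2 z - x) * b‖ ≤ ‖bpFactor p.1 p.2 z - x‖ * ‖b‖ := norm_mul_le _ _
        _ ≤ ‖bpFactor p.1 p.2 z - x‖ := mul_le_of_le_one_right (norm_nonneg _) ih1
        _ ≤ factorBound z * ((1 - ‖p.1‖) * (1 - ‖p.1‖)) := by rw [← sq]; exact hd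
        _ ≤ factorBound z * (η * (1 - ‖p.1‖)) :=
          mul_le_mul_of_nonneg_left (mul_le_mul_of_nonneg_right hpη hδ0) (factorBound_nonneg z)
        _ = _ := by ring
    have h4 : ‖x * (b - e)‖ ≤ factorBound z * η * total (l.map toStep) :=
      (norm_mul_le _ _).trans ((mul_le_of_le_one_left (norm_nonneg _) hx).trans ih2)
    rw [h2]
    refine (norm_add_le _ _).trans ((add_le_add h3 h4).trans_eq (by ring))

/-- A contractive holomorphic function whose determinant has no zeros in the disk is, up to a
constant unitary factor, a multiplicative integral. -/
theorem Contractive.exists_multIntegral {A : ℂ → Mat n} (hA : Contractive A)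
    (h0 : ∀ z ∈ disk, (A z).det ≠ 0) :
    ∃ V ∈ unitaryGroup (Fin n) ℂ, ∃ (L : ℝ) (E : ℝ → Mat n) (θ : ℝ → ℝ),
      0 ≤ L ∧ IncreasingOn E 0 L ∧ (∀ t ∈ Icc 0 L, (E t).trace = (t : ℂ)) ∧
      (∀ t ∈ Icc 0 L, θ t ∈ Icc 0 (2 * Real.pi)) ∧ MonotoneOn θ (Icc 0 L) ∧
      (∀ t ∈ Icc 0 L, ContinuousWithinAt θ (Icc t L) t) ∧
      ∀ z ∈ disk, ∃ M : Mat n,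
        IsMultIntegral 0 L (fun t => herglotz z (θ t)) E M ∧ A z = V * M := by
  have : ((atTop : Filter ℕ).curry (atTop : Filter ℕ)).NeBot := by
    refine ⟨fun h => ?_⟩
    have h1 : ∀ᶠ _ in (atTop : Filter ℕ).curry (atTop : Filter ℕ), False := h ▸ eventually_bot
    rw [eventually_curry_iff] at h1
    obtain ⟨_, ha⟩ := h1.exists
    exact ha.exists.elim fun _ => id
  set 𝒰 : Ultrafilter (ℕ × ℕ) := Ultrafilter.of ((atTop : Filter ℕ).curry (atTop : Filter ℕ))
  have hle : (𝒰 : Filter (ℕ × ℕ)) ≤ (atTop : Filter ℕ).curry (atTop : Filter ℕ) :=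
    Ultrafilter.of_le _
  have hspec := fun i => hA.innerApprox_spec i
  have hlim : ∀ z ∈ disk, Tendsto (fun i => innerApprox A i z) 𝒰 (𝓝 (A z)) :=
    fun z hz => (hA.tendsto_innerApprox hz).mono_left hle
  have hdet : ∀ z ∈ disk, Tendsto (fun i => (innerApprox A i z).det) 𝒰 (𝓝 (A z).det) :=
    fun z hz => ((continuous_id.matrix_det).tendsto (A z)).comp (hlim z hz)
  have h0d : (0 : ℂ) ∈ disk := Metric.mem_ball_self one_pos
  -- Eventually the determinants of the approximants exceed `c` in modulus at 0, which bounds all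
  -- total lengths by `Λ = -log c`.
  set c := ‖(A 0).det‖ / 2 with hc
  have hc0 : 0 < c := half_pos (norm_pos_iff.2 (h0 0 h0d))
  have hev : ∀ᶠ i in (𝒰 : Filter (ℕ × ℕ)), c < ‖(innerApprox A i 0).det‖ :=
    (hdet 0 h0d).norm.eventually (lt_mem_nhds (half_lt_self (norm_pos_iff.2 (h0 0 h0d))))
  have hfac : ∀ i, ∃ (U : Mat n) (l : List (ℂ × Mat n)), c < ‖(innerApprox A i 0).det‖ →
      U ∈ unitaryGroup (Fin n) ℂ ∧ IsFactorList (fun z => (innerApprox A i z).det) l ∧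
      (∀ z ∈ disk, innerApprox A i z = U * (l.map fun p => bpFactor p.1 p.2 z).prod) ∧
      ‖(innerApprox A i 0).det‖ = (l.map fun p => ‖p.1‖).prod := by
    intro i
    by_cases hi : c < ‖(innerApprox A i 0).det‖
    · obtain ⟨U, hU, l, hl⟩ := (hspec i).1.exists_finite_factorization (hspec i).2
        (norm_pos_iff.1 (hc0.trans hi))
      exact ⟨U, l, fun _ => ⟨hU, hl⟩⟩
    · exact ⟨1, [], fun h => absurd h hi⟩
  choose U l hUl using hfac
  set Λ := -Real.log c with hΛ
  have hne : ∀ i, c < ‖(innerApprox A i 0).det‖ → ∀ p ∈ l i, p.1 ≠ 0 := by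
    intro i hi p hp hp0
    have h1 := (hUl i hi).2.2.2
    have h2 : ((l i).map fun p => ‖p.1‖).prod = 0 :=
      List.prod_eq_zero_iff.2 (List.mem_map.2 ⟨p, hp, by rw [hp0, norm_zero]⟩)
    linarith
  have htot : ∀ i, c < ‖(innerApprox A i 0).det‖ → total ((l i).map toStep) ≤ Λ := by
    intro i hi
    refine (total_map_toStep_le (l i) (hne i hi)).trans ?_
    rw [← (hUl i hi).2.2.2]
    exact neg_le_neg (Real.log_le_log hc0 hi.le)
  refine exists_multIntegral_of_tendsto 𝒰 (l := fun i => (l i).map toStep) (U := U) (Λ := Λ)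
    (hev.mono fun i hi => ⟨(hUl i hi).2.1.validSteps, htot i hi⟩)
    (hev.mono fun i hi => (hUl i hi).1) fun z hz => ?_
  have hz1 : ‖z‖ < 1 := mem_ball_zero_iff.1 hz
  have hdiff : Tendsto (fun i => innerApprox A i z -
      U i * cocycle (herglotz z) ((l i).map toStep) 0 Λ) 𝒰 (𝓝 0) := by
    rw [NormedAddGroup.tendsto_nhds_zero]
    intro ε hε
    set κ := factorBound z * |Λ| + 1 with hκ
    have hκ0 : 0 < κ := add_pos_of_nonneg_of_pos
      (mul_nonneg (factorBound_nonneg z) (abs_nonneg Λ)) one_pos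
    -- Eventually no zero lies within radius `1 - ε / κ`, so each step has length at most `ε / κ`.
    -- The summand 1 in `κ` makes it positive and the final inequality strict.
    have hzeros := eventually_ne_zero_of_tendsto (F := (𝒰 : Filter (ℕ × ℕ)))
      (fun i => (hspec i).1.det_diff) (fun i z hz => (hspec i).1.norm_det_le hz) hdet h0
      (ρ := 1 - ε / κ) (sub_lt_self _ (div_pos hε hκ0))
    filter_upwards [hev, hzeros] with i hi hzi
    obtain ⟨hU, hf, hprod, -⟩ := hUl i hi
    have hη : ∀ p ∈ l i, 1 - ‖p.1‖ ≤ ε / κ := by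
      intro p hp
      by_contra! hlt
      exact hzi p.1 (mem_closedBall_zero_iff.2 (by linarith)) (hf.zero_eq p hp)
    have hest := (norm_prod_bpFactor_sub_prod_expFactor_le hz1 (l i) (hne i hi)
      (fun p hp => (mem_ball_zero_iff.1 (hf.zero_mem p hp)).le) hf.proj hη).2
    rw [hprod z hz, cocycle_eq_prod _ hf.validSteps le_rfl (htot i hi), ← mul_sub]
    refine ((norm_mul_le _ _).trans (mul_le_of_le_one_left (norm_nonneg _)
      (norm_le_one_of_mem_unitaryGroup hU))).trans_lt (hest.trans_lt ?_)
    have h2 : total ((l i).map toStep) ≤ |Λ| := (htot i hi).trans (le_abs_self Λ)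
    calc factorBound z * (ε / κ) * total ((l i).map toStep)
        ≤ factorBound z * (ε / κ) * |Λ| := mul_le_mul_of_nonneg_left h2
          (mul_nonneg (factorBound_nonneg z) (div_pos hε hκ0).le)
      _ = (κ - 1) * (ε / κ) := by rw [hκ]; ring
      _ < κ * (ε / κ) := mul_lt_mul_of_pos_right (by linarith) (div_pos hε hκ0)
      _ = ε := mul_div_cancel₀ _ hκ0.ne'
  simpa using (hlim z hz).sub hdiff

end Representation

end Potapov

end

theorem mainTheorem2 (n : ℕ) (A : ℂ → Potapov.Mat n) (hA : Potapov.IsSchur A) :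
    ∃ (B : Potapov.BPProduct n) (F : ℂ → Potapov.Mat n) (L : ℝ) (E : ℝ → Potapov.Mat n)
      (θ : ℝ → ℝ),
      B.CorrespondsToZeros (fun z => (A z).det) ∧
      B.ConvergesTo F ∧
      0 ≤ L ∧
      Potapov.IncreasingOn E 0 L ∧
      (∀ t ∈ Set.Icc 0 L, (E t).trace = (t : ℂ)) ∧
      (∀ t ∈ Set.Icc 0 L, θ t ∈ Set.Icc 0 (2 * Real.pi)) ∧
      MonotoneOn θ (Set.Icc 0 L) ∧
      (∀ t ∈ Set.Icc 0 L, ContinuousWithinAt θ (Set.Icc t L) t) ∧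
      ∀ z ∈ Potapov.disk, ∃ M : Potapov.Mat n,
        Potapov.IsMultIntegral 0 L (fun t => Potapov.herglotz z (θ t)) E M ∧
        A z = F z * M := by
  obtain ⟨F, A', hA', hdet, hfac, hB⟩ := hA.toContractive.exists_bpProduct hA.det_ne_zero
  obtain ⟨V, hV, L, E, θ, hL, hE, htr, hθ, hmono, hcont, hM⟩ := hA'.exists_multIntegral hdet
  -- The unitary constant of the zero-free part becomes the right constant of the Blaschke–Potapov
  -- product.
  obtain ⟨B, hzeros, hconv⟩ := hB V hV
  refine ⟨B, fun z => F z * V, L, E, θ, hzeros, hconv, hL, hE, htr, hθ, hmono, hcont,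
    fun z hz => ?_⟩
  obtain ⟨M, hinteg, hzM⟩ := hM z hz
  exact ⟨M, hinteg, by rw [hfac z hz, hzM, mul_assoc]⟩
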